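/- **Setting.** There are $n\ge 1$ agents. Agent $i$ has a private value $v_i\in[0,v_{\max}]$ for being served, drawn independently from a probability distribution $F_i$ on $[0,v_{\max}]$; $\mathbf F=F_1\times\dots\times F_n$, and $\mu_{\max}=\max_i \mathbf E[v_i]>0$. An allocation is a vector $x\in\{0,1\}^n$, and $c(x)\in(-\infty,+\infty]$ is an arbitrary cost function. A (randomized) algorithm $\mathcal A$ maps value profiles to (random) allocations $x(\mathbf v)$; its expected welfare, also denoted $\mathcal A$, is $\mathbf E_{\mathbf v\sim\mathbf F}\big[\sum_i v_i x_i(\mathbf v)-c(x(\mathbf v))\big]$. Its interim allocation rule $x_i(z)$ is the probability that $i$ is served when $v_i=z$ and the other values are drawn from their distributions. The algorithm is *$\delta$-BIC* if, with the interim payments $p_i(z)=z\,x_i(z)-\int_0^z x_i(t)\,dt$, $$z\,x_i(z)-p_i(z)\;\ge\; z\,x_i(z')-p_i(z')-\delta\qquad\text{for all } i,\ z\in[0,v_{\max}],\ z'\ge 0 .$$ **Oracle model.** A computation knows $n,\varepsilon,v_{\max},\mu_{\max}$ and the bids, and may (adaptively, and with private randomness) call $\mathcal A$ on any profile, receiving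 the allocation selected, and ask for a sample of $F_i$ conditioned on any interval $I$ (the answer reports if $F_i(I)=0$). It has no other access to $\mathcal A$ or $\mathbf F$. Running time is the number of calls to $\mathcal A$. **Theorem.** There are a single black-box procedure and absolute constants $C,d$ such that for every $n$, $\varepsilon>0$, $v_{\max}$, $\mathbf F$, $c$ and $\mathcal A$ as above, the procedure, run with oracles $\mathcal A$ and $\mathbf F$, is a randomized algorithm $\mathcal A'$ such that 1. $\mathcal A'$ is $\varepsilon v_{\max}$-BIC; 2. $\mathcal A'\ge\mathcal A-\varepsilon\mu_{\max}$; 3. on every bid profile the running time of $\mathcal A'$ is $\tilde O\big(n^3\varepsilon^{-2}\log_{1+\varepsilon}(v_{\max}/\varepsilon\mu_{\max})\big)$: with $$T=1+n^3\varepsilon^{-2}\max\{1,\log_{1+\varepsilon}(v_{\max}/(\varepsilon\mu_{\max}))\},$$ it makes at most $C\,T\,(\log(2+T))^{d}$ calls to $\mathcal A$ in the worst case, and at most $C\,T^{d}$ calls to the distribution oracle. -/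

import Mathlib

open MeasureTheory ProbabilityTheory Set

noncomputable section

namespace BayesMech

/-- A valuation (or bid) profile of `n` agents. -/
abbrev Profile (n : ℕ) : Type := Fin n → ℝ

/-- A binary allocation: `a i = true` means that agent `i` is served. -/
abbrev Allocation (n : ℕ) : Type := Fin n → Bool

/-- A (randomized) algorithm: the law of the selected allocation, for every valuation profile. -/
abbrev Algorithm (n : ℕ) : Type := Kernel (Profile n) (Allocation n)

variable {n : ℕ}

/-- The interim allocation rule `x_i(z)`: the probability that agent `i` is served when its
value is `z` and the other values are drawn from the product distribution. -/
def interimAlloc (D : Fin n → Measure ℝ) (A : Algorithm n) (i : Fin n) (z : ℝ) : ℝ :=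
  ∫ v, (A (Function.update v i z)).real {a | a i = true} ∂(Measure.pi D)

/-- The largest expected valuation of an agent. -/
def muMax (D : Fin n → Measure ℝ) : ℝ := ⨆ i, ∫ x, x ∂(D i)

/-- The expected total value `E[∑ i, v_i x_i(v)]`. -/
def expectedValue (D : Fin n → Measure ℝ) (A : Algorithm n) : ℝ :=
  ∫ v, ∑ i, v i * (A v).real {a | a i = true} ∂(Measure.pi D)

/-- The expected cost `E[c(x(v))]`, where costs may be infinite. -/
def expectedCost (D : Fin n → Measure ℝ) (c : Allocation n → EReal) (A : Algorithm n) : EReal :=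
  ∑ a : Allocation n, (((Measure.pi D).bind A {a} : ENNReal) : EReal) * c a

/-- The expected social welfare `E[∑ i, v_i x_i(v) - c(x(v))]`. -/
def welfare (D : Fin n → Measure ℝ) (c : Allocation n → EReal) (A : Algorithm n) : EReal :=
  (expectedValue D A : EReal) - expectedCost D c A

/-- A mechanism: an allocation rule and a payment rule. `pay v i` is the expectation, over the
mechanism's randomness, of the payment of agent `i` when the bids are `v`. -/
structure Mechanism (n : ℕ) where
  alloc : Algorithm n
  pay : Profile n → Fin n → ℝ

/-- The interim payment rule `p_i(z)`. -/
def Mechanism.interimPay (D : Fin n → Measure ℝ) (M : Mechanism n) (i : Fin n) (z : ℝ) : ℝ :=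
  ∫ v, M.pay (Function.update v i z) i ∂(Measure.pi D)

/-- `δ`-Bayesian incentive compatibility: when the others are truthful, an agent with a value
`z` in `[0, vmax]` gains at most `δ` by any other nonnegative bid `z'`. -/
def Mechanism.IsBIC (D : Fin n → Measure ℝ) (vmax δ : ℝ) (M : Mechanism n) : Prop :=
  ∀ i : Fin n, ∀ z ∈ Icc (0 : ℝ) vmax, ∀ z' : ℝ, 0 ≤ z' →
    z * interimAlloc D M.alloc i z' - M.interimPay D i z' - δ
      ≤ z * interimAlloc D M.alloc i z - M.interimPay D i z

/-- The mechanism that runs `A` and charges `p_i(z) = z x_i(z) - ∫_0^z x_i(t) dt`. -/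
def withPayments (D : Fin n → Measure ℝ) (A : Algorithm n) : Mechanism n where
  alloc := A
  pay v i := v i * interimAlloc D A i (v i) - ∫ t in (0 : ℝ)..(v i), interimAlloc D A i t

/-- An algorithm is `δ`-BIC if it is so together with the payment rule above. -/
def IsBICAlgorithm (D : Fin n → Measure ℝ) (vmax δ : ℝ) (A : Algorithm n) : Prop :=
  (withPayments D A).IsBIC D vmax δ

/-- A terminating computation in the oracle model, as an interaction tree. It may
* stop and output an allocation,
* call the algorithm oracle on any profile and receive the allocation that it selects,
* ask for a sample of the value of agent `i` conditioned on an interval `I`; the answer is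
  `none` if and only if `I` has probability zero,
* draw a private uniform random number from `[0, 1]`. -/
inductive OracleProgram (n : ℕ) : Type where
  | output (a : Allocation n) : OracleProgram n
  | query (v : Profile n) (next : Allocation n → OracleProgram n) : OracleProgram n
  | sample (i : Fin n) (I : Set ℝ) (hI : I.OrdConnected) (next : Option ℝ → OracleProgram n) :
      OracleProgram n
  | coin (next : ℝ → OracleProgram n) : OracleProgram n

namespace OracleProgram

open Classical in
/-- The law of the output when the oracles are `A` and `D`; every oracle answer is drawn
afresh. (A computation whose steps are not measurable loses mass here, so that its law is not a
probability measure.) -/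
def law (D : Fin n → Measure ℝ) (A : Algorithm n) : OracleProgram n → Measure (Allocation n)
  | output a => Measure.dirac a
  | query v next => (A v).bind fun a => law D A (next a)
  | sample i I _ next =>
      if D i I = 0 then law D A (next none)
      else (cond (D i) I).bind fun x => law D A (next (some x))
  | coin next => (volume.restrict (Icc (0 : ℝ) 1)).bind fun u => law D A (next u)

/-- The number of calls to the algorithm oracle, in the worst case over all answers. -/
def algCalls : OracleProgram n → ℕ∞
  | output _ => 0
  | query _ next => 1 + ⨆ a, algCalls (next a)
  | sample _ _ _ next => ⨆ r, algCalls (next r)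
  | coin next => ⨆ u, algCalls (next u)

/-- The number of calls to the distribution oracle, in the worst case over all answers. -/
def distCalls : OracleProgram n → ℕ∞
  | output _ => 0
  | query _ next => ⨆ a, distCalls (next a)
  | sample _ _ _ next => 1 + ⨆ r, distCalls (next r)
  | coin next => ⨆ u, distCalls (next u)

end OracleProgram

/-- A black-box reduction: from the number of agents, `ε`, `vmax`, `μmax` and the bids it forms
a computation in the oracle model. It sees the algorithm and the distributions only through
the oracles, and it does not see the costs. -/
abbrev Reduction : Type :=
  (n : ℕ) → (ε vmax μmax : ℝ) → Profile n → OracleProgram n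

/-- `1 + n³ ε⁻² max(1, log_{1+ε}(vmax / (ε μmax)))`. -/
def callScale (n : ℕ) (ε vmax μmax : ℝ) : ℝ :=
  1 + (n : ℝ) ^ 3 * (ε⁻¹) ^ 2 * max 1 (Real.logb (1 + ε) (vmax / (ε * μmax)))

end BayesMech

end

open BayesMech

set_option linter.unusedSectionVars false

noncomputable section

/-! ### Sequential composition of measures and finite products. -/

namespace MeasureTheory.Measure

variable {α β γ : Type*} [MeasurableSpace α] [MeasurableSpace β] [MeasurableSpace γ]

/-! The reduction replaces every bid by a fresh sample of `F_i` conditioned on a pool, an interval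
containing the bid, and then calls the algorithm once on the new profile. The pools of an agent are
drawn independently of its bid, so resampling preserves `F_i` (`bind_poolKernel`). Hence the other
agents look unchanged, and the new interim allocation of an agent at `z` is the old one averaged
over the pool of `z` (`interimAlloc_comp_resample`). The law of the allocation is also unchanged, so
the expected cost stays the same even if it is infinite, and only the sum over agents of `E[z
x_i(z)]` has to be controlled (`welfare_comp_resample`). By Myerson's area argument, an interim
allocation that is monotone up to `ε` and constant above `vmax` is `ε vmax`-BIC
(`isBICAlgorithm_of_almost_monotone`). It remains to choose, agent by agent, pools whose averages
are nearly increasing and which lose little value.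

Values are rounded to geometric buckets of ratio `1 + η` with `η = ε / (16 n)`, the smallest of
which holds everything up to `η μ`. For exactly known bucket averages, ironing works: as long as
some pool has an average at least that of the next one, merge them. The averages end up increasing,
and every initial segment of a pool has at least the average of the pool (`exists_ironing`). By Abel
summation against the increasing bucket values, pooling then loses nothing. Both facts survive
estimation errors: near monotonicity needs each bucket average only up to order `ε`, whereas the
welfare bound needs the finer accuracy `η` only for the tail sums `∑_{b ≥ t} w_b x_b`, relative to
the tail weight `Q_t` plus a small `q` (`Supported.slope_le_slope`, `Supported.sum_le_pooled`).

This asymmetry gives the call bound. With `m_0` of order `n ε⁻² log`, bucket `c` receives about `m_0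
(1 + n w_c / Q_c)` trials, so that the variance of a tail sum is at most `∑_{c ≥ t} w_c² / m_c ≤
(Q_t + q)² / (n m_0)`, which is what accuracy `η` requires. The hazards `w_c / Q_c` add up to at
most about `log (n / q)` before `Q_c` falls below `q / n`, after which the extra trials are
unnecessary (`sum_trials_le`, `weight_le_trials`). One agent thus costs about `m_0 (K + n log (n /
q))` calls for `K` buckets, and all `n` agents together cost `n³ ε⁻²` times logarithmic factors. The
bucket probabilities are estimated from the distribution oracle alone, for which any polynomial
bound suffices. -/

theorem measurable_bind_prodMk (ν : Measure β) [SFinite ν] {g : α × β → Measure γ}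
    (hg : Measurable g) : Measurable fun a => ν.bind fun b => g (a, b) := by
  refine measurable_of_measurable_coe _ fun s hs => ?_
  have h : (fun a => (ν.bind fun b => g (a, b)) s) = fun a => ∫⁻ b, g (a, b) s ∂ν := by
    funext a
    exact bind_apply hs (hg.comp measurable_prodMk_left).aemeasurable
  rw [h]
  exact ((measurable_coe hs).comp hg).lintegral_prod_right'

theorem prod_bind (μ : Measure α) (ν : Measure β) [SFinite ν] {g : α × β → Measure γ}
    (hg : Measurable g) :
    (μ.prod ν).bind g = μ.bind fun a => ν.bind fun b => g (a, b) := by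
  ext s hs
  rw [bind_apply hs hg.aemeasurable, bind_apply hs (measurable_bind_prodMk ν hg).aemeasurable,
    lintegral_prod (fun p => g p s) ((measurable_coe hs).comp hg).aemeasurable]
  refine lintegral_congr fun a => ?_
  exact (bind_apply hs (hg.comp measurable_prodMk_left).aemeasurable).symm

theorem map_bind {f : α → β} (hf : Measurable f) (μ : Measure α) {g : β → Measure γ}
    (hg : Measurable g) : (μ.map f).bind g = μ.bind fun a => g (f a) := by
  ext s hs
  rw [bind_apply hs hg.aemeasurable,
    bind_apply (f := fun a => g (f a)) hs (hg.comp hf).aemeasurable]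
  exact lintegral_map ((measurable_coe hs).comp hg) hf

theorem measurable_finCons {m : ℕ} :
    Measurable fun p : α × (Fin m → α) => Fin.cons (α := fun _ => α) p.1 p.2 := by
  refine measurable_pi_lambda _ fun j => ?_
  refine Fin.cases ?_ (fun j => ?_) j
  · exact measurable_fst
  · exact (measurable_pi_apply j).comp measurable_snd

/-- Independent coordinates can be drawn one after the other; this is the inductive step of
`HasLaw.collect`. -/
theorem pi_succ_bind {m : ℕ} (μ : Fin (m + 1) → Measure α) [∀ j, SigmaFinite (μ j)]
    {g : (Fin (m + 1) → α) → Measure γ} (hg : Measurable g) :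
    (Measure.pi μ).bind g =
      (μ 0).bind fun a => (Measure.pi fun j : Fin m => μ j.succ).bind fun r =>
        g (Fin.cons (α := fun _ => α) a r) := by
  have h := (measurePreserving_piFinSuccAbove μ 0).symm
  have hf : ⇑(MeasurableEquiv.piFinSuccAbove (fun _ : Fin (m + 1) => α) 0).symm
      = fun p : α × (Fin m → α) => Fin.cons (α := fun _ => α) p.1 p.2 := by
    funext p
    exact Fin.insertNth_zero' p.1 p.2
  have h2 := h.map_eq
  rw [hf] at h2
  simp only [Fin.zero_succAbove] at h2
  rw [← h2, map_bind measurable_finCons _ hg]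
  have h3 := prod_bind (μ 0) (Measure.pi fun j => μ j.succ)
    (g := fun p => g (Fin.cons (α := fun _ => α) p.1 p.2)) (hg.comp measurable_finCons)
  convert h3

end MeasureTheory.Measure

/-! ### Oracle computations, their laws and their call counts. -/

namespace BayesMech

variable {n : ℕ}

/-- A computation in the oracle model that returns a value of type `α`, in
continuation-passing style. -/
abbrev Proc (n : ℕ) (α : Type) : Type := (α → OracleProgram n) → OracleProgram n

namespace Proc

variable {α β : Type}

/-- The returned value of `c` has the law `μ`. -/
def HasLaw [MeasurableSpace α] (D : Fin n → Measure ℝ) (A : Algorithm n) (c : Proc n α)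
    (μ : Measure α) : Prop :=
  ∀ k : α → OracleProgram n, (Measurable fun a => (k a).law D A) →
    (c k).law D A = μ.bind fun a => (k a).law D A

/-- `c` makes at most `N` calls to the algorithm oracle and `M` calls to the distribution
oracle. -/
def CallsLE (c : Proc n α) (N M : ℕ) : Prop :=
  ∀ (k : α → OracleProgram n) (B B' : ℕ∞), (∀ a, (k a).algCalls ≤ B) →
    (∀ a, (k a).distCalls ≤ B') → (c k).algCalls ≤ N + B ∧ (c k).distCalls ≤ M + B'

/-- The computation that returns `a` without any oracle calls. -/
def ret (a : α) : Proc n α := fun k => k a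

/-- Sequential composition. -/
def andThen (c : Proc n α) (f : α → Proc n β) : Proc n β := fun k => c fun a => f a k

/-- Apply a function to the returned value. -/
def mapProc (f : α → β) (c : Proc n α) : Proc n β := fun k => c fun a => k (f a)

/-- Run finitely many computations and collect the returned values. -/
def collect : (m : ℕ) → (Fin m → Proc n α) → Proc n (Fin m → α)
  | 0, _ => fun k => k Fin.elim0
  | m + 1, c => fun k => c 0 fun a => collect m (fun j => c j.succ) fun r => k (Fin.cons (α := fun _ => α) a r)

theorem CallsLE.mono {c : Proc n α} {N M N' M' : ℕ} (h : CallsLE c N M) (hN : N ≤ N')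
    (hM : M ≤ M') : CallsLE c N' M' := by
  intro k B B' h1 h2
  obtain ⟨h3, h4⟩ := h k B B' h1 h2
  exact ⟨h3.trans (by gcongr), h4.trans (by gcongr)⟩

theorem callsLE_ret (a : α) : CallsLE (ret a : Proc n α) 0 0 := by
  intro k B B' h1 h2
  simpa [ret] using ⟨h1 a, h2 a⟩

theorem CallsLE.andThen {c : Proc n α} {f : α → Proc n β} {N M N' M' : ℕ} (h : CallsLE c N M)
    (hf : ∀ a, CallsLE (f a) N' M') : CallsLE (c.andThen f) (N + N') (M + M') := by
  intro k B B' h1 h2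
  have := h (fun a => f a k) (N' + B) (M' + B') (fun a => (hf a k B B' h1 h2).1)
    (fun a => (hf a k B B' h1 h2).2)
  simpa [Proc.andThen, add_assoc] using this

theorem CallsLE.mapProc {c : Proc n α} {N M : ℕ} (h : CallsLE c N M) (f : α → β) :
    CallsLE (c.mapProc f) N M :=
  fun _ B B' h1 h2 => h _ B B' (fun a => h1 (f a)) fun a => h2 (f a)

theorem CallsLE.collect {m : ℕ} {c : Fin m → Proc n α} {N M : Fin m → ℕ}
    (h : ∀ j, CallsLE (c j) (N j) (M j)) : CallsLE (collect m c) (∑ j, N j) (∑ j, M j) := by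
  induction m with
  | zero =>
    intro k B B' h1 h2
    simpa [Proc.collect] using ⟨h1 _, h2 _⟩
  | succ m ih =>
    intro k B B' h1 h2
    have key : ∀ a, _ := fun a => ih (c := fun j => c j.succ) (fun j => h j.succ)
      (fun r => k (Fin.cons (α := fun _ => α) a r)) B B' (fun r => h1 _) (fun r => h2 _)
    have := h 0 _ _ _ (fun a => (key a).1) (fun a => (key a).2)
    rw [Fin.sum_univ_succ, Fin.sum_univ_succ]
    push_cast at this ⊢
    simpa [Proc.collect, add_assoc] using this

section law

variable [MeasurableSpace α] [MeasurableSpace β] {D : Fin n → Measure ℝ} {A : Algorithm n}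

theorem hasLaw_ret (a : α) : HasLaw D A (ret a) (Measure.dirac a) := by
  intro k hk
  rw [Measure.dirac_bind hk]
  rfl

theorem HasLaw.andThen {c : Proc n α} {f : α → Proc n β} {μ : Measure α} {ν : α → Measure β}
    (hc : HasLaw D A c μ) (hf : ∀ a, HasLaw D A (f a) (ν a)) (hν : Measurable ν) :
    HasLaw D A (c.andThen f) (μ.bind ν) := by
  intro k hk
  have h1 : (fun a => (f a k).law D A) = fun a => (ν a).bind fun b => (k b).law D A :=
    funext fun a => hf a k hk
  -- `hc` only speaks about continuations with a measurable law; the explicit form `h1` supplies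
  -- this.
  have h2 : Measurable fun a => (f a k).law D A := by
    rw [h1]
    exact (Measure.measurable_bind' hk).comp hν
  rw [Proc.andThen, hc _ h2, h1, Measure.bind_bind hν.aemeasurable hk.aemeasurable]

theorem HasLaw.mapProc {c : Proc n α} {μ : Measure α} (hc : HasLaw D A c μ) {f : α → β}
    (hf : Measurable f) : HasLaw D A (c.mapProc f) (μ.map f) := by
  intro k hk
  rw [Measure.map_bind hf _ hk]
  exact hc _ (hk.comp hf)

theorem HasLaw.collect {m : ℕ} {c : Fin m → Proc n α} {μ : Fin m → Measure α}
    [∀ j, IsProbabilityMeasure (μ j)] (h : ∀ j, HasLaw D A (c j) (μ j)) :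
    HasLaw D A (collect m c) (Measure.pi μ) := by
  induction m with
  | zero =>
    intro k hk
    rw [Measure.pi_of_empty μ Fin.elim0, Measure.dirac_bind hk]
    rfl
  | succ m ih =>
    intro k hk
    have h1 : ∀ a, (Proc.collect m (fun j => c j.succ) fun r => k (Fin.cons (α := fun _ => α) a r)).law D A
        = (Measure.pi fun j : Fin m => μ j.succ).bind fun r => (k (Fin.cons (α := fun _ => α) a r)).law D A :=
      fun a => ih (fun j => h j.succ) _ (hk.comp (Measure.measurable_finCons.comp measurable_prodMk_left))
    have h2 : Measurable fun a =>
        (Proc.collect m (fun j => c j.succ) fun r => k (Fin.cons (α := fun _ => α) a r)).law D A := by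
      rw [funext h1]
      exact Measure.measurable_bind_prodMk (g := fun p => (k (Fin.cons (α := fun _ => α) p.1 p.2)).law D A) _
        (hk.comp Measure.measurable_finCons)
    rw [Measure.pi_succ_bind μ hk]
    refine (h 0 _ h2).trans ?_
    rw [funext h1]

end law

/-- Sample the value of agent `i` conditioned on `I`; the result is `x₀` if this is
impossible. -/
def draw (i : Fin n) (I : Set ℝ) (hI : I.OrdConnected) (x₀ : ℝ) : Proc n ℝ :=
  fun k => OracleProgram.sample i I hI fun r => k (r.getD x₀)

/-- Call the algorithm oracle. -/
def call (v : Profile n) : Proc n (Allocation n) := fun k => OracleProgram.query v k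

theorem callsLE_draw (i : Fin n) (I : Set ℝ) (hI : I.OrdConnected) (x₀ : ℝ) :
    CallsLE (draw i I hI x₀) 0 1 := by
  intro k B B' h1 h2
  simp only [draw, OracleProgram.algCalls, OracleProgram.distCalls]
  refine ⟨by simpa using fun r => h1 _, ?_⟩
  push_cast
  gcongr
  exact iSup_le fun r => h2 _

theorem callsLE_call (v : Profile n) : CallsLE (call v) 1 0 := by
  intro k B B' h1 h2
  simp only [call, OracleProgram.algCalls, OracleProgram.distCalls]
  refine ⟨?_, by simpa using fun r => h2 _⟩
  push_cast
  gcongr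
  exact iSup_le fun r => h1 _

/-- The law of a value conditioned on `I`, with default value `x₀`. -/
def condLaw (F : Measure ℝ) (I : Set ℝ) (x₀ : ℝ) : Measure ℝ :=
  open Classical in if F I = 0 then Measure.dirac x₀ else cond F I

instance (F : Measure ℝ) [IsFiniteMeasure F] (I : Set ℝ) (x₀ : ℝ) :
    IsProbabilityMeasure (condLaw F I x₀) := by
  unfold condLaw
  split_ifs with h
  · infer_instance
  · exact cond_isProbabilityMeasure h

theorem hasLaw_draw (D : Fin n → Measure ℝ) (A : Algorithm n) (i : Fin n) (I : Set ℝ)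
    (hI : I.OrdConnected) (x₀ : ℝ) :
    HasLaw D A (draw i I hI x₀) (condLaw (D i) I x₀) := by
  intro k hk
  simp only [draw, OracleProgram.law, condLaw]
  split_ifs with h
  · rw [Measure.dirac_bind hk]
    rfl
  · rfl

theorem hasLaw_call (D : Fin n → Measure ℝ) (A : Algorithm n) (v : Profile n) :
    HasLaw D A (call v) (A v) := by
  intro k hk
  simp only [call, OracleProgram.law]

end Proc

end BayesMech

/-! ### Resampling of values, interim allocations and approximate incentive compatibility. -/

namespace BayesMech


variable {n : ℕ}

theorem measurable_update_prod (i : Fin n) :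
    Measurable fun p : ℝ × Profile n => Function.update p.2 i p.1 := by
  refine measurable_pi_lambda _ fun j => ?_
  by_cases h : j = i
  · subst h
    simpa using measurable_fst
  · simp only [Function.update_of_ne h]
    exact (measurable_pi_apply j).comp measurable_snd

instance isProbabilityMeasure_update (D : Fin n → Measure ℝ) [∀ i, IsProbabilityMeasure (D i)]
    (i : Fin n) (ν : Measure ℝ) [IsProbabilityMeasure ν] (j : Fin n) :
    IsProbabilityMeasure (Function.update D i ν j) := by
  by_cases h : j = i
  · subst h
    simpa
  · simpa [h] using inferInstanceAs (IsProbabilityMeasure (D j))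

/-- Checked on boxes: the preimage of a box is the product of its `i`-th side with the box whose
`i`-th side is everything. It turns averages of interim allocations into integrals over a single
product measure. -/
theorem map_update_prod_pi (D : Fin n → Measure ℝ) [∀ i, IsProbabilityMeasure (D i)] (i : Fin n)
    (ν : Measure ℝ) [IsProbabilityMeasure ν] :
    (ν.prod (Measure.pi D)).map (fun p => Function.update p.2 i p.1)
      = Measure.pi (Function.update D i ν) := by
  refine (Measure.pi_eq fun s hs => ?_).symm
  rw [Measure.map_apply (measurable_update_prod i) (MeasurableSet.univ_pi hs)]
  have hpre : (fun p : ℝ × Profile n => Function.update p.2 i p.1) ⁻¹' (univ.pi s)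
      = s i ×ˢ univ.pi (Function.update s i univ) := by
    ext p
    simp only [mem_preimage, mem_pi, mem_univ, true_implies, mem_prod]
    constructor
    · intro h
      refine ⟨by simpa using h i, fun j => ?_⟩
      by_cases hj : j = i
      · subst hj
        simp
      · simpa [hj] using h j
    · rintro ⟨h1, h2⟩ j
      by_cases hj : j = i
      · subst hj
        simpa using h1
      · simpa [hj] using h2 j
  rw [hpre, Measure.prod_prod, Measure.pi_pi, ← Finset.mul_prod_erase _ _ (Finset.mem_univ i),
    ← Finset.mul_prod_erase Finset.univ (fun j => Function.update D i ν j (s j))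
      (Finset.mem_univ i)]
  simp only [Function.update_self, measure_univ, one_mul]
  congr 1
  refine Finset.prod_congr rfl fun j hj => ?_
  have : j ≠ i := Finset.ne_of_mem_erase hj
  simp [this]

/-- Resample the value of every agent independently. -/
def resample (K : Fin n → Kernel ℝ ℝ) [∀ i, IsMarkovKernel (K i)] :
    Kernel (Profile n) (Profile n) where
  toFun v := Measure.pi fun i => K i (v i)
  measurable' := by
    refine Measurable.measure_of_isPiSystem_of_isProbabilityMeasure generateFrom_pi.symm
      isPiSystem_pi ?_
    rintro _ ⟨s, hs, rfl⟩
    simp only [Measure.pi_pi]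
    exact Finset.measurable_fun_prod _ fun i _ =>
      ((K i).measurable_coe (hs i (mem_univ i))).comp (measurable_pi_apply i)

instance (K : Fin n → Kernel ℝ ℝ) [∀ i, IsMarkovKernel (K i)] : IsMarkovKernel (resample K) :=
  ⟨fun v => inferInstanceAs (IsProbabilityMeasure (Measure.pi fun i => K i (v i)))⟩

/-- On a box the resampled mass is a product of functions of separate coordinates, and these are
independent under the product measure. -/
theorem pi_bind_resample (K : Fin n → Kernel ℝ ℝ) [∀ i, IsMarkovKernel (K i)]
    (μ : Fin n → Measure ℝ) [∀ i, IsProbabilityMeasure (μ i)] :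
    (Measure.pi μ).bind (resample K) = Measure.pi fun i => (μ i).bind (K i) := by
  refine (Measure.pi_eq fun s hs => ?_).symm
  rw [Measure.bind_apply (MeasurableSet.univ_pi hs) (resample K).aemeasurable]
  have : ∀ v : Profile n, resample K v (univ.pi s) = ∏ i, K i (v i) (s i) := fun v =>
    Measure.pi_pi _ _
  simp only [this]
  have hm : ∀ i, Measurable fun x => K i x (s i) := fun i => (K i).measurable_coe (hs i)
  rw [lintegral_prod_eq_prod_lintegral_of_indepFun (μ := Measure.pi μ) Finset.univ
    (fun i (v : Profile n) => K i (v i) (s i)) (iIndepFun_pi fun i => (hm i).aemeasurable)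
    fun i => (hm i).comp (measurable_pi_apply i)]
  refine Finset.prod_congr rfl fun i _ => ?_
  rw [Measure.bind_apply (hs i) (K i).aemeasurable]
  exact (measurePreserving_eval μ i).lintegral_comp (hm i)

theorem integral_real_kernel {α β : Type*} [MeasurableSpace α] [MeasurableSpace β] (μ : Measure α)
    [IsProbabilityMeasure μ] (κ : Kernel α β) [IsMarkovKernel κ] {s : Set β}
    (hs : MeasurableSet s) : ∫ v, (κ v).real s ∂μ = (μ.bind κ).real s := by
  rw [Measure.real, Measure.bind_apply hs κ.aemeasurable]
  exact integral_toReal (κ.measurable_coe hs).aemeasurable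
    (Filter.Eventually.of_forall fun v => measure_lt_top _ _)

/-- The event that agent `i` is served. -/
abbrev served (i : Fin n) : Set (Allocation n) := {a | a i = true}

theorem measurable_real_served (A : Algorithm n) (i : Fin n) :
    Measurable fun v => (A v).real (served i) :=
  (A.measurable_coe (MeasurableSet.of_discrete)).ennreal_toReal

section interim

variable (D : Fin n → Measure ℝ) [∀ i, IsProbabilityMeasure (D i)] (A : Algorithm n)
  [IsMarkovKernel A] (i : Fin n)

theorem measurable_interimAlloc : Measurable (interimAlloc D A i) := by
  have : Measurable fun p : ℝ × Profile n => (A (Function.update p.2 i p.1)).real (served i) :=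
    (measurable_real_served A i).comp (measurable_update_prod i)
  exact (this.stronglyMeasurable.integral_prod_right' (ν := Measure.pi D)).measurable

theorem interimAlloc_nonneg (z : ℝ) : 0 ≤ interimAlloc D A i z :=
  integral_nonneg fun _ => measureReal_nonneg

theorem interimAlloc_le_one (z : ℝ) : interimAlloc D A i z ≤ 1 := by
  have h : interimAlloc D A i z ≤ ∫ _, (1 : ℝ) ∂(Measure.pi D) := by
    refine integral_mono_of_nonneg (Filter.Eventually.of_forall fun _ => measureReal_nonneg)
      (integrable_const _) (Filter.Eventually.of_forall fun _ => measureReal_le_one)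
  simpa using h

/-- Fubini for an own value drawn from `ν` and the rest from `D`. The weight `g = 1` yields
probabilities of service, and the identity yields expected value. -/
theorem integral_interimAlloc (ν : Measure ℝ) [IsProbabilityMeasure ν] (g : ℝ → ℝ)
    (hg : Measurable g) (B : ℝ) (hB : ∀ᵐ z ∂ν, |g z| ≤ B) :
    ∫ z, g z * interimAlloc D A i z ∂ν
      = ∫ v, g (v i) * (A v).real (served i) ∂(Measure.pi (Function.update D i ν)) := by
  have hF : Measurable fun v : Profile n => g (v i) * (A v).real (served i) :=
    (hg.comp (measurable_pi_apply i)).mul (measurable_real_served A i)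
  rw [← map_update_prod_pi D i ν, integral_map (measurable_update_prod i).aemeasurable
    hF.aestronglyMeasurable, integral_prod]
  · refine integral_congr_ae (Filter.Eventually.of_forall fun z => ?_)
    simp only [Function.update_self, interimAlloc]
    rw [integral_const_mul]
  · refine Integrable.of_bound (hF.comp (measurable_update_prod i)).aestronglyMeasurable B ?_
    have h1 : ∀ᵐ p ∂(ν.prod (Measure.pi D)), |g p.1| ≤ B :=
      Measure.quasiMeasurePreserving_fst.ae hB
    filter_upwards [h1] with p hp
    simp only [Function.update_self, Real.norm_eq_abs, abs_mul]
    have h2 : |(A (Function.update p.2 i p.1)).real (served i)| ≤ 1 := by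
      rw [abs_of_nonneg measureReal_nonneg]
      exact measureReal_le_one
    exact (mul_le_of_le_one_right (abs_nonneg _) h2).trans hp

theorem interimAlloc_eq (z : ℝ) :
    interimAlloc D A i z
      = ((Measure.pi (Function.update D i (Measure.dirac z))).bind A).real (served i) := by
  rw [← integral_real_kernel _ _ MeasurableSet.of_discrete]
  have h := integral_interimAlloc D A i (Measure.dirac z) (fun _ => 1) measurable_const 1 (by simp)
  simp only [one_mul] at h
  rw [← h, integral_dirac' _ _ (measurable_interimAlloc D A i).stronglyMeasurable]

theorem integral_interimAlloc_eq (ν : Measure ℝ) [IsProbabilityMeasure ν] :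
    ∫ z, interimAlloc D A i z ∂ν
      = ((Measure.pi (Function.update D i ν)).bind A).real (served i) := by
  rw [← integral_real_kernel _ _ MeasurableSet.of_discrete]
  have h := integral_interimAlloc D A i ν (fun _ => 1) measurable_const 1 (by simp)
  simpa only [one_mul] using h

/-- The others are still distributed as before once they have been resampled, so the only visible
effect is that the own value `z` is replaced by a draw from `K i z`. -/
theorem interimAlloc_comp_resample (K : Fin n → Kernel ℝ ℝ) [∀ i, IsMarkovKernel (K i)]
    (hK : ∀ j, (D j).bind (K j) = D j) (z : ℝ) :
    interimAlloc D (A ∘ₖ resample K) i z = ∫ w, interimAlloc D A i w ∂(K i z) := by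
  rw [interimAlloc_eq, integral_interimAlloc_eq]
  congr 1
  have h : ⇑(A ∘ₖ resample K) = fun v => (resample K v).bind A :=
    funext fun v => Kernel.comp_apply _ _ _
  rw [h, ← Measure.bind_bind (resample K).aemeasurable A.aemeasurable, pi_bind_resample]
  congr 2
  funext j
  by_cases hj : j = i
  · subst hj
    simp [Measure.dirac_bind (K j).measurable]
  · simp [hj, hK]

theorem expectedValue_eq {vmax : ℝ} (hD : ∀ i, ∀ᵐ x ∂(D i), x ∈ Icc 0 vmax) :
    expectedValue D A = ∑ i, ∫ z, z * interimAlloc D A i z ∂(D i) := by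
  have hb : ∀ i, ∀ᵐ z ∂(D i), |z| ≤ vmax := fun i => by
    filter_upwards [hD i] with z hz
    rw [abs_of_nonneg hz.1]
    exact hz.2
  rw [expectedValue, integral_finsetSum]
  · refine Finset.sum_congr rfl fun i _ => ?_
    have h := integral_interimAlloc D A i (D i) (fun z => z) measurable_id vmax (hb i)
    rw [Function.update_eq_self] at h
    exact h.symm
  · intro i _
    have hF : Measurable fun v : Profile n => v i * (A v).real (served i) :=
      (measurable_pi_apply i).mul (measurable_real_served A i)
    refine Integrable.of_bound hF.aestronglyMeasurable vmax ?_
    have h1 : ∀ᵐ v ∂(Measure.pi D), |v i| ≤ vmax :=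
      (measurePreserving_eval D i).quasiMeasurePreserving.ae (hb i)
    filter_upwards [h1] with p hp
    simp only [Real.norm_eq_abs, abs_mul]
    have h2 : |(A p).real (served i)| ≤ 1 := by
      rw [abs_of_nonneg measureReal_nonneg]
      exact measureReal_le_one
    exact (mul_le_of_le_one_right (abs_nonneg _) h2).trans hp

/-- Since resampling preserves the law of the profile, it preserves the law of the allocation and
therefore the expected cost. What is left of the welfare decouples into one-agent problems. -/
theorem welfare_comp_resample {vmax δ : ℝ} (hD : ∀ i, ∀ᵐ x ∂(D i), x ∈ Icc 0 vmax)
    (c : Allocation n → EReal) (K : Fin n → Kernel ℝ ℝ) [∀ i, IsMarkovKernel (K i)]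
    (hK : ∀ j, (D j).bind (K j) = D j)
    (hloss : ∀ i, ∫ z, z * interimAlloc D A i z ∂(D i) - δ
      ≤ ∫ z, z * ∫ w, interimAlloc D A i w ∂(K i z) ∂(D i)) :
    welfare D c A - ((n * δ : ℝ) : EReal) ≤ welfare D c (A ∘ₖ resample K) := by
  have hbind : (Measure.pi D).bind (A ∘ₖ resample K) = (Measure.pi D).bind A := by
    have h : ⇑(A ∘ₖ resample K) = fun v => (resample K v).bind A :=
      funext fun v => Kernel.comp_apply _ _ _
    rw [h, ← Measure.bind_bind (resample K).aemeasurable A.aemeasurable, pi_bind_resample]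
    congr 2
    exact funext hK
  have hcost : expectedCost D c (A ∘ₖ resample K) = expectedCost D c A := by
    simp only [expectedCost, hbind]
  have hval : expectedValue D A - n * δ ≤ expectedValue D (A ∘ₖ resample K) := by
    rw [expectedValue_eq D A hD, expectedValue_eq D _ hD]
    have h2 := Finset.sum_le_sum fun i (_ : i ∈ Finset.univ) => hloss i
    simp only [interimAlloc_comp_resample D A _ K hK]
    rw [Finset.sum_sub_distrib] at h2
    simpa using h2
  rw [welfare, welfare, hcost]
  -- Only associativity and commutativity of addition in `EReal` are needed, so infinite expected
  -- costs require no separate case.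
  have : (expectedValue D A : EReal) - expectedCost D c A - ((n * δ : ℝ) : EReal)
      = ((expectedValue D A - n * δ : ℝ) : EReal) - expectedCost D c A := by
    rw [EReal.coe_sub]
    simp only [sub_eq_add_neg]
    rw [add_assoc, add_comm (-expectedCost D c A), ← add_assoc]
  rw [this]
  exact EReal.sub_le_sub (by exact_mod_cast hval) le_rfl

theorem interimPay_withPayments (z : ℝ) :
    (withPayments D A).interimPay D i z
      = z * interimAlloc D A i z - ∫ t in (0 : ℝ)..z, interimAlloc D A i t := by
  simp [Mechanism.interimPay, withPayments]

/-- Truthful utility is the area under `x` up to `z`. The gain from reporting `z'` is the signed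
area between `x` and the constant `x z'` from `z` to `z'`; near monotonicity bounds the height by
`ε`, and only the part below `vmax` counts. -/
theorem isBICAlgorithm_of_almost_monotone {vmax ε : ℝ} (hε : 0 ≤ ε)
    (hmono : ∀ i, ∀ z z' : ℝ, 0 ≤ z → z ≤ z' →
      interimAlloc D A i z ≤ interimAlloc D A i z' + ε)
    (hconst : ∀ i, ∀ z, vmax ≤ z → interimAlloc D A i z = interimAlloc D A i vmax) :
    IsBICAlgorithm D vmax (ε * vmax) A := by
  intro i z hz z' hz'
  rw [interimPay_withPayments, interimPay_withPayments]
  have hint : ∀ a b, IntervalIntegrable (interimAlloc D A i) volume a b := fun a b =>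
    (intervalIntegrable_const (c := (1 : ℝ))).mono_fun
      (measurable_interimAlloc D A i).aestronglyMeasurable
      (Filter.Eventually.of_forall fun t => by
        simp only [Real.norm_of_nonneg (interimAlloc_nonneg D A i t), norm_one]
        exact interimAlloc_le_one D A i t)
  have hcc : ∀ c a b : ℝ, IntervalIntegrable (fun _ => c) volume a b :=
    fun c a b => intervalIntegrable_const
  set x := interimAlloc D A i with hx
  have hsplit := intervalIntegral.integral_add_adjacent_intervals (hint 0 z) (hint z z')
  change z * x z' - (z' * x z' - ∫ t in (0 : ℝ)..z', x t) - ε * vmax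
    ≤ z * x z - (z * x z - ∫ t in (0 : ℝ)..z, x t)
  -- Inserting the payments and cancelling the area up to `z` leaves exactly this inequality.
  suffices h : ∫ t in z..z', x t ≤ (z' - z) * x z' + ε * vmax by linarith
  rcases le_total z z' with hzz | hzz
  · have hle : ∀ b, z ≤ b → (∀ t ∈ Icc z b, x t ≤ x z' + ε) →
        ∫ t in z..b, x t ≤ (b - z) * (x z' + ε) := by
      intro b hb h
      have h1 := intervalIntegral.integral_mono_on hb (hint z b) (hcc (x z' + ε) z b) h
      rwa [intervalIntegral.integral_const, smul_eq_mul] at h1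
    rcases le_total z' vmax with h' | h'
    · have h1 := hle z' hzz fun t ht => hmono i t z' (hz.1.trans ht.1) ht.2
      nlinarith [mul_le_mul_of_nonneg_left (show z' - z ≤ vmax by linarith [hz.1]) hε]
    -- For an overbid above `vmax` the interval may be long, but beyond `vmax` the curve equals `x
    -- z'` and contributes no error.
    · have h1 := hle vmax hz.2 fun t ht => hmono i t z' (hz.1.trans ht.1) (ht.2.trans h')
      have h2 := intervalIntegral.integral_add_adjacent_intervals (hint z vmax) (hint vmax z')
      have h3 : ∫ t in vmax..z', x t = (z' - vmax) * x z' := by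
        rw [intervalIntegral.integral_congr (g := fun _ => x z')]
        · simp
        · intro t ht
          rw [uIcc_of_le h'] at ht
          simp only [hx]
          rw [hconst i t ht.1, hconst i z' h']
      nlinarith [mul_le_mul_of_nonneg_left (show vmax - z ≤ vmax by linarith [hz.1]) hε]
  · have h1 := intervalIntegral.integral_mono_on hzz (hcc (x z' - ε) z' z) (hint z' z)
      (fun t ht => by linarith [hmono i z' t hz' ht.1])
    simp only [intervalIntegral.integral_const, smul_eq_mul] at h1
    rw [intervalIntegral.integral_symm]
    nlinarith [mul_le_mul_of_nonneg_left (show z - z' ≤ vmax by linarith [hz.2]) hε]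

end interim

end BayesMech

/-! ### Ironing of a finite sequence and the effect of pooling on weighted sums. -/

namespace BayesMech

namespace Ironing

/-- `c` and `d` are neighbouring elements of `S`. -/
def Consec (S : Finset ℕ) (c d : ℕ) : Prop :=
  c ∈ S ∧ d ∈ S ∧ c < d ∧ ∀ e ∈ S, ¬(c < e ∧ e < d)

/-- The largest element of `S` that is at most `b`. -/
def lo (S : Finset ℕ) (b : ℕ) : ℕ := (S.filter (· ≤ b)).sup id

/-- The smallest element of `S` that exceeds `b`. -/
def hi (S : Finset ℕ) (b : ℕ) : ℕ := sInf {e | e ∈ S ∧ b < e}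

/-- The slope of `R` as a function of `Q` between `c` and `d`. -/
def slope (Q R : ℕ → ℝ) (c d : ℕ) : ℝ := (R c - R d) / (Q c - Q d)

theorem lo_mem {S : Finset ℕ} (h0 : 0 ∈ S) (b : ℕ) : lo S b ∈ S ∧ lo S b ≤ b := by
  have hne : (S.filter (· ≤ b)).Nonempty := ⟨0, by simp [h0]⟩
  have := Finset.exists_mem_eq_sup _ hne id
  obtain ⟨e, he, heq⟩ := this
  rw [Finset.mem_filter] at he
  have h : lo S b = e := heq
  rw [h]
  exact he

theorem le_lo {S : Finset ℕ} {b e : ℕ} (he : e ∈ S) (heb : e ≤ b) : e ≤ lo S b :=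
  Finset.le_sup (f := id) (by simp [he, heb])

theorem hi_mem {S : Finset ℕ} {K b : ℕ} (hK : K ∈ S) (hb : b < K) : hi S b ∈ S ∧ b < hi S b :=
  Nat.sInf_mem (s := {e | e ∈ S ∧ b < e}) ⟨K, hK, hb⟩

theorem hi_le {S : Finset ℕ} {b e : ℕ} (he : e ∈ S) (hb : b < e) : hi S b ≤ e :=
  Nat.sInf_le ⟨he, hb⟩

theorem consec_lo_hi {S : Finset ℕ} {K b : ℕ} (h0 : 0 ∈ S) (hK : K ∈ S) (hb : b < K) :
    Consec S (lo S b) (hi S b) := by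
  obtain ⟨h1, h2⟩ := lo_mem h0 b
  obtain ⟨h3, h4⟩ := hi_mem hK hb
  refine ⟨h1, h3, by omega, ?_⟩
  rintro e he ⟨h5, h6⟩
  rcases le_or_gt e b with h | h
  · have := le_lo he h
    omega
  · have := hi_le he h
    omega

theorem lo_hi_eq {S : Finset ℕ} {b c d : ℕ} (h : Consec S c d) (h1 : c ≤ b) (h2 : b < d) :
    lo S b = c ∧ hi S b = d := by
  obtain ⟨hc, hd, _, hno⟩ := h
  have hlo : lo S b = c := by
    refine le_antisymm (Finset.sup_le fun e he => ?_) (le_lo hc h1)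
    rw [Finset.mem_filter] at he
    by_contra hcon
    exact hno e he.1 ⟨not_le.1 hcon, lt_of_le_of_lt he.2 h2⟩
  have hhi := Nat.sInf_mem (s := {e | e ∈ S ∧ b < e}) ⟨d, hd, h2⟩
  refine ⟨hlo, le_antisymm (hi_le hd h2) ?_⟩
  by_contra hcon
  exact hno _ hhi.1 ⟨lt_of_le_of_lt h1 hhi.2, not_le.1 hcon⟩

theorem consec_erase {S : Finset ℕ} {c d e c' d' : ℕ} (h1 : Consec S c d) (h2 : Consec S d e)
    (h : Consec (S.erase d) c' d') : Consec S c' d' ∨ (c' = c ∧ d' = e) := by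
  obtain ⟨hc', hd', hlt, hno⟩ := h
  rw [Finset.mem_erase] at hc' hd'
  obtain ⟨hc, hd, hcd, hno1⟩ := h1
  obtain ⟨_, he, hde, hno2⟩ := h2
  by_cases hmid : c' < d ∧ d < d'
  · right
    have a1 := hno c (Finset.mem_erase.2 ⟨by omega, hc⟩)
    have a2 := hno1 c' hc'.2
    have a3 := hno e (Finset.mem_erase.2 ⟨by omega, he⟩)
    have a4 := hno2 d' hd'.2
    omega
  · left
    refine ⟨hc'.2, hd'.2, hlt, fun f hf hf' => ?_⟩
    by_cases hfd : f = d
    · subst hfd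
      exact hmid hf'
    · exact hno f (Finset.mem_erase.2 ⟨hfd, hf⟩) hf'

/-- Pooling at `S` is justified: every pool has positive mass and every initial segment of a pool
has at least the average of the pool. -/
def Justified (K : ℕ) (Q R : ℕ → ℝ) (S : Finset ℕ) : Prop :=
  S ⊆ Finset.range (K + 1) ∧ 0 ∈ S ∧ K ∈ S ∧ (∀ c d, Consec S c d → Q d < Q c) ∧
    ∀ c d, Consec S c d → ∀ t, c < t → t < d →
      (R c - R d) * (Q c - Q t) ≤ (R c - R t) * (Q c - Q d)

/-- The finest pooling works. In terms of tails `Q`, a boundary is kept if its bucket has mass and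
there is mass before it. Every pool then contains just one bucket of positive mass, so an initial
segment carries either nothing or everything. -/
theorem exists_justified {K : ℕ} {Q R : ℕ → ℝ} (hQ : ∀ a b, a ≤ b → b ≤ K → Q b ≤ Q a)
    (hR : ∀ a b, a ≤ b → b ≤ K → Q a = Q b → R a = R b) (hpos : Q K < Q 0) :
    ∃ S, Justified K Q R S := by
  classical
  have hK0 : 0 < K := by
    rcases Nat.eq_zero_or_pos K with h | h
    · subst h
      exact absurd hpos (lt_irrefl _)
    · exact h
  set S := (Finset.range (K + 1)).filter
    (fun b => b = 0 ∨ b = K ∨ (Q (b + 1) < Q b ∧ Q b < Q 0)) with hS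
  have hmem : ∀ b, b ∈ S ↔ b ≤ K ∧ (b = 0 ∨ b = K ∨ (Q (b + 1) < Q b ∧ Q b < Q 0)) := by
    intro b
    rw [hS, Finset.mem_filter, Finset.mem_range, Nat.lt_succ_iff]
  refine ⟨S, Finset.filter_subset _ _, (hmem 0).2 ⟨by omega, by simp⟩,
    (hmem K).2 ⟨le_rfl, by simp⟩, ?_, ?_⟩
  · rintro c d ⟨hc, hd, hcd, -⟩
    rw [hmem] at hc hd
    rcases hc.2 with h | h | h
    · subst h
      rcases hd.2 with h | h | h
      · omega
      · rwa [h]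
      · exact h.2
    · omega
    · exact lt_of_le_of_lt (hQ _ _ hcd hd.1) h.1
  · rintro c d ⟨hc, hd, hcd, hno⟩ t hct htd
    have hdK := ((hmem d).1 hd).1
    rcases eq_or_lt_of_le (hQ 0 t (by omega) (by omega)) with h | h
    · have h1 : Q c = Q t := le_antisymm (h ▸ hQ 0 c (by omega) (by omega))
        (hQ c t hct.le (by omega))
      rw [hR c t hct.le (by omega) h1, h1]
      simp
    -- There is mass before `t`, so any further mass between `t` and `d` would create a boundary
    -- inside the pool.
    · have key : ∀ m, t + m ≤ d → Q (t + m) = Q t := by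
        intro m
        induction m with
        | zero => simp
        | succ m ih =>
          intro hm
          have h1 := ih (by omega)
          have h2 := hno (t + m)
          rw [hmem] at h2
          by_contra hcon
          refine h2 ⟨by omega, Or.inr (Or.inr ⟨?_, by rw [h1]; exact h⟩)⟩
            ⟨by omega, by omega⟩
          refine lt_of_le_of_ne (hQ _ _ (by omega) (by omega)) ?_
          rw [h1]
          exact hcon
      have h1 : Q d = Q t := by
        have := key (d - t) (by omega)
        rwa [Nat.add_sub_cancel' htd.le] at this
      rw [hR t d htd.le hdK h1.symm, h1]

/-- The left average is at least the right one, so the merged average lies between them. An initial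
segment ending in the left pool has at least the left average; one ending in the right pool leaves a
final segment with at most the right average. -/
theorem Justified.merge {K : ℕ} {Q R : ℕ → ℝ} (hQ : ∀ a b, a ≤ b → b ≤ K → Q b ≤ Q a)
    {S : Finset ℕ} (hS : Justified K Q R S) {c d e : ℕ} (h1 : Consec S c d) (h2 : Consec S d e)
    (h : slope Q R d e ≤ slope Q R c d) : Justified K Q R (S.erase d) := by
  obtain ⟨hsub, h0, hK, hpos, hpre⟩ := hS
  have hle : ∀ b ∈ S, b ≤ K := fun b hb => Nat.lt_succ_iff.1 (Finset.mem_range.1 (hsub hb))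
  have heK := hle e h2.2.1
  have hcd := h1.2.2.1
  have hde := h2.2.2.1
  have hA := hpos c d h1
  have hB := hpos d e h2
  have hAB : (R d - R e) * (Q c - Q d) ≤ (R c - R d) * (Q d - Q e) := by
    rw [slope, slope, div_le_div_iff₀ (by linarith) (by linarith)] at h
    exact h
  refine ⟨(Finset.erase_subset _ _).trans hsub, Finset.mem_erase.2 ⟨by omega, h0⟩,
    Finset.mem_erase.2 ⟨by omega, hK⟩, ?_, ?_⟩
  · intro c' d' h'
    rcases consec_erase h1 h2 h' with h' | ⟨rfl, rfl⟩
    · exact hpos _ _ h'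
    · exact hB.trans hA
  · intro c' d' h' t hct htd
    rcases consec_erase h1 h2 h' with h' | ⟨rfl, rfl⟩
    · exact hpre _ _ h' t hct htd
    · rcases lt_trichotomy t d with htd' | rfl | htd'
      · have h3 := hpre _ _ h1 t hct htd'
        have hp : 0 ≤ Q c' - Q t := by linarith [hQ c' t hct.le (by omega)]
        -- The two cross-multiplied comparisons share the mass of the left pool as a factor, which
        -- is positive and can be cancelled.
        have h4 : (R d - R d') * (Q c' - Q t) ≤ (R c' - R t) * (Q d - Q d') := by
          refine le_of_mul_le_mul_right ?_ (sub_pos.2 hA)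
          nlinarith [mul_le_mul_of_nonneg_right hAB hp,
            mul_le_mul_of_nonneg_right h3 (sub_pos.2 hB).le]
        nlinarith
      · nlinarith
      · have h3 := hpre _ _ h2 t htd' htd
        have hp : 0 ≤ Q t - Q d' := by linarith [hQ t d' htd.le (by omega)]
        have h3' : (R t - R d') * (Q d - Q d') ≤ (R d - R d') * (Q t - Q d') := by nlinarith
        have h4 : (R t - R d') * (Q c' - Q d) ≤ (R c' - R d) * (Q t - Q d') := by
          refine le_of_mul_le_mul_right ?_ (sub_pos.2 hB)
          nlinarith [mul_le_mul_of_nonneg_right hAB hp,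
            mul_le_mul_of_nonneg_right h3' (sub_pos.2 hA).le]
        nlinarith

/-- Take a justified set with the fewest boundaries. If two adjacent pools were out of order,
merging them would leave a smaller justified set. -/
theorem exists_ironing {K : ℕ} {Q R : ℕ → ℝ} (hQ : ∀ a b, a ≤ b → b ≤ K → Q b ≤ Q a)
    (hR : ∀ a b, a ≤ b → b ≤ K → Q a = Q b → R a = R b) (hpos : Q K < Q 0) :
    ∃ S, Justified K Q R S ∧ ∀ c d c' d', Consec S c d → Consec S c' d' → d ≤ c' →
      slope Q R c d ≤ slope Q R c' d' := by
  classical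
  have hex : ∃ m, ∃ S, Justified K Q R S ∧ S.card = m := by
    obtain ⟨S, hS⟩ := exists_justified hQ hR hpos
    exact ⟨_, S, hS, rfl⟩
  obtain ⟨S, hS, hcard⟩ := Nat.find_spec hex
  refine ⟨S, hS, ?_⟩
  have hadj : ∀ c d e, Consec S c d → Consec S d e → slope Q R c d ≤ slope Q R d e := by
    intro c d e h1 h2
    by_contra hcon
    have h3 := hS.merge hQ h1 h2 (not_le.1 hcon).le
    have h4 : (S.erase d).card < Nat.find hex := by
      rw [← hcard]
      exact Finset.card_erase_lt_of_mem h1.2.1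
    exact Nat.find_min hex h4 ⟨_, h3, rfl⟩
  have main : ∀ m c d c' d', K - d ≤ m → Consec S c d → Consec S c' d' → d ≤ c' →
      slope Q R c d ≤ slope Q R c' d' := by
    have hle : ∀ b ∈ S, b ≤ K := fun b hb => Nat.lt_succ_iff.1 (Finset.mem_range.1 (hS.1 hb))
    intro m
    induction m with
    | zero =>
      intro c d c' d' hm h1 h2 hdc
      have := hle d' h2.2.1
      have := h2.2.2.1
      omega
    | succ m ih =>
      intro c d c' d' hm h1 h2 hdc
      have hd'K := hle d' h2.2.1
      have hlt := h2.2.2.1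
      rcases eq_or_lt_of_le hdc with rfl | hdc
      · exact hadj _ _ _ h1 h2
      · have h3 := consec_lo_hi (b := d) hS.2.1 hS.2.2.1 (by omega)
        have hlo : lo S d = d := le_antisymm (lo_mem hS.2.1 d).2 (le_lo h1.2.1 le_rfl)
        rw [hlo] at h3
        have h4 : hi S d ≤ c' := hi_le h2.1 hdc
        have h5 := h3.2.2.1
        exact (hadj _ _ _ h1 h3).trans (ih _ _ _ _ (by omega) h3 h2 h4)
  exact fun c d c' d' => main _ c d c' d' le_rfl

/-- Abel summation for a weighted sum whose tails are bounded. -/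
theorem sum_mul_le_of_tail_le {K : ℕ} {ζ g : ℕ → ℝ} {β Z : ℝ} (hζ : Monotone ζ) (h0 : 0 ≤ ζ 0)
    (hZ : ∀ b ≤ K, ζ b ≤ Z) (hβ : 0 ≤ β)
    (hg : ∀ t < K, ∑ b ∈ Finset.Ico t K, g b ≤ β) :
    ∑ b ∈ Finset.range K, ζ b * g b ≤ β * Z := by
  -- Induction downwards from `K`. The term `β * (Z - ζ (K - m))` pays for the increments of `ζ`
  -- passed so far, each of which multiplies a tail of at most `β`.
  have key : ∀ m ≤ K, ∑ b ∈ Finset.Ico (K - m) K, ζ b * g b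
      ≤ ζ (K - m) * ∑ b ∈ Finset.Ico (K - m) K, g b + β * (Z - ζ (K - m)) := by
    intro m
    induction m with
    | zero =>
      intro _
      simpa using mul_nonneg hβ (sub_nonneg.2 (hZ K le_rfl))
    | succ m ih =>
      intro hm
      have h1 := ih (by omega)
      have h2 : K - m = (K - (m + 1)) + 1 := by omega
      have hlt : K - (m + 1) < K := by omega
      rw [Finset.sum_eq_sum_Ico_succ_bot hlt (fun b => ζ b * g b),
        Finset.sum_eq_sum_Ico_succ_bot hlt g, ← h2]
      have h3 : ζ (K - (m + 1)) ≤ ζ (K - m) := hζ (by omega)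
      have h4 : ∑ b ∈ Finset.Ico (K - m) K, g b ≤ β := by
        rcases Nat.eq_zero_or_pos m with h | h
        · subst h
          simpa using hβ
        · exact hg _ (by omega)
      nlinarith
  have h := key K le_rfl
  rw [Nat.sub_self] at h
  rw [Finset.range_eq_Ico]
  refine h.trans ?_
  rcases Nat.eq_zero_or_pos K with hK | hK
  · subst hK
    have := hZ 0 le_rfl
    simp only [Finset.Ico_self, Finset.sum_empty, mul_zero, zero_add]
    nlinarith
  · nlinarith [hg 0 hK]

/-- The tail sum of `f`. -/
def tail (K : ℕ) (f : ℕ → ℝ) (t : ℕ) : ℝ := ∑ b ∈ Finset.Ico t K, f b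

theorem tail_sub_tail {K : ℕ} (f : ℕ → ℝ) {c d : ℕ} (hcd : c ≤ d) (hd : d ≤ K) :
    tail K f c - tail K f d = ∑ b ∈ Finset.Ico c d, f b := by
  rw [tail, tail, ← Finset.sum_Ico_consecutive f hcd hd]
  ring

/-- Averaging preserves the total over each pool, hence over every tail that starts at a boundary.
-/
theorem tail_pooled_eq_zero {K : ℕ} {w x : ℕ → ℝ} {S : Finset ℕ}
    (h0 : 0 ∈ S) (hK : K ∈ S) (hle : ∀ b ∈ S, b ≤ K)
    (hpos : ∀ c d, Consec S c d → tail K w d < tail K w c) :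
    ∀ d ∈ S, tail K (fun b => w b * x b - w b *
      slope (tail K w) (tail K fun b => w b * x b) (lo S b) (hi S b)) d = 0 := by
  have pool : ∀ c d t, Consec S c d → c ≤ t → t ≤ d →
      ∑ b ∈ Finset.Ico t d, (w b * x b - w b *
        slope (tail K w) (tail K fun b => w b * x b) (lo S b) (hi S b))
      = (tail K (fun b => w b * x b) t - tail K (fun b => w b * x b) d)
        - (tail K w t - tail K w d) * slope (tail K w) (tail K fun b => w b * x b) c d := by
    intro c d t h hct htd
    have hdK := hle d h.2.1
    rw [tail_sub_tail _ htd hdK, tail_sub_tail _ htd hdK, Finset.sum_mul, ← Finset.sum_sub_distrib]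
    refine Finset.sum_congr rfl fun b hb => ?_
    rw [Finset.mem_Ico] at hb
    obtain ⟨e1, e2⟩ := lo_hi_eq h (hct.trans hb.1) hb.2
    rw [e1, e2]
  have main : ∀ m, ∀ d ∈ S, K - d ≤ m → tail K (fun b => w b * x b - w b *
      slope (tail K w) (tail K fun b => w b * x b) (lo S b) (hi S b)) d = 0 := by
    intro m
    induction m with
    | zero =>
      intro d hd hm
      have : d = K := le_antisymm (hle d hd) (by omega)
      subst this
      simp [tail]
    | succ m ih =>
      intro d hd hm
      rcases eq_or_lt_of_le (hle d hd) with rfl | hlt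
      · simp [tail]
      · have h3 := consec_lo_hi h0 hK hlt
        have hlo : lo S d = d := le_antisymm (lo_mem h0 d).2 (le_lo hd le_rfl)
        rw [hlo] at h3
        have h4 := ih _ h3.2.1 (by have := h3.2.2.1; omega)
        have h5 := tail_sub_tail (K := K) (fun b => w b * x b - w b *
          slope (tail K w) (tail K fun b => w b * x b) (lo S b) (hi S b)) h3.2.2.1.le
          (hle _ h3.2.1)
        rw [h4, pool _ _ _ h3 le_rfl h3.2.2.1.le, slope,
          mul_div_cancel₀ _ (sub_pos.2 (hpos _ _ h3)).ne'] at h5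
        linarith
  exact fun d hd => main _ d hd le_rfl

/-- If pooling decreases no tail sum by much, then it does not decrease the weighted sum by
much. -/
theorem sum_le_pooled {K : ℕ} {w x ζ : ℕ → ℝ} {S : Finset ℕ} {α β Z : ℝ}
    (h0 : 0 ∈ S) (hK : K ∈ S) (hle : ∀ b ∈ S, b ≤ K) (hw : ∀ b, 0 ≤ w b)
    (hpos : ∀ c d, Consec S c d → tail K w d < tail K w c)
    (hζ : Monotone ζ) (hζ0 : 0 ≤ ζ 0) (hZ : ∀ b ≤ K, ζ b ≤ Z) (hα : 0 ≤ α) (hβ : 0 ≤ β)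
    (hsplit : ∀ c d, Consec S c d → ∀ t, c < t → t < d →
      (tail K (fun b => w b * x b) t - tail K (fun b => w b * x b) d)
        * (tail K w c - tail K w d)
      ≤ (tail K w t - tail K w d)
          * (tail K (fun b => w b * x b) c - tail K (fun b => w b * x b) d)
        + (α * tail K w t + β) * (tail K w c - tail K w d)) :
    ∑ b ∈ Finset.range K, ζ b * (w b * x b)
      ≤ ∑ b ∈ Finset.range K, ζ b * (w b *
          slope (tail K w) (tail K fun b => w b * x b) (lo S b) (hi S b))
        + α * ∑ b ∈ Finset.range K, ζ b * w b + β * Z := by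
  set f : ℕ → ℝ := fun b => w b * x b - w b *
      slope (tail K w) (tail K fun b => w b * x b) (lo S b) (hi S b) with hf
  have htail0 := tail_pooled_eq_zero (x := x) h0 hK hle hpos
  have hwt : ∀ t, 0 ≤ tail K w t := fun t => Finset.sum_nonneg fun b _ => hw b
  -- All later pools cancel, so only the final segment of the pool of `t` matters, and `hsplit`
  -- compares it with the pool average.
  have hft : ∀ t < K, tail K f t ≤ α * tail K w t + β := by
    intro t ht
    have h3 := consec_lo_hi h0 hK ht
    have hlt := lo_mem h0 t
    have hhi := hi_mem hK ht
    rcases eq_or_lt_of_le hlt.2 with h | h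
    · rw [h] at hlt
      rw [htail0 t hlt.1]
      have := hwt t
      positivity
    · have h4 := hsplit _ _ h3 t h hhi.2
      have hdK := hle _ h3.2.1
      have h5 : tail K f t = (tail K (fun b => w b * x b) t
          - tail K (fun b => w b * x b) (hi S t))
        - (tail K w t - tail K w (hi S t))
          * slope (tail K w) (tail K fun b => w b * x b) (lo S t) (hi S t) := by
        have h6 := tail_sub_tail (K := K) f hhi.2.le hdK
        rw [htail0 _ h3.2.1, sub_zero] at h6
        rw [h6, tail_sub_tail _ hhi.2.le hdK, tail_sub_tail _ hhi.2.le hdK, Finset.sum_mul,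
          ← Finset.sum_sub_distrib]
        refine Finset.sum_congr rfl fun b hb => ?_
        rw [Finset.mem_Ico] at hb
        obtain ⟨e1, e2⟩ := lo_hi_eq h3 (hlt.2.trans hb.1) hb.2
        simp only [hf]
        rw [e1, e2]
      have h7 := sub_pos.2 (hpos _ _ h3)
      rw [h5]
      refine le_of_mul_le_mul_right ?_ h7
      rw [sub_mul, mul_assoc, slope, div_mul_cancel₀ _ h7.ne']
      linarith
  -- Subtracting `α * w b` removes the part of the error proportional to tail weight and leaves
  -- tails bounded by the constant `β`.
  have h1 := sum_mul_le_of_tail_le (g := fun b => f b - α * w b) hζ hζ0 hZ hβ fun t ht => by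
    rw [Finset.sum_sub_distrib, ← Finset.mul_sum]
    have := hft t ht
    simp only [tail] at this
    linarith
  have h2 : ∑ b ∈ Finset.range K, ζ b * (f b - α * w b)
      = ∑ b ∈ Finset.range K, ζ b * (w b * x b)
        - ∑ b ∈ Finset.range K, ζ b * (w b *
          slope (tail K w) (tail K fun b => w b * x b) (lo S b) (hi S b))
        - α * ∑ b ∈ Finset.range K, ζ b * w b := by
    rw [Finset.mul_sum, ← Finset.sum_sub_distrib, ← Finset.sum_sub_distrib]
    refine Finset.sum_congr rfl fun b _ => ?_
    simp only [hf]
    ring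
  linarith

end Ironing

end BayesMech

/-! ### Ironing based on estimates. -/

namespace BayesMech

namespace Ironing

/-- `S` is a set of pool boundaries that the estimates `u` of the pool averages support: the pools
have increasing averages, and no pool can be split profitably. -/
structure Supported (K : ℕ) (pos : ℕ → Prop) (u : ℕ → ℕ → ℝ) (ν : ℝ) (S : Finset ℕ) : Prop where
  subset : S ⊆ Finset.range (K + 1)
  zero_mem : 0 ∈ S
  last_mem : K ∈ S
  exists_pos : ∀ c d, Consec S c d → ∃ b, c ≤ b ∧ b < d ∧ pos b
  mono : ∀ c d c' d', Consec S c d → Consec S c' d' → d ≤ c' → u c d ≤ u c' d' + 2 * ν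
  split : ∀ c d, Consec S c d → ∀ t, c < t → t < d → (∃ b, c ≤ b ∧ b < t ∧ pos b) →
    (∃ b, t ≤ b ∧ b < d ∧ pos b) → u t d ≤ u c t + 2 * ν

theorem tail_lt_tail_iff {K : ℕ} {w : ℕ → ℝ} (hw : ∀ b, 0 ≤ w b) {c d : ℕ} (hcd : c ≤ d)
    (hd : d ≤ K) : tail K w d < tail K w c ↔ ∃ b, c ≤ b ∧ b < d ∧ 0 < w b := by
  rw [← sub_pos, tail_sub_tail w hcd hd, Finset.sum_pos_iff_of_nonneg fun b _ => hw b]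
  simp [and_assoc]

theorem tail_antitone {K : ℕ} {w : ℕ → ℝ} (hw : ∀ b, 0 ≤ w b) {c d : ℕ} (hcd : c ≤ d)
    (hd : d ≤ K) : tail K w d ≤ tail K w c := by
  rw [← sub_nonneg, tail_sub_tail w hcd hd]
  exact Finset.sum_nonneg fun b _ => hw b

section

variable {K : ℕ} {w y : ℕ → ℝ} {pos : ℕ → Prop} {u : ℕ → ℕ → ℝ} {ν : ℝ}

/-- The exact ironing of `y` passes all tests: each test compares two estimates, both within `ν` of
the true averages, so a slack of `2 * ν` absorbs the error. Hence the search made by the reduction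
cannot fail when its estimates are accurate. -/
theorem exists_supported (hw : ∀ b, 0 ≤ w b) (hpos : ∀ b < K, pos b ↔ 0 < w b)
    (h0 : 0 < tail K w 0)
    (hu : ∀ a b, a < b → b ≤ K → tail K w b < tail K w a →
      |u a b - slope (tail K w) (tail K fun b => w b * y b) a b| ≤ ν) :
    ∃ S, Supported K pos u ν S := by
  have hpos' : ∀ c d, c ≤ d → d ≤ K →
      ((∃ b, c ≤ b ∧ b < d ∧ pos b) ↔ tail K w d < tail K w c) := by
    intro c d hcd hd
    rw [tail_lt_tail_iff hw hcd hd]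
    constructor
    · rintro ⟨b, h1, h2, h3⟩
      exact ⟨b, h1, h2, (hpos b (by omega)).1 h3⟩
    · rintro ⟨b, h1, h2, h3⟩
      exact ⟨b, h1, h2, (hpos b (by omega)).2 h3⟩
  have hR : ∀ a b, a ≤ b → b ≤ K → tail K w a = tail K w b →
      tail K (fun b => w b * y b) a = tail K (fun b => w b * y b) b := by
    intro a b hab hb h
    rw [← sub_eq_zero, tail_sub_tail _ hab hb] at h ⊢
    rw [Finset.sum_eq_zero_iff_of_nonneg fun b _ => hw b] at h
    exact Finset.sum_eq_zero fun i hi => by rw [h i hi, zero_mul]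
  have hK : tail K w K = 0 := by simp [tail]
  obtain ⟨S, hS, hmono⟩ := exists_ironing (Q := tail K w) (R := tail K fun b => w b * y b)
    (fun a b hab hb => tail_antitone hw hab hb) hR (by rwa [hK])
  obtain ⟨hsub, h0S, hKS, hposS, hpre⟩ := hS
  have hle : ∀ b ∈ S, b ≤ K := fun b hb => Nat.lt_succ_iff.1 (Finset.mem_range.1 (hsub hb))
  refine ⟨S, hsub, h0S, hKS, ?_, ?_, ?_⟩
  · intro c d h
    exact (hpos' c d h.2.2.1.le (hle _ h.2.1)).2 (hposS c d h)
  · intro c d c' d' h h' hdc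
    have h1 := abs_le.1 (hu c d h.2.2.1 (hle _ h.2.1) (hposS c d h))
    have h2 := abs_le.1 (hu c' d' h'.2.2.1 (hle _ h'.2.1) (hposS c' d' h'))
    have h3 := hmono c d c' d' h h' hdc
    linarith [h1.2, h2.1]
  · intro c d h t hct htd h1 h2
    have hdK := hle _ h.2.1
    rw [hpos' _ _ hct.le (by omega)] at h1
    rw [hpos' _ _ htd.le hdK] at h2
    have h3 := abs_le.1 (hu c t hct (by omega) h1)
    have h4 := abs_le.1 (hu t d htd hdK h2)
    have h5 := hpre c d h t hct htd
    have h6 : slope (tail K w) (tail K fun b => w b * y b) t d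
        ≤ slope (tail K w) (tail K fun b => w b * y b) c t := by
      rw [slope, slope, div_le_div_iff₀ (by linarith) (by linarith)]
      nlinarith
    linarith [h3.1, h4.2]

variable {x : ℕ → ℝ} {S : Finset ℕ} {e η q : ℝ}

theorem abs_slope_sub_slope_le (hw : ∀ b, 0 ≤ w b)
    (he : ∀ b < K, 0 < w b → |y b - x b| ≤ e) {c d : ℕ} (hcd : c ≤ d) (hd : d ≤ K)
    (hlt : tail K w d < tail K w c) :
    |slope (tail K w) (tail K fun b => w b * y b) c d
      - slope (tail K w) (tail K fun b => w b * x b) c d| ≤ e := by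
  rw [slope, slope, ← sub_div, abs_div, abs_of_pos (sub_pos.2 hlt), div_le_iff₀ (sub_pos.2 hlt),
    tail_sub_tail _ hcd hd, tail_sub_tail _ hcd hd, tail_sub_tail _ hcd hd,
    ← Finset.sum_sub_distrib, Finset.mul_sum]
  refine (Finset.abs_sum_le_sum_abs _ _).trans (Finset.sum_le_sum fun b hb => ?_)
  rw [Finset.mem_Ico] at hb
  rw [← mul_sub, abs_mul, abs_of_nonneg (hw b), mul_comm]
  rcases eq_or_lt_of_le (hw b) with h | h
  · simp [← h]
  · exact mul_le_mul_of_nonneg_right (he b (by omega) h) h.le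

theorem Supported.pos_tail (hS : Supported K pos u ν S) (hw : ∀ b, 0 ≤ w b)
    (hpos : ∀ b < K, pos b ↔ 0 < w b) {c d : ℕ} (h : Consec S c d) :
    tail K w d < tail K w c := by
  have hd : d ≤ K := Nat.lt_succ_iff.1 (Finset.mem_range.1 (hS.subset h.2.1))
  rw [tail_lt_tail_iff hw h.2.2.1.le hd]
  obtain ⟨b, h1, h2, h3⟩ := hS.exists_pos c d h
  exact ⟨b, h1, h2, (hpos b (by omega)).1 h3⟩

/-- The slack `2 * ν` of the test is joined by `ν` for each of the two estimated pool averages and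
`e` for each replacement of `y` by `x`. -/
theorem Supported.slope_le_slope (hS : Supported K pos u ν S) (hw : ∀ b, 0 ≤ w b)
    (hpos : ∀ b < K, pos b ↔ 0 < w b)
    (hu : ∀ a b, a < b → b ≤ K → tail K w b < tail K w a →
      |u a b - slope (tail K w) (tail K fun b => w b * y b) a b| ≤ ν)
    (he : ∀ b < K, 0 < w b → |y b - x b| ≤ e) {c d c' d' : ℕ} (h : Consec S c d)
    (h' : Consec S c' d') (hdc : d ≤ c') :
    slope (tail K w) (tail K fun b => w b * x b) c d
      ≤ slope (tail K w) (tail K fun b => w b * x b) c' d' + (4 * ν + 2 * e) := by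
  have hle : ∀ b ∈ S, b ≤ K := fun b hb =>
    Nat.lt_succ_iff.1 (Finset.mem_range.1 (hS.subset hb))
  have p := hS.pos_tail hw hpos h
  have p' := hS.pos_tail hw hpos h'
  have h1 := abs_le.1 (hu c d h.2.2.1 (hle _ h.2.1) p)
  have h2 := abs_le.1 (hu c' d' h'.2.2.1 (hle _ h'.2.1) p')
  have h3 := abs_le.1 (abs_slope_sub_slope_le hw he h.2.2.1.le (hle _ h.2.1) p)
  have h4 := abs_le.1 (abs_slope_sub_slope_le hw he h'.2.2.1.le (hle _ h'.2.1) p')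
  have h5 := hS.mono c d c' d' h h' hdc
  linarith [h1.1, h2.2, h3.1, h4.2]

/-- The splitting test first shows that pooling `y` decreases no tail sum by much; the accuracy of
the tail sums then transfers this to `x`. Errors in single buckets do not enter, which is why few
trials per bucket suffice. -/
theorem Supported.sum_le_pooled (hS : Supported K pos u ν S) (hw : ∀ b, 0 ≤ w b)
    (hpos : ∀ b < K, pos b ↔ 0 < w b) (hν : 0 ≤ ν) (hη : 0 ≤ η) (hq : 0 ≤ q)
    (hu : ∀ a b, a < b → b ≤ K → tail K w b < tail K w a →
      |u a b - slope (tail K w) (tail K fun b => w b * y b) a b| ≤ ν)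
    (htail : ∀ t ≤ K, |tail K (fun b => w b * y b) t - tail K (fun b => w b * x b) t|
      ≤ η * (tail K w t + q))
    {ζ : ℕ → ℝ} {Z : ℝ} (hζ : Monotone ζ) (hζ0 : 0 ≤ ζ 0) (hZ : ∀ b ≤ K, ζ b ≤ Z) :
    ∑ b ∈ Finset.range K, ζ b * (w b * x b)
      ≤ ∑ b ∈ Finset.range K, ζ b * (w b *
          slope (tail K w) (tail K fun b => w b * x b) (lo S b) (hi S b))
        + (4 * ν + 2 * η) * ∑ b ∈ Finset.range K, ζ b * w b + 2 * η * q * Z := by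
  have hle : ∀ b ∈ S, b ≤ K := fun b hb =>
    Nat.lt_succ_iff.1 (Finset.mem_range.1 (hS.subset hb))
  have hwt : ∀ t, 0 ≤ tail K w t := fun t => Finset.sum_nonneg fun b _ => hw b
  refine Ironing.sum_le_pooled hS.zero_mem hS.last_mem hle hw
    (fun c d h => hS.pos_tail hw hpos h) hζ hζ0 hZ (by positivity) (by positivity) ?_
  intro c d h t hct htd
  have hdK := hle _ h.2.1
  have hQ1 := tail_antitone hw hct.le (show t ≤ K by omega)
  have hQ2 := tail_antitone hw htd.le hdK
  have hQt := hwt t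
  have hQd := hwt d
  have key : (tail K (fun b => w b * y b) t - tail K (fun b => w b * y b) d)
        * (tail K w c - tail K w d)
      ≤ (tail K w t - tail K w d)
          * (tail K (fun b => w b * y b) c - tail K (fun b => w b * y b) d)
        + 4 * ν * tail K w t * (tail K w c - tail K w d) := by
    have hnn : 0 ≤ 4 * ν * tail K w t * (tail K w c - tail K w d) := by
      have : 0 ≤ tail K w c - tail K w d := by linarith
      positivity
    have hR : ∀ a b, a ≤ b → b ≤ K → tail K w a = tail K w b →
        tail K (fun b => w b * y b) a = tail K (fun b => w b * y b) b := by
      intro a b hab hb h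
      rw [← sub_eq_zero, tail_sub_tail _ hab hb] at h ⊢
      rw [Finset.sum_eq_zero_iff_of_nonneg fun b _ => hw b] at h
      exact Finset.sum_eq_zero fun i hi => by rw [h i hi, zero_mul]
    -- If one of the two parts of the pool has no mass, no test applies, but the corresponding
    -- difference of tail sums of `y` vanishes as well.
    rcases eq_or_lt_of_le hQ1 with h1 | h1
    · have := hR c t hct.le (by omega) h1.symm
      rw [h1] at hnn ⊢
      rw [← this]
      linarith
    rcases eq_or_lt_of_le hQ2 with h2 | h2
    · have := hR t d htd.le hdK h2.symm
      rw [← h2] at hnn ⊢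
      rw [this]
      linarith
    have p1 := h1
    have p2 := h2
    rw [tail_lt_tail_iff hw hct.le (by omega)] at h1
    rw [tail_lt_tail_iff hw htd.le hdK] at h2
    have h3 := hS.split c d h t hct htd
      (let ⟨b, a1, a2, a3⟩ := h1; ⟨b, a1, a2, (hpos b (by omega)).2 a3⟩)
      (let ⟨b, a1, a2, a3⟩ := h2; ⟨b, a1, a2, (hpos b (by omega)).2 a3⟩)
    have h4 := abs_le.1 (hu c t hct (by omega) p1)
    have h5 := abs_le.1 (hu t d htd hdK p2)
    have h6 : slope (tail K w) (tail K fun b => w b * y b) t d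
        ≤ slope (tail K w) (tail K fun b => w b * y b) c t + 4 * ν := by linarith [h4.2, h5.1]
    have e1 : tail K (fun b => w b * y b) t - tail K (fun b => w b * y b) d
        = slope (tail K w) (tail K fun b => w b * y b) t d * (tail K w t - tail K w d) := by
      rw [slope, div_mul_cancel₀ _ (sub_pos.2 p2).ne']
    have e2 : tail K (fun b => w b * y b) c - tail K (fun b => w b * y b) t
        = slope (tail K w) (tail K fun b => w b * y b) c t * (tail K w c - tail K w t) := by
      rw [slope, div_mul_cancel₀ _ (sub_pos.2 p1).ne']
    have e3 : tail K (fun b => w b * y b) c - tail K (fun b => w b * y b) d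
        = slope (tail K w) (tail K fun b => w b * y b) c t * (tail K w c - tail K w t)
          + slope (tail K w) (tail K fun b => w b * y b) t d * (tail K w t - tail K w d) := by
      rw [← e1, ← e2]
      ring
    rw [e3, e1]
    have h7 : (tail K w t - tail K w d) * (tail K w c - tail K w t) * (4 * ν)
        ≤ 4 * ν * tail K w t * (tail K w c - tail K w d) := by
      have : (tail K w t - tail K w d) * (tail K w c - tail K w t)
          ≤ tail K w t * (tail K w c - tail K w d) := by
        apply mul_le_mul <;> linarith
      nlinarith
    have h8 := mul_le_mul_of_nonneg_left h6 (mul_nonneg (sub_pos.2 p2).le (sub_pos.2 p1).le)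
    nlinarith
  -- The bound `η * (Q + q)` is affine in the tail weight `Q`. Interpolating it between `c` and `d`
  -- returns its value at `t`, so the three errors add up to exactly twice the bound at `t`.
  have t1 := abs_le.1 (htail t (by omega))
  have t2 := abs_le.1 (htail c (by omega))
  have t3 := abs_le.1 (htail d hdK)
  have m1 := mul_le_mul_of_nonneg_right t1.1 (show 0 ≤ tail K w c - tail K w d by linarith)
  have m2 := mul_le_mul_of_nonneg_right t2.2 (show 0 ≤ tail K w t - tail K w d by linarith)
  have m3 := mul_le_mul_of_nonneg_right t3.2 (show 0 ≤ tail K w c - tail K w t by linarith)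
  linear_combination key + m1 + m2 + m3

end

end Ironing

end BayesMech

/-! ### Resampling from random pools. -/

namespace BayesMech

namespace Ironing

open Proc

section fiber

variable {F : Measure ℝ} [IsProbabilityMeasure F] {p : ℝ → ℕ}

theorem condLaw_eq_cond {I : Set ℝ} (h : F I ≠ 0) (x₀ : ℝ) : condLaw F I x₀ = cond F I :=
  if_neg h

theorem measurable_condLaw_fiber (hp : Measurable p) :
    Measurable fun z => condLaw F (p ⁻¹' {p z}) 0 :=
  (measurable_of_countable fun k => condLaw F (p ⁻¹' {k}) 0).comp hp

/-- The law of total probability over the fibres of `p`. The default value on null fibres is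
harmless since such fibres are almost surely not met. -/
theorem bind_condLaw_fiber (hp : Measurable p) :
    F.bind (fun z => condLaw F (p ⁻¹' {p z}) 0) = F := by
  have hm : ∀ k, MeasurableSet (p ⁻¹' {k}) := fun k => hp (measurableSet_singleton k)
  have hd : Pairwise fun i j => Disjoint (p ⁻¹' {i}) (p ⁻¹' {j}) := fun i j hij =>
    Disjoint.preimage _ (by simpa using hij)
  have hU : ⋃ k, p ⁻¹' {k} = univ := by
    ext z
    simp
  ext s hs
  rw [Measure.bind_apply hs (measurable_condLaw_fiber hp).aemeasurable, ← setLIntegral_univ,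
    ← hU, lintegral_iUnion hm hd, ← inter_univ s, ← hU, inter_iUnion,
    measure_iUnion (fun i j hij => (hd hij).mono inter_subset_right inter_subset_right)
      fun k => hs.inter (hm k)]
  refine tsum_congr fun k => ?_
  by_cases h0 : F (p ⁻¹' {k}) = 0
  · rw [Measure.restrict_eq_zero.2 h0, lintegral_zero_measure,
      measure_mono_null inter_subset_right h0]
  · have h : ∀ z ∈ p ⁻¹' {k}, condLaw F (p ⁻¹' {p z}) 0 s = cond F (p ⁻¹' {k}) s := by
      intro z hz
      have hz' : p z = k := hz
      rw [hz', condLaw_eq_cond h0]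
    rw [← inter_iUnion, hU, inter_univ, setLIntegral_congr_fun (hm k) h, setLIntegral_const,
      cond_apply (hm k), mul_comm, ← mul_assoc, ENNReal.mul_inv_cancel h0 (measure_ne_top _ _),
      one_mul, inter_comm]

end fiber

/-- The buckets that are pooled with the bucket of `z`. -/
def pool (idx : ℝ → ℕ) (S : Finset ℕ) (z : ℝ) : Set ℝ := {z' | lo S (idx z') = lo S (idx z)}

theorem lo_mono (S : Finset ℕ) : Monotone (lo S) := fun a b hab =>
  Finset.sup_mono fun e he => by
    rw [Finset.mem_filter] at he ⊢
    exact ⟨he.1, he.2.trans hab⟩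

/-- The distribution oracle conditions only on intervals; pools are fibres of a monotone function.
-/
theorem ordConnected_pool {idx : ℝ → ℕ} (hidx : Monotone idx) (S : Finset ℕ) (z : ℝ) :
    (pool idx S z).OrdConnected := by
  have : pool idx S z = (lo S ∘ idx) ⁻¹' Icc (lo S (idx z)) (lo S (idx z)) := by
    ext z'
    simp [pool]
  rw [this]
  exact ordConnected_Icc.preimage_mono ((lo_mono S).comp hidx)

section mixture

variable (F : Measure ℝ) [IsProbabilityMeasure F] {idx : ℝ → ℕ} (hidx : Measurable idx)
  (τ : Measure (Finset ℕ)) [IsProbabilityMeasure τ]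

include hidx in
theorem measurable_poolLaw :
    Measurable fun p : ℝ × Finset ℕ => condLaw F (pool idx p.2 p.1) 0 :=
  measurable_from_prod_countable_left fun S =>
    measurable_condLaw_fiber (p := lo S ∘ idx) ((measurable_of_countable _).comp hidx)

/-- Resampling a value from its pool, where the set of pool boundaries is drawn from `τ`. -/
def poolKernel : Kernel ℝ ℝ where
  toFun z := τ.bind fun S => condLaw F (pool idx S z) 0
  measurable' := Measure.measurable_bind_prodMk τ
    (g := fun p : ℝ × Finset ℕ => condLaw F (pool idx p.2 p.1) 0) (measurable_poolLaw F hidx)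

theorem poolKernel_apply (z : ℝ) :
    poolKernel F hidx τ z = τ.bind fun S => condLaw F (pool idx S z) 0 := rfl

instance : IsMarkovKernel (poolKernel F hidx τ) := by
  refine ⟨fun z => ?_⟩
  rw [poolKernel_apply]
  exact isProbabilityMeasure_bind (measurable_of_countable _).aemeasurable
    (Filter.Eventually.of_forall fun S => inferInstance)

/-- The law `τ` of the boundaries does not depend on `z`, so the two random choices can be
exchanged, and for fixed boundaries resampling within the pools preserves `F`. -/
theorem bind_poolKernel : F.bind (poolKernel F hidx τ) = F := by
  ext s hs
  rw [Measure.bind_apply hs (Kernel.aemeasurable _)]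
  have h : ∀ z, poolKernel F hidx τ z s = ∫⁻ S, condLaw F (pool idx S z) 0 s ∂τ := fun z =>
    Measure.bind_apply hs (measurable_of_countable _).aemeasurable
  simp_rw [h]
  rw [lintegral_lintegral_swap (f := fun z S => condLaw F (pool idx S z) 0 s)
    ((Measure.measurable_coe hs).comp (measurable_poolLaw F hidx)).aemeasurable]
  have h2 : ∀ S : Finset ℕ, ∫⁻ z, condLaw F (pool idx S z) 0 s ∂F = F s := by
    intro S
    have hp : Measurable (lo S ∘ idx) := (measurable_of_countable _).comp hidx
    have h3 := Measure.bind_apply hs (measurable_condLaw_fiber (F := F) hp).aemeasurable (m := F)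
    rw [bind_condLaw_fiber hp] at h3
    exact h3.symm
  simp [h2]

variable {x : ℝ → ℝ} (hx : Measurable x) (hx0 : ∀ z, 0 ≤ x z) (hx1 : ∀ z, x z ≤ 1)

include hx hx0 hx1 in
theorem integrable_of_unit (ν : Measure ℝ) [IsFiniteMeasure ν] : Integrable x ν :=
  Integrable.of_bound hx.aestronglyMeasurable 1 (Filter.Eventually.of_forall fun z => by
    rw [Real.norm_eq_abs, abs_of_nonneg (hx0 z)]
    exact hx1 z)

/-- The average of `x` over the pool of `z`. -/
def poolAvg (idx : ℝ → ℕ) (x : ℝ → ℝ) (z : ℝ) (S : Finset ℕ) : ℝ :=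
  ∫ t, x t ∂(condLaw F (pool idx S z) 0)

include hx0 in
theorem poolAvg_nonneg (z : ℝ) (S : Finset ℕ) : 0 ≤ poolAvg F idx x z S :=
  integral_nonneg hx0

include hx hx0 hx1 in
theorem poolAvg_le_one (z : ℝ) (S : Finset ℕ) : poolAvg F idx x z S ≤ 1 := by
  have := integral_mono (integrable_of_unit hx hx0 hx1 (condLaw F (pool idx S z) 0))
    (integrable_const (1 : ℝ)) hx1
  simpa [poolAvg] using this

include hx hx0 hx1 in
theorem integral_poolKernel (z : ℝ) :
    ∫ t, x t ∂(poolKernel F hidx τ z) = ∫ S, poolAvg F idx x z S ∂τ := by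
  let κ : Kernel (Finset ℕ) ℝ := ⟨fun S => condLaw F (pool idx S z) 0, measurable_of_countable _⟩
  have h : (κ ∘ₖ Kernel.const Unit τ) () = poolKernel F hidx τ z := by
    rw [Kernel.comp_apply, Kernel.const_apply]
    rfl
  rw [← h, Kernel.integral_comp, Kernel.const_apply]
  · rfl
  · rw [h]
    exact integrable_of_unit hx hx0 hx1 _

include hidx hx in
theorem measurable_poolAvg : Measurable fun p : ℝ × Finset ℕ => poolAvg F idx x p.1 p.2 := by
  let κ : Kernel (ℝ × Finset ℕ) ℝ := ⟨_, measurable_poolLaw F hidx⟩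
  have h : Measurable fun p => ∫ t, x t ∂(κ p) :=
    (hx.stronglyMeasurable.integral_kernel (κ := κ)).measurable
  exact h

/-- Pooling along `S` makes `x` nearly monotone, and costs little welfare. -/
def Good (idx : ℝ → ℕ) (x : ℝ → ℝ) (γ L : ℝ) (S : Finset ℕ) : Prop :=
  (∀ z z', z ≤ z' → poolAvg F idx x z S ≤ poolAvg F idx x z' S + γ) ∧
    ∫ z, z * x z ∂F ≤ ∫ z, z * poolAvg F idx x z S ∂F + L

variable {γ L δ vmax : ℝ}

include hx hx0 hx1 in
theorem integrable_poolAvg (z : ℝ) : Integrable (poolAvg F idx x z) τ :=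
  Integrable.of_bound (measurable_of_countable _).aestronglyMeasurable 1
    (Filter.Eventually.of_forall fun S => by
      rw [Real.norm_eq_abs, abs_of_nonneg (poolAvg_nonneg F hx0 z S)]
      exact poolAvg_le_one F hx hx0 hx1 z S)

theorem integral_add_indicator {g : Finset ℕ → ℝ} (hg : Integrable g τ) (s : Set (Finset ℕ))
    (a b : ℝ) : ∫ S, (g S + a + s.indicator (fun _ => b) S) ∂τ
      = ∫ S, g S ∂τ + a + τ.real s * b := by
  rw [integral_add (f := fun S => g S + a) (hg.add (integrable_const a))
    ((integrable_const b).indicator MeasurableSet.of_discrete), integral_add hg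
    (integrable_const a), integral_indicator_const _ MeasurableSet.of_discrete]
  simp

include hx hx0 hx1 in
-- Both values see the same law of boundaries, so they can be compared for each `S`. Bad boundaries
-- cost at most `1` and have probability at most `δ`.
theorem integral_poolKernel_mono (hγ : 0 ≤ γ) (hτ : τ.real {S | ¬ Good F idx x γ L S} ≤ δ)
    {z z' : ℝ} (hz : z ≤ z') :
    ∫ t, x t ∂(poolKernel F hidx τ z) ≤ ∫ t, x t ∂(poolKernel F hidx τ z') + (γ + δ) := by
  rw [integral_poolKernel F hidx τ hx hx0 hx1, integral_poolKernel F hidx τ hx hx0 hx1]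
  have h : ∀ S, poolAvg F idx x z S
      ≤ poolAvg F idx x z' S + γ + {S | ¬ Good F idx x γ L S}.indicator (fun _ => (1 : ℝ)) S := by
    intro S
    by_cases hS : Good F idx x γ L S
    · rw [indicator_of_notMem (by simpa using hS), add_zero]
      exact hS.1 z z' hz
    · rw [indicator_of_mem (by simpa using hS)]
      linarith [poolAvg_le_one F hx hx0 hx1 (idx := idx) z S, poolAvg_nonneg F hx0 (idx := idx) z' S]
  have h2 := integral_mono (integrable_poolAvg F τ hx hx0 hx1 z)
    (((integrable_poolAvg F τ hx hx0 hx1 z').add (integrable_const γ)).add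
      ((integrable_const (1 : ℝ)).indicator MeasurableSet.of_discrete)) h
  have h3 := integral_add_indicator τ (integrable_poolAvg F τ hx hx0 hx1 (idx := idx) z')
    {S | ¬ Good F idx x γ L S} γ 1
  linarith [h2.trans_eq h3]

include hx hx0 hx1 in
-- Bad boundaries lose at most the mean of `F`, so their probability enters the loss relative to the
-- mean, not to `vmax`.
theorem integral_mul_poolKernel (hF : ∀ᵐ z ∂F, z ∈ Icc 0 vmax) (hL : 0 ≤ L)
    (hτ : τ.real {S | ¬ Good F idx x γ L S} ≤ δ) :
    ∫ z, z * x z ∂F - (L + δ * ∫ z, z ∂F) ≤ ∫ z, z * ∫ t, x t ∂(poolKernel F hidx τ z) ∂F := by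
  have hz : Integrable (fun z : ℝ => z) F := Integrable.of_mem_Icc 0 vmax aemeasurable_id hF
  have hbd : ∀ g : ℝ → ℝ, Measurable g → (∀ z, 0 ≤ g z) → (∀ z, g z ≤ 1) →
      Integrable (fun z => z * g z) F := fun g hg h0 h1 =>
    hz.mul_bdd hg.aestronglyMeasurable (Filter.Eventually.of_forall fun z => by
      rw [Real.norm_eq_abs, abs_of_nonneg (h0 z)]; exact h1 z)
  have hmean : 0 ≤ ∫ z, z ∂F := integral_nonneg_of_ae (hF.mono fun z h => h.1)
  have hS : ∀ S, ∫ z, z * x z ∂F ≤ ∫ z, z * poolAvg F idx x z S ∂F + L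
      + {S | ¬ Good F idx x γ L S}.indicator (fun _ => ∫ z, z ∂F) S := by
    intro S
    by_cases hS : Good F idx x γ L S
    · rw [indicator_of_notMem (by simpa using hS), add_zero]
      exact hS.2
    · rw [indicator_of_mem (by simpa using hS)]
      have h1 : ∫ z, z * x z ∂F ≤ ∫ z, z ∂F :=
        integral_mono_ae (hbd x hx hx0 hx1) hz (hF.mono fun z h => by
          simpa using mul_le_mul_of_nonneg_left (hx1 z) h.1)
      have h2 : 0 ≤ ∫ z, z * poolAvg F idx x z S ∂F :=
        integral_nonneg_of_ae (hF.mono fun z h => mul_nonneg h.1 (poolAvg_nonneg F hx0 z S))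
      linarith
  have hprod : Integrable (fun p : ℝ × Finset ℕ => p.1 * poolAvg F idx x p.1 p.2) (F.prod τ) :=
    (hz.comp_fst τ).mul_bdd (measurable_poolAvg F hidx hx).aestronglyMeasurable
      (Filter.Eventually.of_forall fun p => by
        rw [Real.norm_eq_abs, abs_of_nonneg (poolAvg_nonneg F hx0 _ _)]
        exact poolAvg_le_one F hx hx0 hx1 _ _)
  have hint : Integrable (fun S => ∫ z, z * poolAvg F idx x z S ∂F) τ := hprod.integral_prod_right
  have h2 := integral_mono (μ := τ) (integrable_const _) ((hint.add (integrable_const L)).add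
    ((integrable_const (∫ z, z ∂F)).indicator MeasurableSet.of_discrete)) hS
  have h3 := h2.trans_eq (integral_add_indicator τ hint _ L _)
  rw [integral_integral_swap (f := fun S z => z * poolAvg F idx x z S) hprod.swap] at h3
  simp only [integral_const, probReal_univ, smul_eq_mul, one_mul, integral_const_mul] at h3
  simp only [integral_poolKernel F hidx τ hx hx0 hx1]
  have := mul_le_mul_of_nonneg_right hτ hmean
  linarith

end mixture

end Ironing

end BayesMech

/-! ### From values to buckets. -/

namespace BayesMech

namespace Ironing

open Proc

section bucket

variable (F : Measure ℝ) [IsProbabilityMeasure F] (idx : ℝ → ℕ) (x : ℝ → ℝ)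

/-- The probability of a bucket. -/
def weight (b : ℕ) : ℝ := F.real (idx ⁻¹' {b})

/-- The average of `x` over a bucket. -/
def average (b : ℕ) : ℝ := (∫ z in idx ⁻¹' {b}, x z ∂F) / weight F idx b

theorem weight_nonneg (b : ℕ) : 0 ≤ weight F idx b := measureReal_nonneg

theorem weight_mul_average (b : ℕ) :
    weight F idx b * average F idx x b = ∫ z in idx ⁻¹' {b}, x z ∂F := by
  rcases eq_or_ne (weight F idx b) 0 with h | h
  · have h2 : F (idx ⁻¹' {b}) = 0 := by
      rwa [weight, measureReal_eq_zero_iff] at h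
    rw [h, zero_mul, Measure.restrict_eq_zero.2 h2, integral_zero_measure]
  · rw [average, mul_div_cancel₀ _ h]

variable {F idx x} {K : ℕ} (hidx : Measurable idx) (hK : ∀ z, idx z < K)

theorem preimage_eq_biUnion (s : Finset ℕ) : idx ⁻¹' (s : Set ℕ) = ⋃ b ∈ s, idx ⁻¹' {b} := by
  ext z
  simp

include hidx in
theorem measureReal_preimage (s : Finset ℕ) :
    F.real (idx ⁻¹' (s : Set ℕ)) = ∑ b ∈ s, weight F idx b := by
  rw [preimage_eq_biUnion, measureReal_biUnion_finset]
  · rfl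
  · exact fun i _ j _ hij => Disjoint.preimage _ (by simpa using hij)
  · exact fun b _ => hidx (measurableSet_singleton b)

include hidx in
theorem setIntegral_preimage (hx : Integrable x F) (s : Finset ℕ) :
    ∫ z in idx ⁻¹' (s : Set ℕ), x z ∂F = ∑ b ∈ s, weight F idx b * average F idx x b := by
  simp_rw [weight_mul_average]
  rw [preimage_eq_biUnion, integral_biUnion_finset]
  · exact fun b _ => hidx (measurableSet_singleton b)
  · exact fun i _ j _ hij => Disjoint.preimage _ (by simpa using hij)
  · exact fun b _ => hx.integrableOn

include hidx hK in
theorem integral_comp_mul (hx : Integrable x F) (g : ℕ → ℝ) :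
    ∫ z, g (idx z) * x z ∂F
      = ∑ b ∈ Finset.range K, g b * (weight F idx b * average F idx x b) := by
  have hm : ∀ b, MeasurableSet (idx ⁻¹' {b}) := fun b => hidx (measurableSet_singleton b)
  have hU : idx ⁻¹' (Finset.range K : Set ℕ) = univ := by
    ext z
    simpa using hK z
  have hcongr : ∀ b, ∀ z ∈ idx ⁻¹' {b}, g (idx z) * x z = g b * x z := by
    intro b z hz
    rw [show idx z = b from hz]
  rw [← setIntegral_univ, ← hU, preimage_eq_biUnion, integral_biUnion_finset]
  · refine Finset.sum_congr rfl fun b _ => ?_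
    rw [setIntegral_congr_fun (hm b) (hcongr b), integral_const_mul, weight_mul_average]
  · exact fun b _ => hm b
  · exact fun i _ j _ hij => Disjoint.preimage _ (by simpa using hij)
  · intro b _
    exact IntegrableOn.congr_fun (hx.integrableOn.const_mul (g b))
      (fun z hz => (hcongr b z hz).symm) (hm b)

include hidx hK in
theorem tail_weight_zero : tail K (weight F idx) 0 = 1 := by
  have hU : idx ⁻¹' ((Finset.Ico 0 K : Finset ℕ) : Set ℕ) = univ := by
    ext z
    simpa using hK z
  rw [tail, ← measureReal_preimage hidx, hU, probReal_univ]

include hK in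
theorem pool_eq_preimage {S : Finset ℕ} (h0 : 0 ∈ S) (hKS : K ∈ S) (z : ℝ) :
    pool idx S z
      = idx ⁻¹' ((Finset.Ico (lo S (idx z)) (hi S (idx z)) : Finset ℕ) : Set ℕ) := by
  ext z'
  simp only [pool, mem_ofPred_eq, mem_preimage, Finset.coe_Ico, mem_Ico]
  constructor
  · intro h
    refine ⟨h ▸ (lo_mem h0 (idx z')).2, ?_⟩
    by_contra! h2
    have h3 := le_lo (hi_mem hKS (hK z)).1 h2
    have h4 := (hi_mem hKS (hK z)).2
    have h5 := (lo_mem h0 (idx z)).2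
    omega
  · rintro ⟨h1, h2⟩
    exact (lo_hi_eq (consec_lo_hi h0 hKS (hK z)) h1 h2).1

include hidx hK in
-- A pool is a union of whole buckets, so its conditional average is the slope between its two
-- boundaries. This connects the resampling kernel with the ironing of finite sequences.
theorem poolAvg_eq_slope (hx : Integrable x F) {S : Finset ℕ} (h0 : 0 ∈ S) (hKS : K ∈ S)
    (hS : ∀ b ∈ S, b ≤ K) (z : ℝ)
    (hpos : tail K (weight F idx) (hi S (idx z)) < tail K (weight F idx) (lo S (idx z))) :
    poolAvg F idx x z S = slope (tail K (weight F idx))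
      (tail K fun b => weight F idx b * average F idx x b) (lo S (idx z)) (hi S (idx z)) := by
  have hc := consec_lo_hi h0 hKS (hK z)
  have hle := hS _ hc.2.1
  rw [slope, tail_sub_tail _ hc.2.2.1.le hle, tail_sub_tail _ hc.2.2.1.le hle,
    ← measureReal_preimage hidx, ← setIntegral_preimage hidx hx, ← pool_eq_preimage hK h0 hKS]
  rw [← sub_pos, tail_sub_tail _ hc.2.2.1.le hle, ← measureReal_preimage hidx,
    ← pool_eq_preimage hK h0 hKS] at hpos
  have h : F (pool idx S z) ≠ 0 := by
    intro h
    rw [Measure.real, h] at hpos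
    simp at hpos
  rw [poolAvg, condLaw_eq_cond h, ProbabilityTheory.cond, integral_smul_measure]
  simp [Measure.real, div_eq_inv_mul]

/-- Supported pool boundaries are good when the estimates are accurate. -/
theorem Supported.good {pos : ℕ → Prop} {u : ℕ → ℕ → ℝ} {y : ℕ → ℝ} {ν e η q : ℝ} {S : Finset ℕ}
    (hS : Supported K pos u ν S) (hidx : Measurable idx) (hmono : Monotone idx)
    (hK : ∀ z, idx z < K) (hx : Measurable x) (hx0 : ∀ z, 0 ≤ x z) (hx1 : ∀ z, x z ≤ 1)
    (hpos : ∀ b < K, pos b ↔ 0 < weight F idx b) (hν : 0 ≤ ν) (hη : 0 ≤ η) (hq : 0 ≤ q)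
    (he0 : 0 ≤ e)
    (hu : ∀ a b, a < b → b ≤ K → tail K (weight F idx) b < tail K (weight F idx) a →
      |u a b - slope (tail K (weight F idx)) (tail K fun b => weight F idx b * y b) a b| ≤ ν)
    (he : ∀ b < K, 0 < weight F idx b → |y b - average F idx x b| ≤ e)
    (htail : ∀ t ≤ K, |tail K (fun b => weight F idx b * y b) t
        - tail K (fun b => weight F idx b * average F idx x b) t|
      ≤ η * (tail K (weight F idx) t + q))
    {vmax θ μ : ℝ} (hF : ∀ᵐ z ∂F, z ∈ Icc 0 vmax) (hμ : ∫ z, z ∂F ≤ μ) {ζ : ℕ → ℝ}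
    (hζ : Monotone ζ) (hζ0 : 0 ≤ ζ 0) (hZ : ∀ b ≤ K, ζ b ≤ vmax)
    (hζle : ∀ z ∈ Icc 0 vmax, ζ (idx z) ≤ z)
    (hleζ : ∀ z ∈ Icc 0 vmax, z ≤ (1 + η) * ζ (idx z) + θ) (hθ : 0 ≤ θ) :
    Good F idx x (4 * ν + 2 * e) (θ + η * μ + (4 * ν + 2 * η) * μ + 2 * η * q * vmax) S := by
  have hle : ∀ b ∈ S, b ≤ K := fun b hb =>
    Nat.lt_succ_iff.1 (Finset.mem_range.1 (hS.subset hb))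
  have hw := weight_nonneg F idx
  have hint := integrable_of_unit hx hx0 hx1 F
  have hslope : ∀ z, poolAvg F idx x z S = slope (tail K (weight F idx))
      (tail K fun b => weight F idx b * average F idx x b) (lo S (idx z)) (hi S (idx z)) :=
    fun z => poolAvg_eq_slope hidx hK hint hS.zero_mem hS.last_mem hle z
      (hS.pos_tail hw hpos (consec_lo_hi hS.zero_mem hS.last_mem (hK z)))
  have hz : Integrable (fun z : ℝ => z) F := Integrable.of_mem_Icc 0 vmax aemeasurable_id hF
  have hζb : ∀ z, |ζ (idx z)| ≤ vmax := fun z => by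
    rw [abs_of_nonneg (hζ0.trans (hζ (Nat.zero_le _)))]
    exact hZ _ (hK z).le
  have hζm : Measurable fun z => ζ (idx z) := (measurable_of_countable ζ).comp hidx
  have hζi : Integrable (fun z => ζ (idx z)) F :=
    Integrable.of_bound hζm.aestronglyMeasurable vmax (Filter.Eventually.of_forall hζb)
  have hbd : ∀ f : ℝ → ℝ, Integrable f F → ∀ g : ℝ → ℝ, Measurable g → (∀ z, 0 ≤ g z) →
      (∀ z, g z ≤ 1) → Integrable (fun z => f z * g z) F := fun f hf g hg h0 h1 =>
    hf.mul_bdd hg.aestronglyMeasurable (Filter.Eventually.of_forall fun z => by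
      rw [Real.norm_eq_abs, abs_of_nonneg (h0 z)]; exact h1 z)
  have havg0 : ∀ z, 0 ≤ poolAvg F idx x z S := fun z => poolAvg_nonneg F hx0 z S
  have havg1 : ∀ z, poolAvg F idx x z S ≤ 1 := fun z => poolAvg_le_one F hx hx0 hx1 z S
  have havgm : Measurable fun z => poolAvg F idx x z S :=
    (measurable_poolAvg F hidx hx).comp (measurable_id.prodMk measurable_const)
  refine ⟨fun z z' hzz => ?_, ?_⟩
  · have hc := consec_lo_hi hS.zero_mem hS.last_mem (hK z)
    have hc' := consec_lo_hi hS.zero_mem hS.last_mem (hK z')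
    rw [hslope, hslope]
    -- The larger value lies either in the same pool or in a later one.
    rcases lt_or_ge (idx z') (hi S (idx z)) with h | h
    · have h2 := lo_hi_eq hc ((lo_mem hS.zero_mem (idx z)).2.trans (hmono hzz)) h
      rw [h2.1, h2.2]
      linarith
    · exact hS.slope_le_slope hw hpos hu he hc hc' (le_lo hc.2.1 h)
  -- Rounding `z` down to its bucket floor costs `η * μ + θ` in the mean. The remaining loss comes
  -- from pooling, and rounding back up to `z` in the pooled integral only helps.
  · have h1 : ∫ z, z * x z ∂F ≤ ∫ z, (ζ (idx z) * x z + η * z + θ) ∂F := by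
      refine integral_mono_ae (hbd _ hz x hx hx0 hx1)
        (((hbd _ hζi x hx hx0 hx1).add (hz.const_mul η)).add (integrable_const θ))
        (hF.mono fun z h => ?_)
      have a1 := mul_le_mul_of_nonneg_right (hleζ z h) (hx0 z)
      have a2 : 0 ≤ ζ (idx z) := hζ0.trans (hζ (Nat.zero_le _))
      have a3 := mul_le_mul_of_nonneg_left (hx1 z) (mul_nonneg hη a2)
      have a4 := mul_le_mul_of_nonneg_left (hx1 z) hθ
      have a5 := mul_le_mul_of_nonneg_left (hζle z h) hη
      show z * x z ≤ ζ (idx z) * x z + η * z + θ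
      linarith
    have h2 : ∫ z, (ζ (idx z) * x z + η * z + θ) ∂F
        = ∫ z, ζ (idx z) * x z ∂F + η * ∫ z, z ∂F + θ := by
      rw [integral_add (f := fun z => ζ (idx z) * x z + η * z)
        ((hbd _ hζi x hx hx0 hx1).add (hz.const_mul η)) (integrable_const θ),
        integral_add (hbd _ hζi x hx hx0 hx1) (hz.const_mul η), integral_const_mul]
      simp
    have h3 := hS.sum_le_pooled hw hpos hν hη hq hu htail hζ hζ0 hZ
    rw [← integral_comp_mul hidx hK hint ζ] at h3
    have h4 : ∑ b ∈ Finset.range K, ζ b * weight F idx b = ∫ z, ζ (idx z) ∂F := by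
      have := integral_comp_mul (F := F) hidx hK (integrable_const (1 : ℝ)) ζ
      simp only [mul_one] at this
      rw [this]
      refine Finset.sum_congr rfl fun b _ => ?_
      rw [weight_mul_average]
      simp [weight, Measure.real]
    have h5 : ∫ z, ζ (idx z) ∂F ≤ μ :=
      (integral_mono_ae hζi hz (hF.mono fun z h => hζle z h)).trans hμ
    have h6 : ∑ b ∈ Finset.range K, ζ b * (weight F idx b * slope (tail K (weight F idx))
        (tail K fun b => weight F idx b * average F idx x b) (lo S b) (hi S b))
        ≤ ∫ z, z * poolAvg F idx x z S ∂F := by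
      have := integral_comp_mul (F := F) hidx hK (integrable_const (1 : ℝ)) fun b =>
        ζ b * slope (tail K (weight F idx))
          (tail K fun b => weight F idx b * average F idx x b) (lo S b) (hi S b)
      simp only [mul_one, weight_mul_average F idx (fun _ => (1 : ℝ))] at this
      simp only [integral_const, smul_eq_mul, mul_one] at this
      have h7 : ∀ b, (F.restrict (idx ⁻¹' {b})).real univ = weight F idx b := by
        intro b
        simp [weight, Measure.real]
      simp only [h7] at this
      calc _ = ∫ z, ζ (idx z) * poolAvg F idx x z S ∂F := by
            simp_rw [hslope]
            rw [this]
            exact Finset.sum_congr rfl fun b _ => by ring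
        _ ≤ _ := integral_mono_ae (hbd _ hζi _ havgm havg0 havg1)
            (hbd _ hz _ havgm havg0 havg1)
            (hF.mono fun z h => mul_le_mul_of_nonneg_right (hζle z h) (havg0 z))
    rw [h4] at h3
    have h8 := mul_le_mul_of_nonneg_left h5 (show 0 ≤ 4 * ν + 2 * η by positivity)
    have h9 := mul_le_mul_of_nonneg_left hμ hη
    linarith

end bucket

end Ironing

end BayesMech

/-! ### Geometric buckets and the schedule of trials. -/

namespace BayesMech

namespace Ironing

section bucketing

variable (η θ vmax : ℝ)

/-- The geometric bucket of a value. -/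
def bucket (z : ℝ) : ℕ := ⌈Real.logb (1 + η) (max θ (min z vmax) / θ)⌉₊

/-- The number of buckets. -/
def bucketCount : ℕ := ⌈Real.logb (1 + η) (vmax / θ)⌉₊ + 1

/-- The lower end of a bucket. -/
def bucketFloor (b : ℕ) : ℝ := min vmax (if b = 0 then 0 else θ * (1 + η) ^ (b - 1))

variable {η θ vmax} (hη : 0 < η) (hθ : 0 < θ) (hv : θ ≤ vmax)

include hη hθ in
theorem bucket_mono : Monotone (bucket η θ vmax) := fun z z' h => by
  have : 0 < max θ (min z vmax) := lt_max_of_lt_left hθ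
  unfold bucket
  gcongr
  linarith

include hη hθ hv in
theorem bucket_lt (z : ℝ) : bucket η θ vmax z < bucketCount η θ vmax := by
  have : 0 < max θ (min z vmax) := lt_max_of_lt_left hθ
  refine Nat.lt_succ_of_le ?_
  unfold bucket
  gcongr
  · linarith
  · exact max_le hv (min_le_right _ _)

/-- Clipping at `vmax` makes all larger bids equivalent, so the resulting interim allocation is
constant beyond `vmax`. -/
theorem bucket_of_le {z : ℝ} (hz : vmax ≤ z) : bucket η θ vmax z = bucket η θ vmax vmax := by
  rw [bucket, min_eq_right hz, bucket, min_self]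

include hη hθ in
theorem bucketFloor_mono : Monotone (bucketFloor η θ vmax) := fun b b' h => by
  refine min_le_min_left _ ?_
  rcases Nat.eq_zero_or_pos b with rfl | hb
  · rw [if_pos rfl]
    split_ifs <;> positivity
  · rw [if_neg hb.ne', if_neg (by omega)]
    have : b - 1 ≤ b' - 1 := by omega
    gcongr
    linarith

include hθ hv in
theorem bucketFloor_zero : bucketFloor η θ vmax 0 = 0 := by
  rw [bucketFloor, if_pos rfl, min_eq_right (by linarith)]

theorem bucketFloor_le (b : ℕ) : bucketFloor η θ vmax b ≤ vmax := min_le_left _ _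

include hη hθ in
-- A bucket `b > 0` contains only values above `θ * (1 + η) ^ (b - 1)`; bucket `0` contains the
-- values up to `θ` and has floor `0`.
theorem bucketFloor_bucket_le {z : ℝ} (hz : z ∈ Icc 0 vmax) :
    bucketFloor η θ vmax (bucket η θ vmax z) ≤ z := by
  rcases Nat.eq_zero_or_pos (bucket η θ vmax z) with h | h
  · rw [h, bucketFloor, if_pos rfl]
    exact (min_le_right _ _).trans hz.1
  · have h1 : bucket η θ vmax z - 1 < bucket η θ vmax z := by omega
    nth_rewrite 2 [bucket] at h1
    have hpos : 0 < max θ (min z vmax) := lt_max_of_lt_left hθ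
    rw [Nat.lt_ceil, Real.lt_logb_iff_rpow_lt (by linarith) (by positivity), Real.rpow_natCast,
      lt_div_iff₀ hθ, min_eq_left hz.2, lt_max_iff] at h1
    rw [bucketFloor, if_neg h.ne']
    refine (min_le_right _ _).trans ?_
    rcases h1 with h1 | h1
    · have := one_le_pow₀ (n := bucket η θ vmax z - 1) (show 1 ≤ 1 + η by linarith)
      nlinarith
    · linarith

include hη hθ in
-- The rounding error is a factor `1 + η` in positive buckets and an additive `θ` in bucket `0`.
theorem le_bucketFloor_bucket {z : ℝ} (hz : z ∈ Icc 0 vmax) :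
    z ≤ (1 + η) * bucketFloor η θ vmax (bucket η θ vmax z) + θ := by
  have hpos : 0 < max θ (min z vmax) := lt_max_of_lt_left hθ
  have h1 := Nat.le_ceil (Real.logb (1 + η) (max θ (min z vmax) / θ))
  change _ ≤ ((bucket η θ vmax z : ℕ) : ℝ) at h1
  rw [Real.logb_le_iff_le_rpow (by linarith) (by positivity), Real.rpow_natCast, div_le_iff₀ hθ,
    min_eq_left hz.2] at h1
  have h2 := (le_max_right θ z).trans h1
  rw [bucketFloor]
  rcases Nat.eq_zero_or_pos (bucket η θ vmax z) with h | h
  · have hv : 0 ≤ vmax := hz.1.trans hz.2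
    rw [h, if_pos rfl, min_eq_right hv]
    rw [h] at h2
    linarith
  · rw [if_neg h.ne']
    rcases min_choice vmax (θ * (1 + η) ^ (bucket η θ vmax z - 1)) with h3 | h3
    · rw [h3]
      nlinarith [hz.1, hz.2]
    · rw [h3]
      have h4 : (1 + η) ^ bucket η θ vmax z
          = (1 + η) ^ (bucket η θ vmax z - 1) * (1 + η) := by
        rw [← pow_succ]
        congr 1
        omega
      rw [h4] at h2
      linarith

end bucketing

section schedule

/-- The number of trials for the bucket `c`, where `ρ c` is an estimate of the probability of the
bucket `c` among the buckets from `c` on. -/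
def trials (n m₀ : ℕ) (Λ : ℝ) (ρ : ℕ → ℝ) (c : ℕ) : ℕ :=
  if ∑ b ∈ Finset.range (c + 1), ρ b ≤ Λ then m₀ * (1 + ⌈n * ρ c⌉₊) else m₀

variable {n m₀ : ℕ} {Λ : ℝ} {ρ : ℕ → ℝ}

theorem le_trials (c : ℕ) : m₀ ≤ trials n m₀ Λ ρ c := by
  unfold trials
  split_ifs
  · exact Nat.le_mul_of_pos_right _ (by omega)
  · exact le_rfl

/-- Extra trials are granted only while the accumulated hazard is at most `Λ`, so the granted
hazards sum to at most `Λ`. The basic share and the rounding up account for `2 * K`. -/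
theorem sum_trials_le (hρ : ∀ b, 0 ≤ ρ b) (hΛ : 0 ≤ Λ) (K : ℕ) :
    ∑ c ∈ Finset.range K, trials n m₀ Λ ρ c ≤ m₀ * (2 * K + ⌈n * Λ⌉₊) := by
  have h1 : ∀ K : ℕ, ∑ c ∈ Finset.range K,
      (if ∑ b ∈ Finset.range (c + 1), ρ b ≤ Λ then ρ c else 0) ≤ Λ := by
    intro K
    induction K with
    | zero => simpa using hΛ
    | succ K ih =>
      by_cases h : ∑ b ∈ Finset.range (K + 1), ρ b ≤ Λ
      · refine (Finset.sum_le_sum fun c _ => ?_).trans h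
        split_ifs
        · exact le_rfl
        · exact hρ c
      · rw [Finset.sum_range_succ, if_neg h, add_zero]
        exact ih
  have h2 : ∀ c, (trials n m₀ Λ ρ c : ℝ)
      ≤ m₀ * (2 + n * (if ∑ b ∈ Finset.range (c + 1), ρ b ≤ Λ then ρ c else 0)) := by
    intro c
    unfold trials
    split_ifs
    · push_cast
      have := (Nat.ceil_lt_add_one (mul_nonneg (Nat.cast_nonneg n) (hρ c))).le
      exact mul_le_mul_of_nonneg_left (by linarith) (Nat.cast_nonneg _)
    · have : (0 : ℝ) ≤ m₀ := Nat.cast_nonneg _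
      linarith
  have h3 : (∑ c ∈ Finset.range K, (trials n m₀ Λ ρ c : ℝ)) ≤ m₀ * (2 * K + ⌈n * Λ⌉₊) := by
    refine (Finset.sum_le_sum fun c _ => h2 c).trans ?_
    rw [← Finset.mul_sum, Finset.sum_add_distrib, ← Finset.mul_sum]
    have h4 := mul_le_mul_of_nonneg_left (h1 K) (Nat.cast_nonneg (α := ℝ) n)
    have h5 := Nat.le_ceil (n * Λ)
    gcongr
    · simp [mul_comm]
    · exact h4.trans h5
  exact_mod_cast h3

/-- Each bucket multiplies the tail by one minus its hazard `h`, and `1 - h ≤ exp (-h)`. -/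
theorem tail_le_exp {K : ℕ} {w : ℕ → ℝ} (hw : ∀ b, 0 ≤ w b) (h0 : tail K w 0 = 1) {c : ℕ}
    (hc : c ≤ K) :
    tail K w c ≤ Real.exp (-∑ b ∈ Finset.range c, w b / tail K w b) := by
  induction c with
  | zero => simp [h0]
  | succ c ih =>
    have h1 : tail K w c - tail K w (c + 1) = w c := by
      rw [tail_sub_tail w (Nat.le_succ c) hc]
      simp
    have h2 := ih (by omega)
    have h3 : 0 ≤ tail K w c := Finset.sum_nonneg fun b _ => hw b
    rw [Finset.sum_range_succ, neg_add, Real.exp_add]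
    rcases eq_or_lt_of_le h3 with h | h
    · have h4 := hw c
      have : tail K w (c + 1) ≤ 0 := by linarith
      exact this.trans (by positivity)
    · have h4 := Real.add_one_le_exp (-(w c / tail K w c))
      calc tail K w (c + 1) = tail K w c * (-(w c / tail K w c) + 1) := by
            field_simp
            linarith
        _ ≤ tail K w c * Real.exp (-(w c / tail K w c)) := by gcongr
        _ ≤ _ := by gcongr

/-- This is the bound behind the variance of the tail sums. A bucket with extra trials has at least
`m₀ * n` times its hazard of them. Any other bucket lies beyond so much hazard that its tail weight
is at most `q / n`, and the basic `m₀` trials suffice. -/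
theorem weight_le_trials {K : ℕ} {w : ℕ → ℝ} {δ q : ℝ} (hw : ∀ b, 0 ≤ w b)
    (h0 : tail K w 0 = 1) (hρ : ∀ b < K, |ρ b - w b / tail K w b| ≤ δ) (hn : 1 ≤ n)
    (hnδ : n * δ ≤ 1) (hKδ : K * δ ≤ 1) (hq : 0 < q) (hΛ : 2 + Real.log (n / q) ≤ Λ) {c : ℕ}
    (hc : c < K) : n * w c * m₀ ≤ trials n m₀ Λ ρ c * (tail K w c + q) := by
  have hn0 : (0 : ℝ) < n := by exact_mod_cast hn
  have hm : (0 : ℝ) ≤ m₀ := Nat.cast_nonneg _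
  have ht : ∀ t, 0 ≤ tail K w t := fun t => Finset.sum_nonneg fun b _ => hw b
  have hwt : ∀ b < K, w b ≤ tail K w b := by
    intro b hb
    have h1 : tail K w b - tail K w (b + 1) = w b := by
      rw [tail_sub_tail w (Nat.le_succ b) hb]
      simp
    linarith [ht (b + 1)]
  unfold trials
  split_ifs with h
  · push_cast
    have h1 := (abs_le.1 (hρ c hc)).1
    have h2 := Nat.le_ceil (n * ρ c)
    have h3 : (n : ℝ) * (w c / tail K w c) ≤ 1 + ⌈n * ρ c⌉₊ := by nlinarith
    have h4 : (n : ℝ) * w c ≤ (1 + ⌈n * ρ c⌉₊) * (tail K w c + q) := by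
      rcases eq_or_lt_of_le (ht c) with h5 | h5
      · have h6 := hwt c hc
        have h7 : w c = 0 := le_antisymm (by linarith) (hw c)
        rw [h7, mul_zero, ← h5]
        positivity
      · rw [mul_div_assoc', div_le_iff₀ h5] at h3
        refine h3.trans ?_
        gcongr
        linarith
    nlinarith
  · push Not at h
    -- The summand `2` in the bound on `Λ` has two sources: `1` for the accumulated estimation
    -- error, at most `K * δ`, and `1` for the hazard of bucket `c` itself, which must be left out
    -- to bound the tail starting at `c`.
    have h1 : ∑ b ∈ Finset.range (c + 1), ρ b
        ≤ ∑ b ∈ Finset.range (c + 1), (w b / tail K w b) + 1 := by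
      have h2 : ∑ b ∈ Finset.range (c + 1), ρ b
          ≤ ∑ b ∈ Finset.range (c + 1), (w b / tail K w b + δ) := by
        refine Finset.sum_le_sum fun b hb => ?_
        rw [Finset.mem_range] at hb
        linarith [(abs_le.1 (hρ b (by omega))).2]
      refine h2.trans ?_
      rw [Finset.sum_add_distrib]
      simp only [Finset.sum_const, Finset.card_range, nsmul_eq_mul]
      have hδ : 0 ≤ δ := (abs_nonneg _).trans (hρ c hc)
      have : ((c + 1 : ℕ) : ℝ) ≤ K := by exact_mod_cast hc
      have := mul_le_mul_of_nonneg_right this hδ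
      linarith
    rw [Finset.sum_range_succ _ c] at h1
    have h2 : w c / tail K w c ≤ 1 := div_le_one_of_le₀ (hwt c hc) (ht c)
    have h3 : Real.log (n / q) ≤ ∑ b ∈ Finset.range c, w b / tail K w b := by
      rw [Finset.sum_range_succ] at h
      rw [Finset.sum_range_succ] at h1
      linarith
    have h4 : tail K w c ≤ q / n := by
      refine (tail_le_exp hw h0 hc.le).trans ?_
      calc Real.exp (-∑ b ∈ Finset.range c, w b / tail K w b)
          ≤ Real.exp (-Real.log (n / q)) := by gcongr
        _ = q / n := by
          rw [Real.exp_neg, Real.exp_log (by positivity), inv_div]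
    rw [le_div_iff₀ hn0] at h4
    have h5 := hwt c hc
    have h6 : (n : ℝ) * w c ≤ tail K w c + q := by nlinarith [ht c]
    nlinarith

end schedule

end Ironing

end BayesMech

/-! ### Concentration, and repeated sampling by oracle computations. -/

namespace BayesMech

section concentration

open scoped NNReal

theorem _root_.ProbabilityTheory.HasSubgaussianMGF.mono {Ω : Type*} [MeasurableSpace Ω]
    {μ : Measure Ω} {X : Ω → ℝ} {c V : ℝ≥0} (h : HasSubgaussianMGF X c μ) (hV : c ≤ V) :
    HasSubgaussianMGF X V μ :=
  ⟨h.integrable_exp_mul, fun t => (h.mgf_le t).trans (by gcongr)⟩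

theorem _root_.ProbabilityTheory.HasSubgaussianMGF.measureReal_lt_abs_le {Ω : Type*}
    [MeasurableSpace Ω] {μ : Measure Ω} [IsFiniteMeasure μ] {X : Ω → ℝ} {c : ℝ≥0}
    (h : HasSubgaussianMGF X c μ) {V ε a : ℝ} (hV : c ≤ V) (hε : 0 ≤ ε)
    (ha : 2 * V * a ≤ ε ^ 2) (hV0 : 0 < V) :
    μ.real {ω | ε < |X ω|} ≤ 2 * Real.exp (-a) := by
  lift V to ℝ≥0 using hV0.le
  have h' := h.mono (V := V) (by exact_mod_cast hV)
  have h1 := h'.measure_ge_le hε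
  have h2 := h'.neg.measure_ge_le hε
  have h3 : Real.exp (-ε ^ 2 / (2 * V)) ≤ Real.exp (-a) := by
    rw [Real.exp_le_exp, div_le_iff₀ (by positivity)]
    linarith
  have h4 : {ω | ε < |X ω|} ⊆ {ω | ε ≤ X ω} ∪ {ω | ε ≤ (-X) ω} := by
    intro ω hω
    rcases lt_abs.1 (show ε < |X ω| from hω) with h | h
    · exact Or.inl h.le
    · exact Or.inr h.le
  have h5 := (measureReal_mono (μ := μ) h4).trans (measureReal_union_le _ _)
  linarith

theorem hasSubgaussianMGF_pi {ι : Type*} [Fintype ι] {Ω : ι → Type*} [∀ j, MeasurableSpace (Ω j)]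
    {μ : ∀ j, Measure (Ω j)} [∀ j, IsProbabilityMeasure (μ j)] {f : ∀ j, Ω j → ℝ} {c : ι → ℝ≥0}
    (h : ∀ j, HasSubgaussianMGF (f j) (c j) (μ j)) :
    HasSubgaussianMGF (fun ω => ∑ j, f j (ω j)) (∑ j, c j) (Measure.pi μ) := by
  refine HasSubgaussianMGF.sum_of_iIndepFun (iIndepFun_pi fun j => (h j).aemeasurable)
    fun j _ => ?_
  refine HasSubgaussianMGF.of_map (Y := fun ω : ∀ j, Ω j => ω j) (measurable_pi_apply j).aemeasurable ?_
  rw [(measurePreserving_eval μ j).map_eq]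
  exact h j

/-- The number of successes. -/
def countTrue {m : ℕ} (ω : Fin m → Bool) : ℕ := (Finset.univ.filter fun j => ω j = true).card

/-- The law of the number of successes in `m` independent trials. -/
def countLaw (m : ℕ) (ν : Measure Bool) : Measure ℕ :=
  (Measure.pi fun _ : Fin m => ν).map countTrue

instance (m : ℕ) (ν : Measure Bool) [IsProbabilityMeasure ν] :
    IsProbabilityMeasure (countLaw m ν) :=
  Measure.isProbabilityMeasure_map (measurable_of_countable _).aemeasurable

/-- Hoeffding's lemma: a variable in an interval of length `1` has parameter `1 / 4`, and parameters
add under independence. -/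
theorem hasSubgaussianMGF_countLaw (m : ℕ) (ν : Measure Bool) [IsProbabilityMeasure ν] :
    HasSubgaussianMGF (fun k : ℕ => (k : ℝ) - m * ν.real {true}) (m / 4) (countLaw m ν) := by
  have h1 : HasSubgaussianMGF (fun b : Bool => (if b = true then (1 : ℝ) else 0) - ν.real {true})
      (1 / 4) ν := by
    have h := hasSubgaussianMGF_of_mem_Icc (μ := ν) (a := 0) (b := 1)
      (X := fun b : Bool => if b = true then (1 : ℝ) else 0)
      (measurable_of_countable _).aemeasurable
      (Filter.Eventually.of_forall fun b => by cases b <;> simp)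
    have e1 : ∫ b, (if b = true then (1 : ℝ) else 0) ∂ν = ν.real {true} := by
      have : (fun b : Bool => if b = true then (1 : ℝ) else 0)
          = ({true} : Set Bool).indicator fun _ => 1 := by
        funext b
        cases b <;> simp
      rw [this, integral_indicator_const _ (measurableSet_singleton _)]
      simp
    have e2 : (‖(1 : ℝ) - 0‖₊ / 2) ^ 2 = (1 / 4 : ℝ≥0) := by
      rw [sub_zero, nnnorm_one, div_pow]
      norm_num
    rwa [e1, e2] at h
  have h2 := hasSubgaussianMGF_pi (μ := fun _ : Fin m => ν) fun _ => h1
  have h3 : (fun ω : Fin m → Bool => ∑ j, ((if ω j = true then (1 : ℝ) else 0) - ν.real {true}))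
      = (fun k : ℕ => (k : ℝ) - m * ν.real {true}) ∘ countTrue := by
    funext ω
    rw [Finset.sum_sub_distrib]
    simp [countTrue]
  rw [h3, ← HasSubgaussianMGF.id_map_iff (measurable_of_countable _).aemeasurable,
    ← Measure.map_map (measurable_of_countable _) (measurable_of_countable _),
    HasSubgaussianMGF.id_map_iff (measurable_of_countable _).aemeasurable] at h2
  have e3 : ∑ _j : Fin m, (1 / 4 : ℝ≥0) = m / 4 := by simp [div_eq_mul_inv]
  rwa [e3] at h2

theorem measureReal_pi_exists_le {ι : Type*} [Fintype ι] {Ω : ι → Type*}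
    [∀ j, MeasurableSpace (Ω j)] (μ : ∀ j, Measure (Ω j)) [∀ j, IsProbabilityMeasure (μ j)]
    (s : ∀ j, Set (Ω j)) (hs : ∀ j, MeasurableSet (s j)) :
    (Measure.pi μ).real {ω | ∃ j, ω j ∈ s j} ≤ ∑ j, (μ j).real (s j) := by
  have h : {ω : ∀ j, Ω j | ∃ j, ω j ∈ s j} = ⋃ j ∈ Finset.univ, (fun ω => ω j) ⁻¹' s j := by
    ext ω
    simp
  rw [h]
  refine (measureReal_biUnion_finset_le _ _).trans (Finset.sum_le_sum fun j _ => ?_)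
  rw [Measure.real, (measurePreserving_eval μ j).measure_preimage (hs j).nullMeasurableSet,
    Measure.real]

/-- A union bound over two stages, where the second one is only controlled if the first one
succeeds. -/
theorem measureReal_bind_le {α β : Type*} [MeasurableSpace α] [MeasurableSpace β]
    (μ : Measure α) [IsProbabilityMeasure μ] {κ : α → Measure β} (hκ : Measurable κ)
    [∀ a, IsProbabilityMeasure (κ a)] {s : Set α} (hs : MeasurableSet s) {t : Set β}
    (ht : MeasurableSet t) {δ δ' : ℝ} (hδ : μ.real s ≤ δ) (hδ' : 0 ≤ δ')
    (h : ∀ a ∉ s, (κ a).real t ≤ δ') : (μ.bind κ).real t ≤ δ + δ' := by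
  have h1 : ∫ a, (κ a).real t ∂μ = (μ.bind κ).real t := by
    rw [Measure.real, Measure.bind_apply ht hκ.aemeasurable]
    exact integral_toReal ((Measure.measurable_coe ht).comp hκ).aemeasurable
      (Filter.Eventually.of_forall fun v => measure_lt_top _ _)
  rw [← h1]
  have hi : Integrable (fun a => s.indicator (fun _ => (1 : ℝ)) a + δ') μ :=
    ((integrable_const _).indicator hs).add (integrable_const _)
  have h2 : ∫ a, (κ a).real t ∂μ ≤ ∫ a, (s.indicator (fun _ => (1 : ℝ)) a + δ') ∂μ := by
    refine integral_mono_of_nonneg (Filter.Eventually.of_forall fun _ => measureReal_nonneg) hi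
      (Filter.Eventually.of_forall fun a => ?_)
    show (κ a).real t ≤ s.indicator (fun _ => (1 : ℝ)) a + δ'
    by_cases ha : a ∈ s
    · rw [indicator_of_mem ha]
      linarith [measureReal_le_one (μ := κ a) (s := t)]
    · rw [indicator_of_notMem ha, zero_add]
      exact h a ha
  rw [integral_add ((integrable_const _).indicator hs) (integrable_const _),
    integral_indicator_const _ hs] at h2
  simp only [integral_const, probReal_univ, smul_eq_mul, one_mul, mul_one] at h2
  linarith

end concentration

namespace Proc

variable {n : ℕ} {α : Type}

/-- Sample the value of agent `i` conditioned on `I` and report whether it satisfies `f`. -/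
def observe (i : Fin n) (I : Set ℝ) (hI : I.OrdConnected) (f : ℝ → Bool) : Proc n Bool :=
  fun k => OracleProgram.sample i I hI fun r => k (r.elim false f)

/-- The law of the answer of `observe`. -/
def observeLaw (F : Measure ℝ) (I : Set ℝ) (f : ℝ → Bool) : Measure Bool :=
  open Classical in if F I = 0 then Measure.dirac false else (cond F I).map f

theorem isProbabilityMeasure_observeLaw (F : Measure ℝ) [IsFiniteMeasure F] (I : Set ℝ)
    {f : ℝ → Bool} (hf : Measurable f) : IsProbabilityMeasure (observeLaw F I f) := by
  unfold observeLaw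
  split_ifs with h
  · infer_instance
  · have := cond_isProbabilityMeasure h
    exact Measure.isProbabilityMeasure_map hf.aemeasurable

/-- For a null `I` the answer `false` matches the convention that division by zero gives zero. -/
theorem observeLaw_real_true (F : Measure ℝ) {I : Set ℝ} (hI : MeasurableSet I)
    {f : ℝ → Bool} (hf : Measurable f) :
    (observeLaw F I f).real {true} = F.real (I ∩ f ⁻¹' {true}) / F.real I := by
  unfold observeLaw
  split_ifs with h
  · have h2 : F.real I = 0 := by simp [Measure.real, h]
    rw [h2, div_zero]
    simp [Measure.real]
  · rw [map_measureReal_apply hf (measurableSet_singleton _), Measure.real, cond_apply hI,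
      ENNReal.toReal_mul, ENNReal.toReal_inv, Measure.real, Measure.real]
    field_simp

theorem hasLaw_observe (D : Fin n → Measure ℝ) (A : Algorithm n) (i : Fin n) (I : Set ℝ)
    (hI : I.OrdConnected) {f : ℝ → Bool} (hf : Measurable f) :
    HasLaw D A (observe i I hI f) (observeLaw (D i) I f) := by
  intro k hk
  simp only [observe, OracleProgram.law, observeLaw]
  split_ifs with h
  · rw [Measure.dirac_bind hk]
    rfl
  · rw [Measure.map_bind hf _ hk]
    rfl

theorem callsLE_observe (i : Fin n) (I : Set ℝ) (hI : I.OrdConnected) (f : ℝ → Bool) :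
    CallsLE (observe i I hI f) 0 1 := by
  intro k B B' h1 h2
  simp only [observe, OracleProgram.algCalls, OracleProgram.distCalls]
  refine ⟨by simpa using fun r => h1 _, ?_⟩
  push_cast
  gcongr
  exact iSup_le fun r => h2 _

/-- The number of successes in `m` independent runs. -/
def repeatCount (m : ℕ) (c : Proc n Bool) : Proc n ℕ := (collect m fun _ => c).mapProc countTrue

theorem CallsLE.repeatCount {c : Proc n Bool} {N M : ℕ} (h : CallsLE c N M) (m : ℕ) :
    CallsLE (repeatCount m c) (m * N) (m * M) := by
  have := (CallsLE.collect (m := m) fun _ => h).mapProc countTrue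
  rwa [Fin.sum_const, Fin.sum_const, smul_eq_mul, smul_eq_mul] at this

theorem HasLaw.repeatCount {D : Fin n → Measure ℝ} {A : Algorithm n} {c : Proc n Bool}
    {ν : Measure Bool} [IsProbabilityMeasure ν] (h : HasLaw D A c ν) (m : ℕ) :
    HasLaw D A (repeatCount m c) (countLaw m ν) :=
  (HasLaw.collect fun _ => h).mapProc (measurable_of_countable _)

end Proc

end BayesMech

/-! ### The estimation procedure, its call counts and its law. -/

namespace BayesMech

namespace Ironing

open Proc

section estimation

variable {n : ℕ} (i : Fin n) {idx : ℝ → ℕ} (hidx : Monotone idx) (K N m₀ : ℕ) (Λ ν : ℝ)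

theorem ordConnected_preimage_Ico (hidx : Monotone idx) (a b : ℕ) :
    (idx ⁻¹' Ico a b).OrdConnected := ordConnected_Ico.preimage_mono hidx

/-- Numbers of samples, conditioned on the buckets from `a` to `b`, that fall into bucket `c`. -/
abbrev Table (K : ℕ) : Type := Fin (K + 1) → Fin (K + 1) → Fin (K + 1) → ℕ

/-- Sample the value of agent `i` conditioned on the buckets from `a` to `b`, and report whether
it falls into bucket `c`. -/
def member (a b c : ℕ) : Proc n Bool :=
  observe i (idx ⁻¹' Ico a b) (ordConnected_preimage_Ico hidx a b) fun z => decide (idx z = c)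

/-- Estimate all conditional bucket probabilities. -/
def survey : Proc n (Table K) :=
  collect (K + 1) fun a => collect (K + 1) fun b => collect (K + 1) fun c =>
    repeatCount N (member i hidx a b c)

variable {K}

/-- The estimated probability of bucket `c` conditioned on the buckets from `a` to `b`. -/
def freq (W : Table K) (a b c : ℕ) : ℝ :=
  W (Fin.ofNat (K + 1) a) (Fin.ofNat (K + 1) b) (Fin.ofNat (K + 1) c) / N

/-- The number of runs of the algorithm for bucket `c`. -/
def runs (n : ℕ) {K : ℕ} (N m₀ : ℕ) (Λ : ℝ) (W : Table K) (c : ℕ) : ℕ :=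
  trials n m₀ Λ (fun b => freq N W b K b) c

/-- Run the algorithm on random values, where that of agent `i` is in bucket `c`, and report
whether agent `i` is served. -/
def attempt (c : ℕ) : Proc n Bool :=
  (collect n fun j => draw j (if j = i then idx ⁻¹' Ico c (c + 1) else univ)
    (by split_ifs; exacts [ordConnected_preimage_Ico hidx _ _, ordConnected_univ]) 0).andThen
    fun v => (call v).mapProc fun a => a i

/-- Count how often agent `i` is served, for every bucket. -/
def experiment (W : Table K) : Proc n (Fin K → ℕ) :=
  collect K fun c => repeatCount (runs n N m₀ Λ W c) (attempt i hidx c)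

/-- The estimated average allocation of a bucket. -/
def outcome (n : ℕ) (W : Table K) (Y : Fin K → ℕ) (c : ℕ) : ℝ :=
  if h : c < K then Y ⟨c, h⟩ / runs n N m₀ Λ W c else 0

/-- The estimated average allocation of the buckets from `a` to `b`. -/
def poolEstimate (W : Table K) (y : ℕ → ℝ) (a b : ℕ) : ℝ :=
  ∑ c ∈ Finset.range K, freq N W a b c * y c

/-- Pool boundaries that the estimates support. -/
def cuts (W : Table K) (y : ℕ → ℝ) : Finset ℕ :=
  open Classical in
  if h : ∃ S, Supported K (fun b => 1 / 2 < freq N W b (b + 1) b) (poolEstimate N W y) ν S then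
    h.choose
  else {0, K}

variable (K)

/-- Estimate the interim allocation rule of agent `i`, and choose the pool boundaries. -/
def estimate : Proc n (Finset ℕ) :=
  (survey i hidx K N).andThen fun W =>
    (experiment i hidx N m₀ Λ W).mapProc fun Y => cuts N ν W (outcome N m₀ Λ n W Y)

theorem callsLE_attempt (c : ℕ) : CallsLE (attempt i hidx c) 1 n := by
  have h1 := (CallsLE.collect fun j => callsLE_draw j
    (if j = i then idx ⁻¹' Ico c (c + 1) else univ)
    (by split_ifs; exacts [ordConnected_preimage_Ico hidx _ _, ordConnected_univ]) 0).andThen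
    (f := fun v => (call v).mapProc fun a => a i) fun v => (callsLE_call v).mapProc _
  exact h1.mono (by simp) (by simp)

/-- The survey of all triples of buckets is charged to the distribution oracle alone. Each attempt
calls the algorithm once and draws `n` values. -/
theorem callsLE_estimate (hΛ : 0 ≤ Λ) :
    CallsLE (estimate i hidx K N m₀ Λ ν) (m₀ * (2 * K + ⌈n * Λ⌉₊))
      ((K + 1) ^ 3 * N + m₀ * (2 * K + ⌈n * Λ⌉₊) * n) := by
  have h1 : CallsLE (survey i hidx K N) 0 ((K + 1) ^ 3 * N) := by
    have := CallsLE.collect fun a : Fin (K + 1) => CallsLE.collect fun b : Fin (K + 1) =>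
      CallsLE.collect fun c : Fin (K + 1) => (callsLE_observe i (idx ⁻¹' Ico (a : ℕ) b)
        (ordConnected_preimage_Ico hidx a b) fun z => decide (idx z = c)).repeatCount N
    refine this.mono (by simp) (le_of_eq ?_)
    simp only [Finset.sum_const, Finset.card_univ, Fintype.card_fin, smul_eq_mul]
    ring
  have h2 : ∀ W : Table K, CallsLE (experiment i hidx N m₀ Λ W) (m₀ * (2 * K + ⌈n * Λ⌉₊))
      (m₀ * (2 * K + ⌈n * Λ⌉₊) * n) := by
    intro W
    have h3 := CallsLE.collect fun c : Fin K =>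
      (callsLE_attempt i hidx c).repeatCount (runs n N m₀ Λ W c)
    have h4 : ∑ c : Fin K, runs n N m₀ Λ W c ≤ m₀ * (2 * K + ⌈n * Λ⌉₊) := by
      rw [Fin.sum_univ_eq_sum_range (fun c => runs n N m₀ Λ W c)]
      exact sum_trials_le (fun b => by unfold freq; positivity) hΛ K
    refine h3.mono (by simpa using h4) ?_
    rw [← Finset.sum_mul]
    gcongr
  exact (h1.andThen fun W => (h2 W).mapProc _).mono (by omega) le_rfl

section law

variable (D : Fin n → Measure ℝ) [∀ i, IsProbabilityMeasure (D i)] (A : Algorithm n)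
  [IsMarkovKernel A]

/-- The law of `member`. -/
def memberLaw (F : Measure ℝ) (idx : ℝ → ℕ) (a b c : ℕ) : Measure Bool :=
  observeLaw F (idx ⁻¹' Ico a b) fun z => decide (idx z = c)

theorem measurable_decide_eq (hidx : Monotone idx) (c : ℕ) :
    Measurable fun z => decide (idx z = c) :=
  (measurable_of_countable fun b : ℕ => decide (b = c)).comp hidx.measurable

theorem isProbabilityMeasure_memberLaw (F : Measure ℝ) [IsProbabilityMeasure F]
    (hidx : Monotone idx) (a b c : ℕ) : IsProbabilityMeasure (memberLaw F idx a b c) :=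
  isProbabilityMeasure_observeLaw F _ (measurable_decide_eq hidx c)

theorem memberLaw_real_true (F : Measure ℝ) [IsProbabilityMeasure F] (hidx : Monotone idx)
    (a b c : ℕ) : (memberLaw F idx a b c).real {true}
      = (if c ∈ Finset.Ico a b then weight F idx c else 0)
        / ∑ b' ∈ Finset.Ico a b, weight F idx b' := by
  rw [memberLaw, observeLaw_real_true F (hidx.measurable measurableSet_Ico)
    (measurable_decide_eq hidx c), ← Finset.coe_Ico, measureReal_preimage hidx.measurable]
  congr 1
  have h : (fun z => decide (idx z = c)) ⁻¹' {true} = idx ⁻¹' {c} := by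
    ext z
    simp
  rw [h, ← preimage_inter]
  split_ifs with hc
  · rw [inter_eq_self_of_subset_right (by simpa using hc), weight]
  · rw [inter_singleton_eq_empty.2 (by simpa using hc), preimage_empty, measureReal_empty]

/-- The law of `attempt`. -/
def attemptLaw (idx : ℝ → ℕ) (c : ℕ) : Measure Bool :=
  (Measure.pi fun j => condLaw (D j) (if j = i then idx ⁻¹' Ico c (c + 1) else univ) 0).bind
    fun v => (A v).map fun a => a i

theorem measurable_map_eval : Measurable fun v => (A v).map fun a => a i :=
  (Measure.measurable_map _ (measurable_of_countable _)).comp A.measurable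

instance (c : ℕ) : IsProbabilityMeasure (attemptLaw i D A idx c) :=
  isProbabilityMeasure_bind (measurable_map_eval i A).aemeasurable
    (Filter.Eventually.of_forall fun _ =>
      Measure.isProbabilityMeasure_map (measurable_of_countable _).aemeasurable)

/-- An attempt draws from `D` with the `i`-th factor conditioned on the bucket, so its success
probability is the conditional mean of the interim allocation. -/
theorem attemptLaw_real_true {c : ℕ} (hc : 0 < weight (D i) idx c) :
    (attemptLaw i D A idx c).real {true} = average (D i) idx (interimAlloc D A i) c := by
  have hb : idx ⁻¹' Ico c (c + 1) = idx ⁻¹' {c} := by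
    ext z
    simp only [mem_preimage, mem_Ico, mem_singleton_iff]
    omega
  have hne : D i (idx ⁻¹' {c}) ≠ 0 := by
    intro h
    rw [weight, Measure.real, h] at hc
    simp at hc
  have h1 : (fun j => condLaw (D j) (if j = i then idx ⁻¹' Ico c (c + 1) else univ) 0)
      = Function.update D i (cond (D i) (idx ⁻¹' {c})) := by
    funext j
    by_cases hj : j = i
    · subst hj
      rw [if_pos rfl, Function.update_self, hb, condLaw_eq_cond hne]
    · rw [if_neg hj, Function.update_of_ne hj, condLaw_eq_cond (by simp), cond_univ]
  have hp : IsProbabilityMeasure (cond (D i) (idx ⁻¹' {c})) := cond_isProbabilityMeasure hne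
  have h2 := integral_interimAlloc_eq D A i (cond (D i) (idx ⁻¹' {c}))
  have h3 : attemptLaw i D A idx c
      = ((Measure.pi (Function.update D i (cond (D i) (idx ⁻¹' {c})))).bind A).map
        fun a => a i := by
    rw [attemptLaw, h1]
    ext s hs
    rw [Measure.bind_apply hs (measurable_map_eval i A).aemeasurable,
      Measure.map_apply (measurable_of_countable _) hs,
      Measure.bind_apply (measurable_of_countable (fun a : Allocation n => a i) hs)
        A.aemeasurable]
    exact lintegral_congr fun v => Measure.map_apply (measurable_of_countable _) hs
  rw [h3, map_measureReal_apply (measurable_of_countable _) (measurableSet_singleton _)]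
  have h4 : (fun a : Allocation n => a i) ⁻¹' {true} = served i := by
    ext a
    simp
  rw [h4, ← h2, ProbabilityTheory.cond, integral_smul_measure, average, weight]
  simp [Measure.real, div_eq_inv_mul]

/-- The law of `survey`. -/
def surveyLaw (F : Measure ℝ) (idx : ℝ → ℕ) (K N : ℕ) : Measure (Table K) :=
  Measure.pi fun a => Measure.pi fun b => Measure.pi fun c =>
    countLaw N (memberLaw F idx a b c)

/-- The law of `experiment`. -/
def experimentLaw (idx : ℝ → ℕ) {K : ℕ} (W : Table K) : Measure (Fin K → ℕ) :=
  Measure.pi fun c => countLaw (runs n N m₀ Λ W c) (attemptLaw i D A idx c)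

instance (W : Table K) : IsProbabilityMeasure (experimentLaw i N m₀ Λ D A idx W) := by
  unfold experimentLaw
  infer_instance

/-- The law of `estimate`. -/
def estimateLaw (idx : ℝ → ℕ) : Measure (Finset ℕ) :=
  (surveyLaw (D i) idx K N).bind fun W =>
    (experimentLaw i N m₀ Λ D A idx W).map fun Y => cuts N ν W (outcome N m₀ Λ n W Y)

theorem isProbabilityMeasure_surveyLaw (F : Measure ℝ) [IsProbabilityMeasure F]
    (hidx : Monotone idx) : IsProbabilityMeasure (surveyLaw F idx K N) := by
  have := fun a b c => isProbabilityMeasure_memberLaw F hidx a b c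
  unfold surveyLaw
  infer_instance

theorem isProbabilityMeasure_estimateLaw (hidx : Monotone idx) :
    IsProbabilityMeasure (estimateLaw i K N m₀ Λ ν D A idx) := by
  have := isProbabilityMeasure_surveyLaw K N (D i) hidx
  exact isProbabilityMeasure_bind (measurable_of_countable _).aemeasurable
    (Filter.Eventually.of_forall fun _ =>
      Measure.isProbabilityMeasure_map (measurable_of_countable _).aemeasurable)

/-- Tables and counts range over countable types, so the map to pool boundaries is measurable
although it is defined by choice. -/
theorem hasLaw_estimate :
    HasLaw D A (estimate i hidx K N m₀ Λ ν) (estimateLaw i K N m₀ Λ ν D A idx) := by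
  have hm : ∀ a b c : ℕ, IsProbabilityMeasure
      (observeLaw (D i) (idx ⁻¹' Ico a b) fun z => decide (idx z = c)) :=
    isProbabilityMeasure_memberLaw (D i) hidx
  have hm' := fun a b c => isProbabilityMeasure_memberLaw (D i) hidx a b c
  have h1 : HasLaw D A (survey i hidx K N) (surveyLaw (D i) idx K N) :=
    HasLaw.collect fun a => HasLaw.collect fun b => HasLaw.collect fun c =>
      (hasLaw_observe D A i _ _ (measurable_decide_eq hidx c)).repeatCount N
  have h2 : ∀ c, HasLaw D A (attempt i hidx c) (attemptLaw i D A idx c) := by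
    intro c
    refine HasLaw.andThen (HasLaw.collect fun j => hasLaw_draw D A j _ _ 0) (fun v => ?_)
      (measurable_map_eval i A)
    exact (hasLaw_call D A v).mapProc (measurable_of_countable _)
  exact h1.andThen (fun W => (HasLaw.collect fun c => (h2 c).repeatCount _).mapProc
    (measurable_of_countable _)) (measurable_of_countable _)

end law

end estimation

end Ironing

end BayesMech

/-! ### Accuracy of the estimates. -/

namespace BayesMech

namespace Ironing

open Proc

section accuracy

variable {n : ℕ} {i : Fin n} {idx : ℝ → ℕ} {K N m₀ : ℕ} {Λ ν δ e η q : ℝ}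
  {D : Fin n → Measure ℝ} [∀ i, IsProbabilityMeasure (D i)] {A : Algorithm n} [IsMarkovKernel A]

/-- The probability of bucket `c` conditioned on the buckets from `a` to `b`. -/
def relWeight (w : ℕ → ℝ) (a b c : ℕ) : ℝ :=
  (if c ∈ Finset.Ico a b then w c else 0) / ∑ b' ∈ Finset.Ico a b, w b'

theorem sum_relWeight_mul {w y : ℕ → ℝ} {a b : ℕ} (hab : a ≤ b) (hb : b ≤ K) :
    ∑ c ∈ Finset.range K, relWeight w a b c * y c
      = slope (tail K w) (tail K fun b => w b * y b) a b := by
  have h : Finset.Ico a b = (Finset.range K).filter (· ∈ Finset.Ico a b) := by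
    ext c
    simp only [Finset.mem_filter, Finset.mem_range, Finset.mem_Ico]
    omega
  have h2 : ∑ c ∈ Finset.Ico a b, w c * y c
      = ∑ c ∈ Finset.range K, if c ∈ Finset.Ico a b then w c * y c else 0 := by
    rw [← Finset.sum_filter, ← h]
  rw [slope, tail_sub_tail _ hab hb, tail_sub_tail _ hab hb, h2, Finset.sum_div]
  refine Finset.sum_congr rfl fun c _ => ?_
  rw [relWeight]
  split_ifs
  · ring
  · ring

/-- The table `W` is accurate up to `δ`. -/
def Accurate (F : Measure ℝ) (idx : ℝ → ℕ) (N : ℕ) (δ : ℝ) (W : Table K) : Prop :=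
  ∀ a ≤ K, ∀ b ≤ K, ∀ c ≤ K, |freq N W a b c - relWeight (weight F idx) a b c| ≤ δ

/-- Hoeffding's bound for each entry and a union bound over the three indices. -/
theorem surveyLaw_not_accurate_le (F : Measure ℝ) [IsProbabilityMeasure F]
    (hidx : Monotone idx) (hN : 0 < N) (hδ : 0 ≤ δ) :
    (surveyLaw F idx K N).real {W | ¬ Accurate F idx N δ W}
      ≤ (K + 1) ^ 3 * (2 * Real.exp (-(2 * N * δ ^ 2))) := by
  have hm := fun a b c => isProbabilityMeasure_memberLaw F hidx a b c
  have hN' : (0 : ℝ) < N := by exact_mod_cast hN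
  let B : ℕ → ℕ → ℕ → Set ℕ := fun a b c =>
    {k | N * δ < |(k : ℝ) - N * (memberLaw F idx a b c).real {true}|}
  have hB : ∀ a b c, (countLaw N (memberLaw F idx a b c)).real (B a b c)
      ≤ 2 * Real.exp (-(2 * N * δ ^ 2)) := fun a b c =>
    (hasSubgaussianMGF_countLaw N (memberLaw F idx a b c)).measureReal_lt_abs_le (V := N / 4)
      (by push_cast; exact le_rfl) (by positivity) (le_of_eq (by ring)) (by positivity)
  have h1 : {W : Table K | ¬ Accurate F idx N δ W} ⊆
      {W | ∃ a : Fin (K + 1), W a ∈ {V : Fin (K + 1) → Fin (K + 1) → ℕ | ∃ b : Fin (K + 1),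
        V b ∈ {U : Fin (K + 1) → ℕ | ∃ c : Fin (K + 1), U c ∈ B a b c}}} := by
    intro W hW
    simp only [Accurate, mem_ofPred_eq] at hW
    push Not at hW
    obtain ⟨a, ha, b, hb, c, hc, h⟩ := hW
    -- `Fin.ofNat` reduces modulo `K + 1`, which changes nothing for boundaries up to `K`.
    have hof : ∀ a ≤ K, ((Fin.ofNat (K + 1) a : Fin (K + 1)) : ℕ) = a := fun a ha =>
      Nat.mod_eq_of_lt (Nat.lt_succ_of_le ha)
    refine ⟨Fin.ofNat (K + 1) a, Fin.ofNat (K + 1) b, Fin.ofNat (K + 1) c, ?_⟩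
    simp only [B, mem_ofPred_eq, hof a ha, hof b hb, hof c hc, memberLaw_real_true F hidx]
    rw [freq, relWeight] at h
    have h2 := mul_lt_mul_of_pos_left h hN'
    rw [← abs_of_pos hN', ← abs_mul, abs_of_pos hN', mul_sub, mul_div_cancel₀ _ hN'.ne'] at h2
    exact h2
  refine (measureReal_mono (μ := surveyLaw F idx K N) h1 (by
    have := isProbabilityMeasure_surveyLaw K N F hidx
    exact measure_ne_top _ _)).trans ?_
  have e3 : ∀ a b : ℕ, (Measure.pi fun c : Fin (K + 1) => countLaw N (memberLaw F idx a b c)).real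
      {U | ∃ c : Fin (K + 1), U c ∈ B a b c} ≤ (K + 1) * (2 * Real.exp (-(2 * N * δ ^ 2))) := by
    intro a b
    refine (measureReal_pi_exists_le _ _ fun c => MeasurableSet.of_discrete).trans ?_
    refine (Finset.sum_le_sum (s := Finset.univ) fun (c : Fin (K + 1)) _ => hB a b c).trans (le_of_eq ?_)
    simp
  have e2 : ∀ a : ℕ, (Measure.pi fun b : Fin (K + 1) => Measure.pi fun c : Fin (K + 1) =>
      countLaw N (memberLaw F idx a b c)).real
      {V | ∃ b : Fin (K + 1), V b ∈ {U : Fin (K + 1) → ℕ | ∃ c : Fin (K + 1), U c ∈ B a b c}}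
      ≤ (K + 1) * ((K + 1) * (2 * Real.exp (-(2 * N * δ ^ 2)))) := by
    intro a
    refine (measureReal_pi_exists_le _ _ fun c => MeasurableSet.of_discrete).trans ?_
    refine (Finset.sum_le_sum (s := Finset.univ) fun (c : Fin (K + 1)) _ => e3 a c).trans (le_of_eq ?_)
    simp
  refine (measureReal_pi_exists_le _ _ fun c => MeasurableSet.of_discrete).trans ?_
  refine (Finset.sum_le_sum (s := Finset.univ) fun (c : Fin (K + 1)) _ => e2 c).trans (le_of_eq ?_)
  simp
  ring

/-- The outcomes `y` are accurate for single buckets, and on the average for all tails. -/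
def AccurateOutcome (F : Measure ℝ) (idx : ℝ → ℕ) (K : ℕ) (x p y : ℕ → ℝ) (e η q : ℝ) : Prop :=
  (∀ c < K, |y c - p c| ≤ e) ∧
    ∀ t ≤ K, |tail K (fun b => weight F idx b * y b) t
        - tail K (fun b => weight F idx b * x b) t| ≤ η * (tail K (weight F idx) t + q)

/-- Accurate frequencies identify the buckets of positive mass and give pool averages of `y` up to
`ν`. A supported set therefore exists, the chosen one is supported, and `Supported.good` applies. -/
theorem good_cuts {W : Table K} {y p : ℕ → ℝ} (hidx : Monotone idx) (hK : ∀ z, idx z < K)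
    (hW : Accurate (D i) idx N δ W)
    (hy : AccurateOutcome (D i) idx K (average (D i) idx (interimAlloc D A i)) p y e η q)
    (hp0 : ∀ c < K, 0 ≤ p c) (hp1 : ∀ c < K, p c ≤ 1)
    (hp : ∀ c < K, 0 < weight (D i) idx c → p c = average (D i) idx (interimAlloc D A i) c)
    (hδ : δ < 1 / 2) (hδν : 2 * K * δ ≤ ν) (hη : 0 ≤ η) (hq : 0 ≤ q) (he0 : 0 ≤ e) (he1 : e ≤ 1)
    {vmax θ μ : ℝ} (hF : ∀ᵐ z ∂(D i), z ∈ Icc 0 vmax) (hμ : ∫ z, z ∂(D i) ≤ μ) {ζ : ℕ → ℝ}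
    (hζ : Monotone ζ) (hζ0 : 0 ≤ ζ 0) (hZ : ∀ b ≤ K, ζ b ≤ vmax)
    (hζle : ∀ z ∈ Icc 0 vmax, ζ (idx z) ≤ z)
    (hleζ : ∀ z ∈ Icc 0 vmax, z ≤ (1 + η) * ζ (idx z) + θ) (hθ : 0 ≤ θ) :
    Good (D i) idx (interimAlloc D A i) (4 * ν + 2 * e)
      (θ + η * μ + (4 * ν + 2 * η) * μ + 2 * η * q * vmax) (cuts N ν W y) := by
  have hw := weight_nonneg (D i) idx
  have hδ0 : 0 ≤ δ := (abs_nonneg _).trans (hW 0 (Nat.zero_le _) 0 (Nat.zero_le _) 0 (Nat.zero_le _))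
  have hν : 0 ≤ ν := le_trans (by positivity) hδν
  -- The probability of a bucket conditioned on itself is `1`, or `0` by convention if it is null,
  -- so an error below `1 / 2` decides positivity exactly.
  have hpos : ∀ b < K, (1 / 2 < freq N W b (b + 1) b) ↔ 0 < weight (D i) idx b := by
    intro b hb
    have h1 := abs_le.1 (hW b hb.le (b + 1) hb b hb.le)
    have h2 : relWeight (weight (D i) idx) b (b + 1) b
        = weight (D i) idx b / weight (D i) idx b := by
      rw [relWeight, if_pos (by simp)]
      simp
    rw [h2] at h1
    rcases eq_or_lt_of_le (hw b) with h | h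
    · rw [← h, div_zero] at h1
      rw [← h]
      exact ⟨fun h3 => by linarith [h1.2], fun h3 => absurd h3 (lt_irrefl _)⟩
    · rw [div_self h.ne'] at h1
      exact ⟨fun _ => h, fun _ => by linarith [h1.1]⟩
  -- With `|y c| ≤ 2`, frequency errors `δ` in `K` buckets add up to at most `2 * K * δ ≤ ν`.
  have hy2 : ∀ c < K, |y c| ≤ 2 := by
    intro c hc
    have h1 := abs_le.1 (hy.1 c hc)
    rw [abs_le]
    constructor <;> linarith [hp0 c hc, hp1 c hc, h1.1, h1.2]
  have hu : ∀ a b, a < b → b ≤ K →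
      tail K (weight (D i) idx) b < tail K (weight (D i) idx) a →
      |poolEstimate N W y a b - slope (tail K (weight (D i) idx))
        (tail K fun b => weight (D i) idx b * y b) a b| ≤ ν := by
    intro a b hab hb _
    rw [← sum_relWeight_mul hab.le hb, poolEstimate, ← Finset.sum_sub_distrib]
    refine (Finset.abs_sum_le_sum_abs _ _).trans ?_
    have h : ∀ c ∈ Finset.range K, |freq N W a b c * y c
        - relWeight (weight (D i) idx) a b c * y c| ≤ δ * 2 := by
      intro c hc
      rw [Finset.mem_range] at hc
      rw [← sub_mul, abs_mul]
      exact mul_le_mul (hW a (by omega) b hb c hc.le) (hy2 c hc) (abs_nonneg _) hδ0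
    refine (Finset.sum_le_sum h).trans (le_trans (le_of_eq ?_) hδν)
    simp
    ring
  have hex : ∃ S, Supported K (fun b => 1 / 2 < freq N W b (b + 1) b) (poolEstimate N W y) ν S :=
    exists_supported hw hpos (by rw [tail_weight_zero hidx.measurable hK]; exact one_pos) hu
  have hS : Supported K (fun b => 1 / 2 < freq N W b (b + 1) b) (poolEstimate N W y) ν
      (cuts N ν W y) := by
    rw [cuts, dif_pos hex]
    exact hex.choose_spec
  exact hS.good hidx.measurable hidx hK (measurable_interimAlloc D A i)
    (interimAlloc_nonneg D A i) (interimAlloc_le_one D A i) hpos hν hη hq he0 hu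
    (fun b hb hwb => hp b hb hwb ▸ hy.1 b hb) hy.2 hF hμ hζ hζ0 hZ hζle hleζ hθ

/-- Single buckets use only that each has at least `m₀` trials. For the tails the counts are
combined linearly, and the schedule of trials keeps the variance of the combination small, gaining a
factor `n` in the exponent. -/
theorem experimentLaw_not_accurate_le {W : Table K} (hidx : Monotone idx) (hK : ∀ z, idx z < K)
    (hW : Accurate (D i) idx N δ W) (hm₀ : 0 < m₀) (hn : 1 ≤ n) (hnδ : n * δ ≤ 1)
    (hKδ : K * δ ≤ 1) (hq : 0 < q) (hΛ : 2 + Real.log (n / q) ≤ Λ) (he : 0 ≤ e) (hη : 0 ≤ η) :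
    (experimentLaw i N m₀ Λ D A idx W).real
        {Y | ¬ AccurateOutcome (D i) idx K (average (D i) idx (interimAlloc D A i))
          (fun c => (attemptLaw i D A idx c).real {true}) (outcome N m₀ Λ n W Y) e η q}
      ≤ K * (2 * Real.exp (-(2 * m₀ * e ^ 2)))
        + (K + 1) * (2 * Real.exp (-(2 * n * m₀ * η ^ 2))) := by
  set w := weight (D i) idx with hw_def
  set m := runs n N m₀ Λ W with hm_def
  set p : ℕ → ℝ := fun c => (attemptLaw i D A idx c).real {true} with hp_def
  have hw : ∀ b, 0 ≤ w b := weight_nonneg (D i) idx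
  have hm₀' : (0 : ℝ) < m₀ := by exact_mod_cast hm₀
  have hn' : (0 : ℝ) < n := by exact_mod_cast hn
  have hm : ∀ c, (m₀ : ℝ) ≤ m c := fun c => by exact_mod_cast le_trials c
  have hmpos : ∀ c, (0 : ℝ) < m c := fun c => hm₀'.trans_le (hm c)
  -- On a null bucket the attempts use the default value and `p c` need not be the average, but the
  -- weight is zero.
  have hwx : ∀ c < K, w c * average (D i) idx (interimAlloc D A i) c = w c * p c := by
    intro c _
    rcases eq_or_lt_of_le (hw c) with h | h
    · rw [← h, zero_mul, zero_mul]
    · rw [hp_def]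
      simp only
      rw [attemptLaw_real_true i D A h]
  have hwm : ∀ c < K, n * w c * m₀ ≤ m c * (tail K w c + q) := by
    intro c hc
    refine weight_le_trials hw (tail_weight_zero hidx.measurable hK) (fun b hb => ?_) hn hnδ hKδ
      hq hΛ hc
    have h1 := hW b hb.le K le_rfl b hb.le
    rwa [relWeight, if_pos (by simpa using hb)] at h1
  let Y₁ : ℕ → Set ℕ := fun c => {k | m c * e < |(k : ℝ) - m c * p c|}
  -- With these coefficients the error of the tail sum at `t` is a linear combination of independent
  -- centred counts.
  let a : ℕ → ℕ → ℝ := fun t c => if t ≤ c then w c / m c else 0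
  let Y₂ : ℕ → Set (Fin K → ℕ) := fun t =>
    {Y | η * (tail K w t + q) < |∑ c : Fin K, a t c * ((Y c : ℝ) - m c * p c)|}
  have hsub : {Y | ¬ AccurateOutcome (D i) idx K (average (D i) idx (interimAlloc D A i)) p
      (outcome N m₀ Λ n W Y) e η q}
      ⊆ {Y : Fin K → ℕ | ∃ c : Fin K, Y c ∈ Y₁ c} ∪ ⋃ t ∈ Finset.range (K + 1), Y₂ t := by
    intro Y hY
    by_contra hcon
    simp only [mem_union, mem_ofPred_eq, mem_iUnion, Finset.mem_range, not_or, not_exists] at hcon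
    obtain ⟨hc1, hc2⟩ := hcon
    refine hY ⟨fun c hc => ?_, fun t ht => ?_⟩
    · have h1 : |(Y ⟨c, hc⟩ : ℝ) - m c * p c| ≤ m c * e := not_lt.1 (hc1 ⟨c, hc⟩)
      rw [outcome, dif_pos hc, ← hm_def]
      have h2 : (Y ⟨c, hc⟩ : ℝ) / m c - p c = ((Y ⟨c, hc⟩ : ℝ) - m c * p c) / m c := by
        rw [sub_div, mul_div_cancel_left₀ _ (hmpos c).ne']
      rw [h2, abs_div, abs_of_pos (hmpos c), div_le_iff₀ (hmpos c), mul_comm e]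
      exact h1
    · have h1 : |∑ c : Fin K, a t c * ((Y c : ℝ) - m c * p c)| ≤ η * (tail K w t + q) :=
        not_lt.1 (hc2 t (by omega))
      convert h1 using 2
      have h2 : ∀ c : Fin K, a t c * ((Y c : ℝ) - m c * p c)
          = if t ≤ (c : ℕ) then w c * outcome N m₀ Λ n W Y c
              - w c * average (D i) idx (interimAlloc D A i) c else 0 := by
        intro c
        simp only [a]
        split_ifs
        · rw [hwx c c.2, outcome, dif_pos c.2, ← hm_def, Fin.eta]
          have := hmpos c
          field_simp
        · rw [zero_mul]
      simp_rw [h2]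
      rw [Fin.sum_univ_eq_sum_range (fun c => if t ≤ c then w c * outcome N m₀ Λ n W Y c
              - w c * average (D i) idx (interimAlloc D A i) c else 0), ← Finset.sum_filter,
        tail, tail, ← Finset.sum_sub_distrib]
      refine Finset.sum_congr ?_ fun _ _ => rfl
      ext c
      simp only [Finset.mem_filter, Finset.mem_range, Finset.mem_Ico]
      omega
  refine (measureReal_mono hsub).trans ((measureReal_union_le _ _).trans (add_le_add ?_ ?_))
  · refine (measureReal_pi_exists_le _ _ fun c => MeasurableSet.of_discrete).trans ?_
    have h : ∀ c ∈ (Finset.univ : Finset (Fin K)),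
        (countLaw (runs n N m₀ Λ W c) (attemptLaw i D A idx c)).real (Y₁ c)
          ≤ 2 * Real.exp (-(2 * m₀ * e ^ 2)) := by
      intro c _
      refine (hasSubgaussianMGF_countLaw (m c) (attemptLaw i D A idx c)).measureReal_lt_abs_le
        (V := m c / 4) (by push_cast; exact le_rfl) (mul_nonneg (hmpos c).le he) ?_
        (by have := hmpos c; positivity)
      have h1 := mul_le_mul_of_nonneg_right (hm c) (mul_nonneg (hmpos c).le (sq_nonneg e))
      linarith
    refine (Finset.sum_le_sum h).trans (le_of_eq ?_)
    simp
  · refine (measureReal_biUnion_finset_le _ _).trans ?_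
    have h : ∀ t ∈ Finset.range (K + 1), (experimentLaw i N m₀ Λ D A idx W).real (Y₂ t)
        ≤ 2 * Real.exp (-(2 * n * m₀ * η ^ 2)) := by
      intro t _
      have hQ : ∀ t, 0 ≤ tail K w t := fun t => Finset.sum_nonneg fun b _ => hw b
      have h1 : HasSubgaussianMGF (fun Y : Fin K → ℕ => ∑ c : Fin K, a t c * ((Y c : ℝ) - m c * p c)) _
          (experimentLaw i N m₀ Λ D A idx W) := hasSubgaussianMGF_pi
        (f := fun (c : Fin K) (k : ℕ) => a t c * ((k : ℝ) - m c * p c)) fun c =>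
        (hasSubgaussianMGF_countLaw (m c) (attemptLaw i D A idx c)).const_mul (a t c)
      -- The parameter is `∑ w_c² / (4 m_c)` over `c ≥ t`. By `hwm` each term is at most `w_c (Q_t +
      -- q) / (4 n m₀)`, and the weights sum to `Q_t ≤ Q_t + q`.
      refine h1.measureReal_lt_abs_le (V := (tail K w t + q) ^ 2 / (4 * n * m₀)) ?_
        (mul_nonneg hη (by linarith [hQ t])) (le_of_eq ?_)
        (by have := hQ t; positivity)
      · rw [le_div_iff₀ (by positivity)]
        push_cast
        rw [Finset.sum_mul]
        have h2 : ∀ c ∈ (Finset.univ : Finset (Fin K)),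
            (a t c) ^ 2 * ((m c : ℝ) / 4) * (4 * n * m₀)
              ≤ if t ≤ (c : ℕ) then w c * (tail K w t + q) else 0 := by
          intro c _
          simp only [a]
          split_ifs with htc
          · have h3 := hwm c c.2
            have h4 := tail_antitone hw htc c.2.le
            have h5 := hmpos c
            have h6 : (w c / m c) ^ 2 * ((m c : ℝ) / 4) * (4 * n * m₀)
                = w c * ((n * w c * m₀) / m c) := by
              field_simp
            rw [h6]
            refine mul_le_mul_of_nonneg_left ?_ (hw c)
            rw [div_le_iff₀ h5]
            nlinarith
          · simp
        refine (Finset.sum_le_sum h2).trans ?_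
        rw [Fin.sum_univ_eq_sum_range (fun c => if t ≤ c then w c * (tail K w t + q) else 0),
          ← Finset.sum_filter, ← Finset.sum_mul]
        have h3 : ∑ c ∈ (Finset.range K).filter (t ≤ ·), w c = tail K w t := by
          rw [tail]
          refine Finset.sum_congr ?_ fun _ _ => rfl
          ext c
          simp only [Finset.mem_filter, Finset.mem_range, Finset.mem_Ico]
          omega
        rw [h3, sq]
        gcongr
        · linarith [hQ t]
        · linarith
      · field_simp
        ring
    refine (Finset.sum_le_sum h).trans (le_of_eq ?_)
    simp

theorem estimateLaw_not_good_le (hidx : Monotone idx) (hK : ∀ z, idx z < K) (hN : 0 < N)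
    (hm₀ : 0 < m₀) (hn : 1 ≤ n) (hδ0 : 0 ≤ δ) (hδ : δ < 1 / 2) (hnδ : n * δ ≤ 1)
    (hKδ : K * δ ≤ 1) (hδν : 2 * K * δ ≤ ν) (hq : 0 < q) (hΛ : 2 + Real.log (n / q) ≤ Λ)
    (he0 : 0 ≤ e) (he1 : e ≤ 1) (hη : 0 ≤ η) {vmax θ μ : ℝ} (hF : ∀ᵐ z ∂(D i), z ∈ Icc 0 vmax)
    (hμ : ∫ z, z ∂(D i) ≤ μ) {ζ : ℕ → ℝ} (hζ : Monotone ζ) (hζ0 : 0 ≤ ζ 0)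
    (hZ : ∀ b ≤ K, ζ b ≤ vmax) (hζle : ∀ z ∈ Icc 0 vmax, ζ (idx z) ≤ z)
    (hleζ : ∀ z ∈ Icc 0 vmax, z ≤ (1 + η) * ζ (idx z) + θ) (hθ : 0 ≤ θ) :
    (estimateLaw i K N m₀ Λ ν D A idx).real {S | ¬ Good (D i) idx (interimAlloc D A i)
        (4 * ν + 2 * e) (θ + η * μ + (4 * ν + 2 * η) * μ + 2 * η * q * vmax) S}
      ≤ (K + 1) ^ 3 * (2 * Real.exp (-(2 * N * δ ^ 2)))
        + (K * (2 * Real.exp (-(2 * m₀ * e ^ 2)))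
          + (K + 1) * (2 * Real.exp (-(2 * n * m₀ * η ^ 2)))) := by
  have := isProbabilityMeasure_surveyLaw K N (D i) hidx
  have : ∀ W : Table K, IsProbabilityMeasure
      ((experimentLaw i N m₀ Λ D A idx W).map fun Y => cuts N ν W (outcome N m₀ Λ n W Y)) :=
    fun W => Measure.isProbabilityMeasure_map (measurable_of_countable _).aemeasurable
  refine measureReal_bind_le _ (measurable_of_countable _) MeasurableSet.of_discrete
    MeasurableSet.of_discrete (surveyLaw_not_accurate_le (D i) hidx hN hδ0) (by positivity)
    fun W hW => ?_
  have hW' : Accurate (D i) idx N δ W := not_not.1 hW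
  rw [map_measureReal_apply (measurable_of_countable _) MeasurableSet.of_discrete]
  refine (measureReal_mono fun Y hY => ?_).trans
    (experimentLaw_not_accurate_le hidx hK hW' hm₀ hn hnδ hKδ hq hΛ he0 hη)
  intro hacc
  exact hY (good_cuts hidx hK hW' hacc (fun c _ => measureReal_nonneg)
    (fun c _ => measureReal_le_one) (fun c _ h => attemptLaw_real_true i D A h) hδ hδν hη hq.le
    he0 he1 hF hμ hζ hζ0 hZ hζle hleζ hθ)

end accuracy

end Ironing

end BayesMech

/-! ### Parameters and the number of buckets. -/

namespace BayesMech

namespace Ironing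

section parameters

variable (n : ℕ) (ε vmax μ : ℝ)

/-- The accuracy of the estimates. -/
def accuracy : ℝ := ε / (16 * n)

/-- The number of buckets of the reduction. -/
def numBuckets : ℕ := bucketCount (accuracy n ε) (accuracy n ε * μ) vmax

/-- The factor `max(1, log_{1+ε}(vmax / (ε μ)))` of `callScale`. -/
def logFactor : ℝ := max 1 (Real.logb (1 + ε) (vmax / (ε * μ)))

/-- The logarithm of `callScale`. -/
def logScale : ℝ := Real.log (2 + callScale n ε vmax μ)

/-- The number of samples for every conditional bucket probability. -/
def numSamples : ℕ :=
  ⌈46 * (numBuckets n ε vmax μ : ℝ) ^ 2 * ((accuracy n ε)⁻¹) ^ 2 * logScale n ε vmax μ⌉₊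

/-- The smallest number of runs for a bucket. -/
def numTrials : ℕ := ⌈2944 * n * (ε⁻¹) ^ 2 * logScale n ε vmax μ⌉₊

/-- The total hazard after which buckets are negligible. -/
def cutoff : ℝ := 2 + Real.log (n / (μ / vmax))

variable {n ε vmax μ}

theorem callScale_eq : callScale n ε vmax μ = 1 + n ^ 3 * (ε⁻¹) ^ 2 * logFactor ε vmax μ := rfl

theorem one_le_callScale : 1 ≤ callScale n ε vmax μ := by
  have : 0 ≤ logFactor ε vmax μ := zero_le_one.trans (le_max_left _ _)
  rw [callScale_eq]
  have : 0 ≤ (n : ℝ) ^ 3 * (ε⁻¹) ^ 2 * logFactor ε vmax μ := by positivity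
  linarith

theorem one_le_logScale : 1 ≤ logScale n ε vmax μ := by
  have h := one_le_callScale (n := n) (ε := ε) (vmax := vmax) (μ := μ)
  rw [logScale, Real.le_log_iff_exp_le (by linarith)]
  linarith [Real.exp_one_lt_d9]

theorem logScale_le : logScale n ε vmax μ ≤ 2 + callScale n ε vmax μ := by
  have h := one_le_callScale (n := n) (ε := ε) (vmax := vmax) (μ := μ)
  exact (Real.log_le_sub_one_of_pos (by linarith)).trans (by linarith)

variable (hn : 1 ≤ n) (hε : 0 < ε) (hε1 : ε < 1) (hμ : 0 < μ) (hv : μ ≤ vmax)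

include hn hε hε1 in
theorem scale_bounds : (n : ℝ) * logFactor ε vmax μ ≤ callScale n ε vmax μ ∧
    n * ε⁻¹ ≤ callScale n ε vmax μ ∧ 2 ≤ callScale n ε vmax μ := by
  have hL : 1 ≤ logFactor ε vmax μ := le_max_left _ _
  have hn' : (1 : ℝ) ≤ n := by exact_mod_cast hn
  have hi : 1 ≤ ε⁻¹ := (one_le_inv₀ hε).2 hε1.le
  have h1 : (n : ℝ) ≤ (n : ℝ) ^ 3 := le_self_pow₀ hn' (by norm_num)
  have h2 : ε⁻¹ ≤ (ε⁻¹) ^ 2 := le_self_pow₀ hi (by norm_num)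
  have h3 : (n : ℝ) * ε⁻¹ ≤ n ^ 3 * (ε⁻¹) ^ 2 := by gcongr
  have h4 : (n : ℝ) ^ 3 * (ε⁻¹) ^ 2 ≤ n ^ 3 * (ε⁻¹) ^ 2 * logFactor ε vmax μ :=
    le_mul_of_one_le_right (by positivity) hL
  have h5 : (n : ℝ) * 1 ≤ n * ε⁻¹ := by gcongr
  have h6 : (n : ℝ) * logFactor ε vmax μ ≤ n ^ 3 * (ε⁻¹) ^ 2 * logFactor ε vmax μ := by
    gcongr
    linarith
  rw [callScale_eq]
  refine ⟨by linarith, by linarith, by linarith⟩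

include hn hε in
theorem accuracy_pos : 0 < accuracy n ε := by
  have : (0 : ℝ) < n := by exact_mod_cast hn
  unfold accuracy
  positivity

include hn hε hε1 in
theorem accuracy_le : accuracy n ε ≤ 1 / 16 := by
  have hn' : (1 : ℝ) ≤ n := by exact_mod_cast hn
  unfold accuracy
  rw [div_le_div_iff₀ (by positivity) (by norm_num)]
  linarith

include hn hε hε1 in
theorem log_natCast_le : Real.log n ≤ logScale n ε vmax μ := by
  have hn' : (1 : ℝ) ≤ n := by exact_mod_cast hn
  have hi : 1 ≤ ε⁻¹ := (one_le_inv₀ hε).2 hε1.le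
  have h := (scale_bounds (vmax := vmax) (μ := μ) hn hε hε1).2.1
  refine Real.log_le_log (by linarith) ?_
  nlinarith

include hε hε1 hμ hv in
-- Since `log (1 + ε) ≤ ε`, the logarithm is at most `ε` times `logFactor`. If it is at least `1`,
-- this bounds `ε⁻¹`; otherwise `ε⁻¹ ≤ vmax / (ε * μ) ≤ e`. The bound on `ε⁻¹` lets `logFactor`
-- absorb terms `ε⁻¹ log n`.
theorem log_ratio_bounds : 0 < Real.log (vmax / (ε * μ)) ∧
    Real.log (vmax / (ε * μ)) ≤ ε * logFactor ε vmax μ ∧ ε⁻¹ ≤ 3 * logFactor ε vmax μ := by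
  have hL : 1 ≤ logFactor ε vmax μ := le_max_left _ _
  have h1 : ε⁻¹ ≤ vmax / (ε * μ) := by
    rw [inv_eq_one_div, div_le_div_iff₀ hε (by positivity)]
    nlinarith
  have hi : 1 < ε⁻¹ := (one_lt_inv₀ hε).2 hε1
  have h2 : 0 < Real.log (vmax / (ε * μ)) := Real.log_pos (hi.trans_le h1)
  have h3 : Real.log (vmax / (ε * μ)) ≤ ε * logFactor ε vmax μ := by
    have h4 : Real.logb (1 + ε) (vmax / (ε * μ)) ≤ logFactor ε vmax μ := le_max_right _ _
    have h5 : 0 < Real.log (1 + ε) := Real.log_pos (by linarith)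
    have h6 : Real.log (1 + ε) ≤ ε := by 
      linarith [Real.log_le_sub_one_of_pos (show 0 < 1 + ε by linarith)]
    rw [Real.logb, div_le_iff₀ h5] at h4
    calc _ ≤ logFactor ε vmax μ * Real.log (1 + ε) := h4
      _ ≤ logFactor ε vmax μ * ε := by gcongr
      _ = _ := mul_comm _ _
  refine ⟨h2, h3, ?_⟩
  rcases le_total 1 (Real.log (vmax / (ε * μ))) with h | h
  · rw [inv_le_iff_one_le_mul₀ hε]
    nlinarith
  · have h4 : vmax / (ε * μ) ≤ Real.exp 1 := by
      rwa [← Real.log_le_iff_le_exp (lt_trans zero_lt_one (hi.trans_le h1))]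
    linarith [Real.exp_one_lt_d9]

include hn hε hε1 hμ hv in
-- Passing from ratio `1 + ε` to `1 + η` multiplies the count by order `n`. The smaller threshold `η
-- μ` adds `log (16 n)` to the logarithm, which after division by `ε` is absorbed by `logFactor` and
-- `logScale`.
theorem numBuckets_le :
    (numBuckets n ε vmax μ : ℝ) ≤ 322 * (n * logFactor ε vmax μ * logScale n ε vmax μ) := by
  have hn' : (1 : ℝ) ≤ n := by exact_mod_cast hn
  have hL : 1 ≤ logFactor ε vmax μ := le_max_left _ _
  have hl : 1 ≤ logScale n ε vmax μ := one_le_logScale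
  have hη := accuracy_pos hn hε
  have hη1 := accuracy_le hn hε hε1
  obtain ⟨hY, hYL, hiL⟩ := log_ratio_bounds hε hε1 hμ hv
  have hvp : 0 < vmax := hμ.trans_le hv
  have e1 : vmax / (accuracy n ε * μ) = vmax / (ε * μ) * (16 * n) := by
    unfold accuracy
    field_simp
  have e2 : Real.log (vmax / (accuracy n ε * μ))
      = Real.log (vmax / (ε * μ)) + (Real.log 16 + Real.log n) := by
    rw [e1, Real.log_mul (by positivity) (by positivity), Real.log_mul (by norm_num) (by positivity)]
  have h16 : Real.log 16 ≤ 2 * logScale n ε vmax μ := by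
    have h1 : Real.log 16 = 2 * Real.log 4 := by
      rw [show (16 : ℝ) = 4 ^ 2 by norm_num, Real.log_pow]
      norm_num
    have h2 : Real.log 4 ≤ logScale n ε vmax μ :=
      Real.log_le_log (by norm_num)
        (by linarith [(scale_bounds (vmax := vmax) (μ := μ) hn hε hε1).2.2])
    linarith
  have hln := log_natCast_le (vmax := vmax) (μ := μ) hn hε hε1
  have hnum0 : 0 ≤ Real.log (vmax / (accuracy n ε * μ)) := by
    rw [e2]
    have := Real.log_nonneg hn'
    have := Real.log_nonneg (show (1 : ℝ) ≤ 16 by norm_num)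
    linarith
  -- This follows from `log (1 + η) ≥ η / (1 + η)` and `η ≤ 1`.
  have hlog : accuracy n ε / 2 ≤ Real.log (1 + accuracy n ε) := by
    have h1 := Real.one_sub_inv_le_log_of_pos (show 0 < 1 + accuracy n ε by linarith)
    have h2 : accuracy n ε / 2 ≤ 1 - (1 + accuracy n ε)⁻¹ := by
      have : 1 - (1 + accuracy n ε)⁻¹ = accuracy n ε / (1 + accuracy n ε) := by
        field_simp
        ring
      rw [this]
      gcongr
      linarith
    linarith
  have h3 : Real.logb (1 + accuracy n ε) (vmax / (accuracy n ε * μ))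
      ≤ 320 * (n * logFactor ε vmax μ * logScale n ε vmax μ) := by
    rw [Real.logb]
    calc _ ≤ Real.log (vmax / (accuracy n ε * μ)) / (accuracy n ε / 2) := by gcongr
      _ = 32 * n * (Real.log (vmax / (accuracy n ε * μ)) * ε⁻¹) := by
          unfold accuracy
          field_simp
          ring
      _ ≤ 32 * n * (10 * (logFactor ε vmax μ * logScale n ε vmax μ)) := by
          refine mul_le_mul_of_nonneg_left ?_ (by positivity)
          rw [e2, add_mul]
          have h4 : Real.log (vmax / (ε * μ)) * ε⁻¹ ≤ logFactor ε vmax μ := by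
            rw [← div_eq_mul_inv, div_le_iff₀ hε]
            linarith
          have h5 : (Real.log 16 + Real.log n) * ε⁻¹
              ≤ (3 * logScale n ε vmax μ) * (3 * logFactor ε vmax μ) := by
            gcongr
            linarith
          have h6 : logFactor ε vmax μ ≤ logFactor ε vmax μ * logScale n ε vmax μ :=
            le_mul_of_one_le_right (by linarith) hl
          linarith
      _ = _ := by ring
  have h7 := (Nat.ceil_lt_add_one (Real.logb_nonneg (show 1 < 1 + accuracy n ε by linarith)
    (show 1 ≤ vmax / (accuracy n ε * μ) by
      rw [one_le_div (by positivity)]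
      exact (mul_le_of_le_one_left hμ.le (by linarith)).trans hv))).le
  have h8 : 1 ≤ n * logFactor ε vmax μ * logScale n ε vmax μ :=
    one_le_mul_of_one_le_of_one_le (one_le_mul_of_one_le_of_one_le hn' hL) hl
  rw [numBuckets, bucketCount]
  push_cast
  linarith

end parameters

end Ironing

end BayesMech

/-! ### Failure probability and total numbers of calls. -/

namespace BayesMech

namespace Ironing

section parameters

variable {n : ℕ} {ε vmax μ : ℝ}
variable (hn : 1 ≤ n) (hε : 0 < ε) (hε1 : ε < 1) (hμ : 0 < μ) (hv : μ ≤ vmax)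

include hn hε hε1 hμ hv in
theorem numBuckets_add_one_le :
    (numBuckets n ε vmax μ : ℝ) + 1 ≤ 323 * (2 + callScale n ε vmax μ) ^ 2 := by
  have hl : 1 ≤ logScale n ε vmax μ := one_le_logScale
  have hl2 : logScale n ε vmax μ ≤ 2 + callScale n ε vmax μ := logScale_le
  obtain ⟨h1, -, h2⟩ := scale_bounds (vmax := vmax) (μ := μ) hn hε hε1
  have h3 := numBuckets_le hn hε hε1 hμ hv
  have h4 : n * logFactor ε vmax μ * logScale n ε vmax μ
      ≤ (2 + callScale n ε vmax μ) * (2 + callScale n ε vmax μ) := by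
    gcongr
    linarith
  nlinarith

include hn hε hε1 in
theorem inv_accuracy_le : (accuracy n ε)⁻¹ ≤ 16 * (2 + callScale n ε vmax μ) := by
  obtain ⟨-, h1, -⟩ := scale_bounds (vmax := vmax) (μ := μ) hn hε hε1
  have : (accuracy n ε)⁻¹ = 16 * (n * ε⁻¹) := by
    unfold accuracy
    rw [inv_div, div_eq_mul_inv]
    ring
  rw [this]
  linarith

include hn hε hε1 hμ hv in
-- With `X = 2 + callScale`, each exponential is at most `X⁻²³`. The union bound has at most `6 (323
-- X²)³` terms of this size, and since `X ≥ 4` the result is below `1 / (16 X) ≤ η`; hence the `23`.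
theorem failure_le {a₁ a₂ a₃ : ℝ} (h₁ : 23 * logScale n ε vmax μ ≤ a₁)
    (h₂ : 23 * logScale n ε vmax μ ≤ a₂) (h₃ : 23 * logScale n ε vmax μ ≤ a₃) :
    ((numBuckets n ε vmax μ : ℝ) + 1) ^ 3 * (2 * Real.exp (-a₁))
        + (numBuckets n ε vmax μ * (2 * Real.exp (-a₂))
          + (numBuckets n ε vmax μ + 1) * (2 * Real.exp (-a₃))) ≤ accuracy n ε := by
  have hη := accuracy_pos hn hε
  obtain ⟨-, -, hT⟩ := scale_bounds (vmax := vmax) (μ := μ) hn hε hε1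
  set X := 2 + callScale n ε vmax μ with hX
  set K := (numBuckets n ε vmax μ : ℝ)
  have hX4 : 4 ≤ X := by linarith
  have hK0 : 0 ≤ K := Nat.cast_nonneg _
  have hK : K + 1 ≤ 323 * X ^ 2 := numBuckets_add_one_le hn hε hε1 hμ hv
  have hE : Real.exp (-(23 * logScale n ε vmax μ)) = (X ^ 23)⁻¹ := by
    rw [Real.exp_neg, logScale, ← hX, ← Real.exp_log (show 0 < X by linarith), ← Real.exp_nat_mul,
      Real.exp_log (by linarith)]
    norm_num
  have hexp : ∀ a, 23 * logScale n ε vmax μ ≤ a → Real.exp (-a) ≤ (X ^ 23)⁻¹ := by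
    intro a ha
    rw [← hE]
    gcongr
  have hp : (K + 1) ≤ (K + 1) ^ 3 := le_self_pow₀ (by linarith) (by norm_num)
  have h4 : (4 : ℝ) ^ 16 ≤ X ^ 16 := by gcongr
  have hXpos : 0 < X := by linarith
  calc _ ≤ (K + 1) ^ 3 * (2 * (X ^ 23)⁻¹) + ((K + 1) ^ 3 * (2 * (X ^ 23)⁻¹)
          + (K + 1) ^ 3 * (2 * (X ^ 23)⁻¹)) := by
        gcongr
        · exact hexp _ h₁
        · linarith
        · exact hexp _ h₂
        · exact hexp _ h₃
    _ = 6 * (K + 1) ^ 3 * (X ^ 23)⁻¹ := by ring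
    _ ≤ 6 * (323 * X ^ 2) ^ 3 * (X ^ 23)⁻¹ := by gcongr
    _ = 6 * 323 ^ 3 * (X ^ 16)⁻¹ * X⁻¹ := by
        field_simp
    _ ≤ 6 * 323 ^ 3 * (4 ^ 16)⁻¹ * X⁻¹ := by gcongr
    _ ≤ 16⁻¹ * X⁻¹ := by
        gcongr
        norm_num
    _ = (16 * X)⁻¹ := by rw [mul_inv]
    _ ≤ ((accuracy n ε)⁻¹)⁻¹ := by
        gcongr
        exact inv_accuracy_le hn hε hε1
    _ = _ := inv_inv _

include hn hε hε1 hμ hv in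
theorem cutoff_bounds : 0 ≤ cutoff n vmax μ ∧
    cutoff n vmax μ ≤ 4 * (logFactor ε vmax μ * logScale n ε vmax μ) := by
  have hn' : (1 : ℝ) ≤ n := by exact_mod_cast hn
  have hL : 1 ≤ logFactor ε vmax μ := le_max_left _ _
  have hl : 1 ≤ logScale n ε vmax μ := one_le_logScale
  have hvp : 0 < vmax := hμ.trans_le hv
  obtain ⟨hY, hYL, -⟩ := log_ratio_bounds hε hε1 hμ hv
  have h1 : Real.log (n / (μ / vmax)) = Real.log n + Real.log (vmax / μ) := by
    rw [← Real.log_mul (by positivity) (by positivity)]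
    congr 1
    field_simp
  have h2 : Real.log (vmax / μ) ≤ Real.log (vmax / (ε * μ)) := by
    refine Real.log_le_log (by positivity) ?_
    gcongr
    nlinarith
  have h3 : 0 ≤ Real.log (vmax / μ) := Real.log_nonneg ((one_le_div hμ).2 hv)
  have h4 := Real.log_nonneg hn'
  have h5 := log_natCast_le (vmax := vmax) (μ := μ) hn hε hε1
  unfold cutoff
  rw [h1]
  refine ⟨by linarith, ?_⟩
  have h6 : ε * logFactor ε vmax μ ≤ logFactor ε vmax μ := by nlinarith
  have h7 : logFactor ε vmax μ ≤ logFactor ε vmax μ * logScale n ε vmax μ :=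
    le_mul_of_one_le_right (by linarith) hl
  have h8 : logScale n ε vmax μ ≤ logFactor ε vmax μ * logScale n ε vmax μ :=
    le_mul_of_one_le_left (by linarith) hL
  nlinarith

/-- The number of calls to the algorithm that are made for one agent. -/
def agentCalls (n : ℕ) (ε vmax μ : ℝ) : ℕ :=
  numTrials n ε vmax μ * (2 * numBuckets n ε vmax μ + ⌈n * cutoff n vmax μ⌉₊)

include hn hε hε1 hμ hv in
-- Trials per unit are of order `n ε⁻² l`, and buckets together with the hazard budget are of order
-- `n L l`, for `L` the `logFactor` and `l` the `logScale`. Their product times `n` agents is `n³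
-- ε⁻² L l²`; the `1` is the final call.
theorem agentCalls_le : (n : ℝ) * agentCalls n ε vmax μ + 1
    ≤ 2000000 * (callScale n ε vmax μ * logScale n ε vmax μ ^ 2) := by
  have hn' : (1 : ℝ) ≤ n := by exact_mod_cast hn
  have hL : 1 ≤ logFactor ε vmax μ := le_max_left _ _
  have hl : 1 ≤ logScale n ε vmax μ := one_le_logScale
  have hi : 1 ≤ ε⁻¹ := (one_le_inv₀ hε).2 hε1.le
  obtain ⟨hc0, hc⟩ := cutoff_bounds hn hε hε1 hμ hv
  have hK := numBuckets_le hn hε hε1 hμ hv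
  set L := logFactor ε vmax μ with hL_def
  set l := logScale n ε vmax μ with hl_def
  have h1 : (numTrials n ε vmax μ : ℝ) ≤ 2945 * (n * (ε⁻¹) ^ 2 * l) := by
    have h2 : 1 ≤ n * (ε⁻¹) ^ 2 * l :=
      one_le_mul_of_one_le_of_one_le (one_le_mul_of_one_le_of_one_le hn' (one_le_pow₀ hi)) hl
    have h3 := (Nat.ceil_lt_add_one (show 0 ≤ 2944 * n * (ε⁻¹) ^ 2 * l by positivity)).le
    unfold numTrials
    linarith
  have h4 : 1 ≤ n * L * l := one_le_mul_of_one_le_of_one_le (one_le_mul_of_one_le_of_one_le hn' hL) hl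
  have h5 : (2 * numBuckets n ε vmax μ + ⌈n * cutoff n vmax μ⌉₊ : ℝ) ≤ 649 * (n * L * l) := by
    have h6 := (Nat.ceil_lt_add_one (show 0 ≤ n * cutoff n vmax μ by positivity)).le
    have h7 : n * cutoff n vmax μ ≤ n * (4 * (L * l)) := by gcongr
    linarith
  have h8 : (n : ℝ) * agentCalls n ε vmax μ
      ≤ n * ((2945 * (n * (ε⁻¹) ^ 2 * l)) * (649 * (n * L * l))) := by
    unfold agentCalls
    push_cast
    gcongr
  have h9 : n * ((2945 * (n * (ε⁻¹) ^ 2 * l)) * (649 * (n * L * l)))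
      = 1911305 * ((callScale n ε vmax μ - 1) * l ^ 2) := by
    rw [callScale_eq, ← hL_def]
    ring
  have h10 : 1 ≤ l ^ 2 := one_le_pow₀ hl
  have h11 : 1 ≤ callScale n ε vmax μ := one_le_callScale
  nlinarith

/-- The number of calls to the distributions that are made for one agent. -/
def agentSamples (n : ℕ) (ε vmax μ : ℝ) : ℕ :=
  (numBuckets n ε vmax μ + 1) ^ 3 * numSamples n ε vmax μ + agentCalls n ε vmax μ * n + 1

include hn hε hε1 hμ hv in
-- Every quantity is bounded crudely by a power of `X = 2 + callScale`. The survey dominates with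
-- degree `1 + 6 + 4 + 2 + 1 = 14`, the degree in the final statement.
theorem agentSamples_le :
    (n : ℝ) * agentSamples n ε vmax μ ≤ 10 ^ 30 * callScale n ε vmax μ ^ 14 := by
  have hn' : (1 : ℝ) ≤ n := by exact_mod_cast hn
  have hL : 1 ≤ logFactor ε vmax μ := le_max_left _ _
  have hl : 1 ≤ logScale n ε vmax μ := one_le_logScale
  have hl2 : logScale n ε vmax μ ≤ 2 + callScale n ε vmax μ := logScale_le
  have hA := agentCalls_le hn hε hε1 hμ hv
  have hK := numBuckets_add_one_le hn hε hε1 hμ hv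
  have hη := inv_accuracy_le (vmax := vmax) (μ := μ) hn hε hε1
  have hη0 := accuracy_pos hn hε
  obtain ⟨hs1, -, hT⟩ := scale_bounds (vmax := vmax) (μ := μ) hn hε hε1
  set X := 2 + callScale n ε vmax μ with hX
  have hX1 : 1 ≤ X := by linarith
  have hnX : (n : ℝ) ≤ X := by nlinarith
  have hK' : (numBuckets n ε vmax μ : ℝ) ≤ 323 * X ^ 2 := by linarith
  have h1 : (numSamples n ε vmax μ : ℝ) ≤ 46 * (323 * X ^ 2) ^ 2 * (16 * X) ^ 2 * X + 1 := by
    unfold numSamples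
    refine (Nat.ceil_lt_add_one (by positivity)).le.trans ?_
    gcongr
  have h2 : ((numBuckets n ε vmax μ : ℝ) + 1) ^ 3 ≤ (323 * X ^ 2) ^ 3 := by gcongr
  have h3 : callScale n ε vmax μ * logScale n ε vmax μ ^ 2 ≤ X * X ^ 2 := by
    gcongr
    linarith
  have h4 : (n : ℝ) * agentSamples n ε vmax μ
      ≤ X * ((323 * X ^ 2) ^ 3 * (46 * (323 * X ^ 2) ^ 2 * (16 * X) ^ 2 * X + 1))
        + 2000000 * (X * X ^ 2) * X + X := by
    have e : (n : ℝ) * agentSamples n ε vmax μ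
        = n * (((numBuckets n ε vmax μ : ℝ) + 1) ^ 3 * numSamples n ε vmax μ)
          + (n * agentCalls n ε vmax μ) * n + n := by
      unfold agentSamples
      push_cast
      ring
    rw [e]
    have hA' : n * agentCalls n ε vmax μ ≤ 2000000 * (X * X ^ 2) := by linarith
    gcongr
  have hp : ∀ k ≤ 14, X ^ k ≤ X ^ 14 := fun k hk => pow_le_pow_right₀ hX1 hk
  have h5 : (X : ℝ) ^ 14 ≤ (2 * callScale n ε vmax μ) ^ 14 := by
    gcongr
    linarith
  rw [mul_pow] at h5
  have h7 := hp 7 (by norm_num)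
  have h8 := hp 4 (by norm_num)
  have h9 := hp 1 (by norm_num)
  have e2 : X * ((323 * X ^ 2) ^ 3 * (46 * (323 * X ^ 2) ^ 2 * (16 * X) ^ 2 * X + 1))
        + 2000000 * (X * X ^ 2) * X + X
      = 323 ^ 5 * 46 * 256 * X ^ 14 + 323 ^ 3 * X ^ 7 + 2000000 * X ^ 4 + X ^ 1 := by ring
  rw [e2] at h4
  have h10 : 0 ≤ callScale n ε vmax μ ^ 14 := by positivity
  have h11 : 323 ^ 5 * 46 * 256 * X ^ 14 + 323 ^ 3 * X ^ 7 + 2000000 * X ^ 4 + X ^ 1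
      ≤ (323 ^ 5 * 46 * 256 + 323 ^ 3 + 2000000 + 1) * X ^ 14 := by linarith
  refine h4.trans (h11.trans ?_)
  norm_num at h5 ⊢
  linarith

end parameters

end Ironing

end BayesMech

/-! ### The reduction and its specification. -/

namespace BayesMech

open Proc Ironing

section programs

variable {n : ℕ} {D : Fin n → Measure ℝ} [∀ i, IsProbabilityMeasure (D i)] {A : Algorithm n}
  [IsMarkovKernel A]

/-- Replace every bid, and run the algorithm on the result. -/
def replaceAndCall (c : Fin n → Proc n ℝ) : OracleProgram n :=
  ((collect n c).andThen call) OracleProgram.output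

theorem law_replaceAndCall {c : Fin n → Proc n ℝ} {K : Fin n → Kernel ℝ ℝ}
    [∀ i, IsMarkovKernel (K i)] {v : Profile n} (hc : ∀ i, HasLaw D A (c i) (K i (v i))) :
    (replaceAndCall c).law D A = (A ∘ₖ resample K) v := by
  have h := (HasLaw.collect hc).andThen (f := call) (fun w => hasLaw_call D A w) A.measurable
  have h2 := h OracleProgram.output (measurable_of_countable _)
  rw [replaceAndCall, h2, Kernel.comp_apply]
  exact Measure.bind_dirac

theorem calls_replaceAndCall {c : Fin n → Proc n ℝ} {N M : ℕ} (hc : ∀ i, CallsLE (c i) N M) :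
    (replaceAndCall c).algCalls ≤ (n * N + 1 : ℕ)
      ∧ (replaceAndCall c).distCalls ≤ (n * M : ℕ) := by
  have h := (CallsLE.collect hc).andThen (f := call) fun w => callsLE_call w
  have h2 := h OracleProgram.output 0 0 (fun _ => by simp [OracleProgram.algCalls])
    fun _ => by simp [OracleProgram.distCalls]
  simpa [replaceAndCall] using h2

section resampleAgent

variable (i : Fin n) {idx : ℝ → ℕ} (hidx : Monotone idx) (K N m₀ : ℕ) (Λ ν : ℝ)

/-- Choose pool boundaries and resample a value `z` of agent `i` from its pool. -/
def resampleAgent (z : ℝ) : Proc n ℝ :=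
  (estimate i hidx K N m₀ Λ ν).andThen fun S =>
    draw i (pool idx S z) (ordConnected_pool hidx S z) 0

theorem callsLE_resampleAgent (hΛ : 0 ≤ Λ) (z : ℝ) :
    CallsLE (resampleAgent i hidx K N m₀ Λ ν z) (m₀ * (2 * K + ⌈n * Λ⌉₊))
      ((K + 1) ^ 3 * N + m₀ * (2 * K + ⌈n * Λ⌉₊) * n + 1) :=
  (callsLE_estimate i hidx K N m₀ Λ ν hΛ).andThen fun _ => callsLE_draw i _ _ 0

theorem hasLaw_resampleAgent [IsProbabilityMeasure (estimateLaw i K N m₀ Λ ν D A idx)] (z : ℝ) :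
    HasLaw D A (resampleAgent i hidx K N m₀ Λ ν z)
      (poolKernel (D i) hidx.measurable (estimateLaw i K N m₀ Λ ν D A idx) z) :=
  (hasLaw_estimate i hidx K N m₀ Λ ν D A).andThen (fun _ => hasLaw_draw D A i _ _ 0)
    (measurable_of_countable _)

end resampleAgent

/-- A resampling that makes the interim allocation nearly monotone at a small loss yields a nearly
incentive compatible algorithm of nearly the same welfare. -/
theorem isBIC_and_welfare_comp_resample {ε vmax μ : ℝ} (hn : 1 ≤ n) (hε : 0 < ε)
    (hD : ∀ i, ∀ᵐ x ∂(D i), x ∈ Icc 0 vmax) (c : Allocation n → EReal) (K : Fin n → Kernel ℝ ℝ)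
    [∀ i, IsMarkovKernel (K i)] (hK : ∀ j, (D j).bind (K j) = D j)
    (hmono : ∀ i z z', z ≤ z' →
      ∫ w, interimAlloc D A i w ∂(K i z) ≤ ∫ w, interimAlloc D A i w ∂(K i z') + ε)
    (hconst : ∀ i z, vmax ≤ z → K i z = K i vmax)
    (hloss : ∀ i, ∫ z, z * interimAlloc D A i z ∂(D i) - ε / n * μ
      ≤ ∫ z, z * ∫ w, interimAlloc D A i w ∂(K i z) ∂(D i)) :
    IsBICAlgorithm D vmax (ε * vmax) (A ∘ₖ resample K) ∧
      welfare D c A - ((ε * μ : ℝ) : EReal) ≤ welfare D c (A ∘ₖ resample K) := by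
  constructor
  · refine isBICAlgorithm_of_almost_monotone D _ hε.le (fun i z z' _ h => ?_) fun i z hz => ?_
    · rw [interimAlloc_comp_resample D A i K hK, interimAlloc_comp_resample D A i K hK]
      exact hmono i z z' h
    · rw [interimAlloc_comp_resample D A i K hK, interimAlloc_comp_resample D A i K hK,
        hconst i z hz]
  · have h := welfare_comp_resample D A hD c K hK hloss
    have hn' : (n : ℝ) ≠ 0 := by
      exact_mod_cast (by omega : n ≠ 0)
    have e : n * (ε / n * μ) = ε * μ := by field_simp
    rwa [e] at h

end programs

/-- The reduction: resample every bid from a pool of an estimated ironing. -/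
def reduction : Reduction := fun n ε vmax μ v =>
  open Classical in
  -- The positivity conditions provide the proof that buckets are intervals. For `n ≥ 1` and
  -- positive `ε` and `μ`, only `ε < 1` is a real test.
  if h : ε < 1 ∧ 0 < accuracy n ε ∧ 0 < accuracy n ε * μ then
    replaceAndCall fun i => resampleAgent i
      (bucket_mono (vmax := vmax) h.2.1 h.2.2)
      (numBuckets n ε vmax μ) (numSamples n ε vmax μ) (numTrials n ε vmax μ) (cutoff n vmax μ)
      (accuracy n ε) (v i)
  else replaceAndCall fun i => ret (min (v i) vmax)

section main

variable {n : ℕ} {ε vmax μ : ℝ} {D : Fin n → Measure ℝ} [∀ i, IsProbabilityMeasure (D i)]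
  {A : Algorithm n} [IsMarkovKernel A]

/-- The specification of the reduction for given parameters. -/
def Specification (n : ℕ) (ε vmax μ : ℝ) (D : Fin n → Measure ℝ) (c : Allocation n → EReal)
    (A : Algorithm n) (R : Profile n → OracleProgram n) : Prop :=
  ∃ A' : Algorithm n,
    IsMarkovKernel A' ∧
    (∀ v, A' v = (R v).law D A) ∧
    IsBICAlgorithm D vmax (ε * vmax) A' ∧
    welfare D c A - ((ε * μ : ℝ) : EReal) ≤ welfare D c A' ∧
    ∀ v, ∃ N M : ℕ, (R v).algCalls ≤ N ∧
      (N : ℝ) ≤ 10 ^ 30 * callScale n ε vmax μ * Real.log (2 + callScale n ε vmax μ) ^ 14 ∧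
      (R v).distCalls ≤ M ∧ (M : ℝ) ≤ 10 ^ 30 * callScale n ε vmax μ ^ 14

/-- Monotonicity up to `ε ≥ 1` is void for probabilities. Clipping the bids makes the allocation
constant above `vmax` and changes almost no true profile. -/
theorem specification_of_one_le (hn : 1 ≤ n) (hε : 1 ≤ ε) (hμ : 0 < μ)
    (hD : ∀ i, ∀ᵐ x ∂(D i), x ∈ Icc 0 vmax) (c : Allocation n → EReal) :
    Specification n ε vmax μ D c A (reduction n ε vmax μ) := by
  have hT : 1 ≤ callScale n ε vmax μ := one_le_callScale
  have hl : 1 ≤ Real.log (2 + callScale n ε vmax μ) := one_le_logScale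
  let K : Fin n → Kernel ℝ ℝ := fun _ =>
    Kernel.deterministic (fun z => min z vmax) (measurable_id.min measurable_const)
  have hR : ∀ v, reduction n ε vmax μ v = replaceAndCall fun i => ret (min (v i) vmax) :=
    fun v => dif_neg fun h => absurd h.1 (not_lt.2 hε)
  have hx : ∀ i z, ∫ w, interimAlloc D A i w ∂(K i z) = interimAlloc D A i (min z vmax) :=
    fun i z => Kernel.integral_deterministic' _ (measurable_interimAlloc D A i).stronglyMeasurable
  have hK : ∀ j, (D j).bind (K j) = D j := by
    intro j
    rw [Measure.bind_congr_right (g := Measure.dirac), Measure.bind_dirac]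
    filter_upwards [hD j] with z hz
    rw [Kernel.deterministic_apply, min_eq_left hz.2]
  obtain ⟨h1, h2⟩ := isBIC_and_welfare_comp_resample (A := A) (ε := ε) (μ := μ) hn (by linarith) hD c K hK
    (fun i z z' _ => by
      rw [hx, hx]
      linarith [interimAlloc_le_one D A i (min z vmax), interimAlloc_nonneg D A i (min z' vmax)])
    (fun i z hz => by
      rw [Kernel.deterministic_apply, Kernel.deterministic_apply, min_eq_right hz, min_self])
    (fun i => by
      have e : ∫ z, z * ∫ w, interimAlloc D A i w ∂(K i z) ∂(D i)
          = ∫ z, z * interimAlloc D A i z ∂(D i) := by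
        refine integral_congr_ae ?_
        filter_upwards [hD i] with z hz
        rw [hx, min_eq_left hz.2]
      rw [e]
      have : 0 ≤ ε / n * μ := by positivity
      linarith)
  refine ⟨A ∘ₖ resample K, inferInstance, fun v => ?_, h1, h2, fun v => ?_⟩
  · rw [hR, law_replaceAndCall (K := K) fun i => ?_]
    rw [Kernel.deterministic_apply]
    exact hasLaw_ret _
  · obtain ⟨h3, h4⟩ := calls_replaceAndCall (n := n) (N := 0) (M := 0) fun i =>
      callsLE_ret (min (v i) vmax)
    rw [hR]
    refine ⟨_, _, h3, ?_, h4, ?_⟩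
    · have h5 : 1 ≤ callScale n ε vmax μ * Real.log (2 + callScale n ε vmax μ) ^ 14 :=
        one_le_mul_of_one_le_of_one_le hT (one_le_pow₀ hl)
      push_cast
      linarith
    · push_cast
      rw [mul_zero]
      positivity

/-- The choices are `ν = η`, `δ = η / (2 K)`, `e = ε / 4`, `θ = η μ` and `q = μ / vmax`. The
monotonicity error, including failures, is `4 η + ε / 2 + η ≤ ε`. The value lost per agent is at
most `11 η μ`, within the allowance `16 η μ = ε μ / n`. -/
theorem specification_of_lt_one (hn : 1 ≤ n) (hε : 0 < ε) (hε1 : ε < 1) (hμ : 0 < μ)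
    (hv : μ ≤ vmax) (hmean : ∀ i, ∫ z, z ∂(D i) ≤ μ)
    (hD : ∀ i, ∀ᵐ x ∂(D i), x ∈ Icc 0 vmax) (c : Allocation n → EReal) :
    Specification n ε vmax μ D c A (reduction n ε vmax μ) := by
  have hT : 1 ≤ callScale n ε vmax μ := one_le_callScale
  have hl : 1 ≤ logScale n ε vmax μ := one_le_logScale
  have hn' : (1 : ℝ) ≤ n := by exact_mod_cast hn
  have hi : 1 ≤ ε⁻¹ := (one_le_inv₀ hε).2 hε1.le
  have hvp : 0 < vmax := hμ.trans_le hv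
  set η := accuracy n ε with hη_def
  have hη : 0 < η := accuracy_pos hn hε
  have hη1 : η ≤ 1 / 16 := accuracy_le hn hε hε1
  have hηn : 16 * η * n = ε := by
    rw [hη_def, accuracy]
    field_simp
  have hθ : 0 < η * μ := mul_pos hη hμ
  have hθv : η * μ ≤ vmax := (mul_le_of_le_one_left hμ.le (by linarith)).trans hv
  have hidx := bucket_mono (vmax := vmax) hη hθ
  set N := numSamples n ε vmax μ with hN_def
  set m₀ := numTrials n ε vmax μ with hm_def
  set Λ := cutoff n vmax μ with hΛ_def
  set Kb := numBuckets n ε vmax μ with hKb_def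
  have hKlt : ∀ z, bucket η (η * μ) vmax z < Kb := bucket_lt hη hθ hθv
  have hKb1 : (1 : ℝ) ≤ Kb := by exact_mod_cast Nat.one_le_of_lt (hKlt 0)
  have hΛ0 : 0 ≤ Λ := (cutoff_bounds hn hε hε1 hμ hv).1
  have hNge : 46 * (Kb : ℝ) ^ 2 * (η⁻¹) ^ 2 * logScale n ε vmax μ ≤ N := Nat.le_ceil _
  have hmge : 2944 * n * (ε⁻¹) ^ 2 * logScale n ε vmax μ ≤ m₀ := Nat.le_ceil _
  have hN0 : 0 < N := Nat.ceil_pos.2 (by positivity)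
  have hm0 : 0 < m₀ := Nat.ceil_pos.2 (by positivity)
  have hR : ∀ v, reduction n ε vmax μ v = replaceAndCall fun i =>
      resampleAgent i hidx Kb N m₀ Λ η (v i) := fun v => dif_pos ⟨hε1, hη, hθ⟩
  have hτ := fun i => isProbabilityMeasure_estimateLaw i Kb N m₀ Λ η D A hidx
  let K : Fin n → Kernel ℝ ℝ := fun i =>
    poolKernel (D i) hidx.measurable (estimateLaw i Kb N m₀ Λ η D A (bucket η (η * μ) vmax))
  have hKM : ∀ i, IsMarkovKernel (K i) := fun i => by
    simp only [K]
    infer_instance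
  have hδ : η / (2 * Kb) * (2 * Kb) = η := by field_simp
  have hδ0 : 0 ≤ η / (2 * Kb) := by positivity
  have hδη : 2 * (η / (2 * Kb)) ≤ η := by nlinarith
  have hbad : ∀ i, (estimateLaw i Kb N m₀ Λ η D A (bucket η (η * μ) vmax)).real
      {S | ¬ Good (D i) (bucket η (η * μ) vmax) (interimAlloc D A i) (4 * η + 2 * (ε / 4))
        (η * μ + η * μ + (4 * η + 2 * η) * μ + 2 * η * (μ / vmax) * vmax) S} ≤ η := by
    intro i
    refine (estimateLaw_not_good_le (δ := η / (2 * Kb)) hidx hKlt hN0 hm0 hn hδ0 (by linarith)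
      (by nlinarith) (by nlinarith) (by linarith) (div_pos hμ hvp) le_rfl (by positivity)
      (by linarith) hη.le (hD i) (hmean i) (bucketFloor_mono hη hθ)
      (bucketFloor_zero hθ hθv).ge (fun b _ => bucketFloor_le b)
      (fun z => bucketFloor_bucket_le hη hθ) (fun z => le_bucketFloor_bucket hη hθ)
      hθ.le).trans ?_
    refine failure_le hn hε hε1 hμ hv ?_ ?_ ?_
    · have e : 2 * (46 * (Kb : ℝ) ^ 2 * (η⁻¹) ^ 2 * logScale n ε vmax μ) * (η / (2 * Kb)) ^ 2
          = 23 * logScale n ε vmax μ := by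
        field_simp
        norm_num
      rw [← e]
      gcongr
    · have e : 2 * (2944 * n * (ε⁻¹) ^ 2 * logScale n ε vmax μ) * (ε / 4) ^ 2
          = n * (368 * logScale n ε vmax μ) := by
        field_simp
        norm_num
      calc _ ≤ n * (368 * logScale n ε vmax μ) := by nlinarith
        _ ≤ _ := by
          rw [← e]
          gcongr
    -- Here `2944 = 23 * 128` is what `η = ε / (16 n)` requires; the single-bucket exponent above
    -- has room to spare.
    · have e : 2 * n * (2944 * n * (ε⁻¹) ^ 2 * logScale n ε vmax μ) * η ^ 2
          = 23 * logScale n ε vmax μ := by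
        rw [hη_def, accuracy]
        field_simp
        norm_num
      rw [← e]
      gcongr
  have hx := measurable_interimAlloc D A
  obtain ⟨h1, h2⟩ := isBIC_and_welfare_comp_resample (A := A) (μ := μ) hn hε hD c K
    (fun j => bind_poolKernel (D j) hidx.measurable _)
    (fun i z z' hz => by
      have h := integral_poolKernel_mono (D i) hidx.measurable _ (hx i)
        (interimAlloc_nonneg D A i) (interimAlloc_le_one D A i) (by positivity) (hbad i) hz
      refine h.trans ?_
      have : 16 * η ≤ ε := by nlinarith
      linarith)
    (fun i z hz => by
      have hp : ∀ S, pool (bucket η (η * μ) vmax) S z = pool (bucket η (η * μ) vmax) S vmax := by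
        intro S
        rw [pool, pool, bucket_of_le hz]
      simp only [K, poolKernel_apply, hp])
    (fun i => by
      have h := integral_mul_poolKernel (D i) hidx.measurable _ (hx i)
        (interimAlloc_nonneg D A i) (interimAlloc_le_one D A i) (hD i) (by positivity) (hbad i)
      refine le_trans (sub_le_sub_left ?_ _) h
      have e1 : ε / n = 16 * η := by
        rw [← hηn]
        field_simp
      have e2 : 2 * η * (μ / vmax) * vmax = 2 * η * μ := by field_simp
      have e3 := mul_le_mul_of_nonneg_left (hmean i) hη.le
      rw [e1, e2]
      nlinarith)
  refine ⟨A ∘ₖ resample K, inferInstance, fun v => ?_, h1, h2, fun v => ?_⟩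
  · rw [hR, law_replaceAndCall (K := K) fun i => hasLaw_resampleAgent i hidx Kb N m₀ Λ η (v i)]
  · obtain ⟨h3, h4⟩ := calls_replaceAndCall fun i =>
      callsLE_resampleAgent i hidx Kb N m₀ Λ η hΛ0 (v i)
    rw [hR]
    refine ⟨_, _, h3, ?_, h4, ?_⟩
    · have h5 := agentCalls_le hn hε hε1 hμ hv
      have h6 : logScale n ε vmax μ ^ 2 ≤ logScale n ε vmax μ ^ 14 :=
        pow_le_pow_right₀ hl (by norm_num)
      have h7 : callScale n ε vmax μ * logScale n ε vmax μ ^ 2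
          ≤ callScale n ε vmax μ * logScale n ε vmax μ ^ 14 := by gcongr
      have h8 : 0 ≤ callScale n ε vmax μ * logScale n ε vmax μ ^ 14 := by positivity
      push_cast [agentCalls] at h5 ⊢
      change _ ≤ 10 ^ 30 * callScale n ε vmax μ * logScale n ε vmax μ ^ 14
      linarith
    · have h5 := agentSamples_le hn hε hε1 hμ hv
      push_cast [agentSamples, agentCalls] at h5 ⊢
      exact h5

end main

end BayesMech

end

open BayesMech

theorem mainTheorem4 :
    ∃ (R : Reduction) (C : ℝ) (d : ℕ),
      ∀ (n : ℕ) (ε vmax : ℝ) (D : Fin n → Measure ℝ) (c : Allocation n → EReal)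
        (A : Algorithm n),
        0 < ε →
        (∀ i, IsProbabilityMeasure (D i)) →
        (∀ i, ∀ᵐ x ∂(D i), x ∈ Set.Icc 0 vmax) →
        0 < muMax D →
        (∀ a, c a ≠ ⊥) →
        IsMarkovKernel A →
        ∃ A' : Algorithm n,
          IsMarkovKernel A' ∧
          (∀ v, A' v = (R n ε vmax (muMax D) v).law D A) ∧
          IsBICAlgorithm D vmax (ε * vmax) A' ∧
          welfare D c A - ((ε * muMax D : ℝ) : EReal) ≤ welfare D c A' ∧
          ∀ v, ∃ N M : ℕ,
            (R n ε vmax (muMax D) v).algCalls ≤ N ∧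
            (N : ℝ) ≤ C * callScale n ε vmax (muMax D)
              * Real.log (2 + callScale n ε vmax (muMax D)) ^ d ∧
            (R n ε vmax (muMax D) v).distCalls ≤ M ∧
            (M : ℝ) ≤ C * callScale n ε vmax (muMax D) ^ d := by
  -- The exponent `14` comes from the samples of the distributions; the calls to the algorithm need
  -- only the square of the logarithm.
  refine ⟨reduction, 10 ^ 30, 14, ?_⟩
  intro n ε vmax D c A hε hprob hD hμ _ hA
  have hn : 1 ≤ n := by
    rcases Nat.eq_zero_or_pos n with rfl | h
    -- Without agents the supremum over the empty type is `0`, contrary to `0 < muMax D`.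
    · simp [muMax, Real.iSup_of_isEmpty] at hμ
    · exact h
  rcases le_or_gt 1 ε with h1 | h1
  · exact specification_of_one_le hn h1 hμ hD c
  · have : Nonempty (Fin n) := ⟨⟨0, hn⟩⟩
    have hmean : ∀ i, ∫ z, z ∂(D i) ≤ muMax D := fun i =>
      le_ciSup (f := fun i => ∫ z, z ∂(D i)) (Set.finite_range _).bddAbove i
    have hv : muMax D ≤ vmax := by
      refine ciSup_le fun i => ?_
      have h2 := integral_mono_ae (Integrable.of_mem_Icc 0 vmax aemeasurable_id (hD i))
        (integrable_const vmax) ((hD i).mono fun z hz => hz.2)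
      simpa using h2
    exact specification_of_lt_one hn hε h1 hμ hv hmean hD c
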